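/- Let $X$ be a compact connected Hausdorff second countable topological space. A simple curve in $X$ is the image of a continuous embedding (simple path) $[0,1]\to X$, its segments are the images of nondegenerate closed subintervals; a simple closed curve is the image of a continuous embedding $S^1\to X$, its segments are the images of nondegenerate proper closed arcs of $S^1$. Let $\mathcal E$ be a set of simple curves in $X$, called elementary curves, such that every segment of an elementary curve is elementary, and such that the union of two elementary curves whose intersection is a single point, an endpoint of both, is elementary. An elementary closed curve is a simple closed curve all of whose segments are elementary. An elementary quadrilateral $Q$ consists of an elementary closed curve $J$ (its boundary), one of the connected components of $X\setminus J$ (its interior, also denoted by $Q$), and four different points $a,b,c,d$ (the vertices) lying on $J$ in this circular order. They divide $J$ into closed segments $[a,b]$, $[b,c]$, $[c,d]$, $[d,a]$. A simple curve all of whose points other than the endpoints lie in the interior of $Q$ is called vertical if it connects a point of $[a,b]$ with a point of $[c,d]$, and horizontal if it connects a point of $[b,c]$ with a point of $[d,a]$. A grid in $Q$ consists of finitely many (possibly no) pairwise disjoint horizontal elementary curves and finitely many (possibly no) pairwise disjoint vertical elementary curves such that every horizontal curve of the grid meets every vertical one in exactly one point. The cells of the grid are the connected components of the complement in the interior of $Q$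 to the union of all these curves. Suppose that the following axioms hold. 1. (Jordan domain axiom) For every elementary closed curve $J$, the set $X\setminus J$ has exactly two connected components. 2. (Extension axiom) For every elementary quadrilateral and every point $x$ of its boundary that is not a vertex, there is a vertical or a horizontal elementary curve with an endpoint at $x$. 3. (Covering axiom) For every elementary quadrilateral $Q$ and every covering $\mathcal U$ of the closure $\overline Q$ of its interior by open sets, there is a grid in $Q$ such that the closure of every cell is contained in a single element of $\mathcal U$. Suppose also that there exists an elementary closed curve in $X$. Then $X$ is homeomorphic to the $2$-sphere. -/

import Mathlib

namespace Moore

/-- A simple path in `X`: a continuous embedding of `[0,1]`. -/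
def IsSimplePath {X : Type*} [TopologicalSpace X] (γ : unitInterval → X) : Prop :=
  Topology.IsEmbedding γ

/-- A simple curve: the image of a simple path. -/
def IsSimpleCurve {X : Type*} [TopologicalSpace X] (A : Set X) : Prop :=
  ∃ γ : unitInterval → X, IsSimplePath γ ∧ Set.range γ = A

/-- `x` is an endpoint of the simple curve `A`. -/
def IsEndpoint {X : Type*} [TopologicalSpace X] (x : X) (A : Set X) : Prop :=
  ∃ γ : unitInterval → X, IsSimplePath γ ∧ Set.range γ = A ∧ (x = γ 0 ∨ x = γ 1)

/-- `S` is a (nondegenerate) segment of the simple curve `A`. -/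
def IsSegment {X : Type*} [TopologicalSpace X] (S A : Set X) : Prop :=
  ∃ γ : unitInterval → X, IsSimplePath γ ∧ Set.range γ = A ∧
    ∃ s t : unitInterval, s < t ∧ S = γ '' Set.Icc s t

/-- A simple closed path in `X`: a continuous embedding of the circle. -/
def IsSimpleClosedPath {X : Type*} [TopologicalSpace X] (γ : Circle → X) : Prop :=
  Topology.IsEmbedding γ

/-- A simple closed curve: the image of a simple closed path. -/
def IsSimpleClosedCurve {X : Type*} [TopologicalSpace X] (J : Set X) : Prop :=
  ∃ γ : Circle → X, IsSimpleClosedPath γ ∧ Set.range γ = J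

/-- The image under `γ : Circle → X` of the arc `{exp (i u) : s ≤ u ≤ t}`. -/
def arcImage {X : Type*} (γ : Circle → X) (s t : ℝ) : Set X :=
  (fun u : ℝ => γ (Circle.exp u)) '' Set.Icc s t

/-- `S` is a segment of the simple closed curve `J`: the image of a nondegenerate
proper closed arc of the circle. -/
def IsClosedCurveSegment {X : Type*} [TopologicalSpace X] (S J : Set X) : Prop :=
  ∃ γ : Circle → X, IsSimpleClosedPath γ ∧ Set.range γ = J ∧
    ∃ s t : ℝ, s < t ∧ t < s + 2 * Real.pi ∧ S = arcImage γ s t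

/-- The set of connected components of the subspace `S`, as subsets of `X`. -/
def components {X : Type*} [TopologicalSpace X] (S : Set X) : Set (Set X) :=
  {C | ∃ x ∈ S, C = connectedComponentIn S x}

/-- The standing assumptions on a set `E` of elementary curves: its members are simple
curves, segments of members are members, and if two members have exactly one point in
common, an endpoint of both, then their union is a member. -/
structure IsElementaryFamily {X : Type*} [TopologicalSpace X] (E : Set (Set X)) : Prop where
  isSimpleCurve : ∀ A ∈ E, IsSimpleCurve A
  segment_mem : ∀ A ∈ E, ∀ S : Set X, IsSegment S A → S ∈ E
  union_mem : ∀ A ∈ E, ∀ B ∈ E, ∀ x : X, IsEndpoint x A → IsEndpoint x B →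
    A ∩ B = {x} → A ∪ B ∈ E

/-- An elementary closed curve: a simple closed curve all of whose segments are
elementary curves. -/
def IsElementaryClosedCurve {X : Type*} [TopologicalSpace X] (E : Set (Set X))
    (J : Set X) : Prop :=
  IsSimpleClosedCurve J ∧ ∀ S : Set X, IsClosedCurveSegment S J → S ∈ E

/-- Jordan domain axiom: the complement of every elementary closed curve has exactly two
connected components. -/
def JordanDomainAxiom {X : Type*} [TopologicalSpace X] (E : Set (Set X)) : Prop :=
  ∀ J : Set X, IsElementaryClosedCurve E J → (components Jᶜ).encard = 2

/-- A topological quadrilateral: one of the domains cut out by a simple closed curve `J`,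
the image of `path`, together with four different points on `J` positioned in this order,
namely the images of `exp (i ta)`, `exp (i tb)`, `exp (i tc)`, `exp (i td)`. -/
structure Quadrilateral (X : Type*) [TopologicalSpace X] where
  path : Circle → X
  isSimpleClosedPath : IsSimpleClosedPath path
  ta : ℝ
  tb : ℝ
  tc : ℝ
  td : ℝ
  ta_lt_tb : ta < tb
  tb_lt_tc : tb < tc
  tc_lt_td : tc < td
  td_lt : td < ta + 2 * Real.pi
  interior : Set X
  interior_mem : interior ∈ components (Set.range path)ᶜ

namespace Quadrilateral

/-- The bounding curve of a quadrilateral. -/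
def boundary {X : Type*} [TopologicalSpace X] (Q : Quadrilateral X) : Set X :=
  Set.range Q.path

/-- The four vertices `a`, `b`, `c`, `d`. -/
def vertices {X : Type*} [TopologicalSpace X] (Q : Quadrilateral X) : Set X :=
  {Q.path (Circle.exp Q.ta), Q.path (Circle.exp Q.tb),
    Q.path (Circle.exp Q.tc), Q.path (Circle.exp Q.td)}

/-- The side `[a,b]`. -/
def sideAB {X : Type*} [TopologicalSpace X] (Q : Quadrilateral X) : Set X :=
  arcImage Q.path Q.ta Q.tb

/-- The side `[b,c]`. -/
def sideBC {X : Type*} [TopologicalSpace X] (Q : Quadrilateral X) : Set X :=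
  arcImage Q.path Q.tb Q.tc

/-- The side `[c,d]`. -/
def sideCD {X : Type*} [TopologicalSpace X] (Q : Quadrilateral X) : Set X :=
  arcImage Q.path Q.tc Q.td

/-- The side `[d,a]`. -/
def sideDA {X : Type*} [TopologicalSpace X] (Q : Quadrilateral X) : Set X :=
  arcImage Q.path Q.td (Q.ta + 2 * Real.pi)

/-- An elementary quadrilateral: its bounding curve is an elementary closed curve. -/
def IsElementary {X : Type*} [TopologicalSpace X] (E : Set (Set X))
    (Q : Quadrilateral X) : Prop :=
  IsElementaryClosedCurve E Q.boundary

/-- `A` is a simple curve with one endpoint in `S`, the other endpoint in `T`, and whose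
interior lies in the interior of `Q`. -/
def Crosses {X : Type*} [TopologicalSpace X] (Q : Quadrilateral X) (S T A : Set X) : Prop :=
  ∃ γ : unitInterval → X, IsSimplePath γ ∧ Set.range γ = A ∧ γ 0 ∈ S ∧ γ 1 ∈ T ∧
    ∀ t : unitInterval, 0 < t → t < 1 → γ t ∈ Q.interior

/-- A vertical curve of `Q` connects `[a,b]` with `[c,d]` through the interior. -/
def IsVertical {X : Type*} [TopologicalSpace X] (Q : Quadrilateral X) (A : Set X) : Prop :=
  Q.Crosses Q.sideAB Q.sideCD A

/-- A horizontal curve of `Q` connects `[b,c]` with `[d,a]` through the interior. -/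
def IsHorizontal {X : Type*} [TopologicalSpace X] (Q : Quadrilateral X) (A : Set X) : Prop :=
  Q.Crosses Q.sideBC Q.sideDA A

end Quadrilateral

/-- Extension axiom: for every elementary quadrilateral and every point `x` of its boundary
that is not a vertex, there is a vertical or a horizontal elementary curve with an
endpoint at `x`. -/
def ExtensionAxiom {X : Type*} [TopologicalSpace X] (E : Set (Set X)) : Prop :=
  ∀ Q : Quadrilateral X, Q.IsElementary E → ∀ x ∈ Q.boundary, x ∉ Q.vertices →
    ∃ A ∈ E, (Q.IsVertical A ∨ Q.IsHorizontal A) ∧ IsEndpoint x A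

/-- A grid in the quadrilateral `Q`: finitely many pairwise disjoint horizontal elementary
curves and finitely many pairwise disjoint vertical elementary curves, such that every
horizontal curve meets every vertical curve in exactly one point. -/
structure Grid {X : Type*} [TopologicalSpace X] (E : Set (Set X)) (Q : Quadrilateral X) where
  horizontal : Set (Set X)
  vertical : Set (Set X)
  finite_horizontal : horizontal.Finite
  finite_vertical : vertical.Finite
  horizontal_mem : ∀ A ∈ horizontal, A ∈ E ∧ Q.IsHorizontal A
  vertical_mem : ∀ A ∈ vertical, A ∈ E ∧ Q.IsVertical A
  disjoint_horizontal : ∀ A ∈ horizontal, ∀ B ∈ horizontal, A ≠ B → Disjoint A B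
  disjoint_vertical : ∀ A ∈ vertical, ∀ B ∈ vertical, A ≠ B → Disjoint A B
  meet : ∀ A ∈ horizontal, ∀ B ∈ vertical, ∃ x : X, A ∩ B = {x}

/-- The cells of a grid: the pieces into which the curves of the grid divide the interior
of the quadrilateral. -/
def Grid.cells {X : Type*} [TopologicalSpace X] {E : Set (Set X)} {Q : Quadrilateral X}
    (G : Grid E Q) : Set (Set X) :=
  components (Q.interior \ (⋃₀ G.horizontal ∪ ⋃₀ G.vertical))

/-- Covering axiom: for every elementary quadrilateral and every open covering of its
closure there is a grid such that the closure of every cell is contained in a single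
element of the covering. -/
def CoveringAxiom {X : Type*} [TopologicalSpace X] (E : Set (Set X)) : Prop :=
  ∀ Q : Quadrilateral X, Q.IsElementary E → ∀ 𝒰 : Set (Set X), (∀ U ∈ 𝒰, IsOpen U) →
    closure Q.interior ⊆ ⋃₀ 𝒰 →
      ∃ G : Grid E Q, ∀ K ∈ G.cells, ∃ U ∈ 𝒰, closure K ⊆ U

end Moore

set_option linter.unusedSectionVars false

open Set Topology


namespace Moore

/-! The sphere is assembled from two closed discs glued along an elementary closed curve `J`. By the
Jordan domain axiom `J` bounds exactly two domains, and the work lies in showing that the closure of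
each is a closed disc whose boundary circle is `J`.

Planar topology comes from two of the axioms alone. The extension axiom supplies crosscuts from
every boundary point of a domain, so that the whole of `J` is the frontier of each of its two
domains. From this follows the theta lemma (`theta`): a crosscut divides a domain into exactly two
domains, bounded by the two evident closed curves. Hence quadrilaterals can be cut along lines into
smaller quadrilaterals. Induction on the number of curves then gives a separation principle
(`joined_diff_biUnion`, `Web.joined`): in a grid, two points that no single line separates are not
separated by all the lines together. Cells are therefore described by the sides of the individual
lines on which they lie.

The covering axiom, applied to small balls, now gives grids of small mesh: points on the same side
of every line are close. Deleting a line at most doubles the mesh (`Mesh.diff`), so lines through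
vertices may be dropped; what remains is called a net. Every line of a net of one half can be
prolonged through a net of the other half (`exists_horiz`), so refinements of two halves can be
matched along the cut, and any net extends to one of arbitrarily small mesh (`exists_refine`).
Iteration yields an increasing sequence of nets with mesh tending to zero.

In the union of these nets a vertical line is labelled by the parameter of its foot on the bottom
side, and the horizontal coordinate of a point is the supremum of the labels of the lines that have
it on their right. The labels are dense in the unit interval, which makes the coordinate continuous.
Two points with equal coordinates lie on the same side of all lines but at most one vertical and one
horizontal one; by the doubling estimate they coincide. Intersections of lines have a dense set of
coordinate pairs, so by compactness every pair occurs. Thus the closed quadrilateral is a square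
(`Quad.exists_square`), hence a disc. Radial extension makes the two disc parametrizations agree on
`J`, and the discs become the two hemispheres. -/

/-- `A` is an arc from `p` to `q`. -/
def IsArc {X : Type*} [TopologicalSpace X] (p q : X) (A : Set X) : Prop :=
  ∃ γ : unitInterval → X, IsSimplePath γ ∧ γ 0 = p ∧ γ 1 = q ∧ range γ = A

/-! ### Arcs: cutting, concatenation and subarcs -/

section Arc

variable {X : Type*} [TopologicalSpace X] [T2Space X] {p q r x y u v : X} {A B C S : Set X}

theorem isArc_of_continuous {f : ℝ → X} (hc : Continuous f) (hi : InjOn f (Icc 0 1)) :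
    IsArc (f 0) (f 1) (f '' Icc 0 1) := by
  refine ⟨fun t => f t, ?_, rfl, rfl, ?_⟩
  · refine (Continuous.isClosedEmbedding (hc.comp continuous_subtype_val) ?_).isEmbedding
    intro a b hab
    exact Subtype.ext (hi a.2 b.2 hab)
  · ext z
    simp [unitInterval]

theorem isArc_image {f : ℝ → X} {s t : ℝ} (hst : s < t) (hc : ContinuousOn f (Icc s t))
    (hi : InjOn f (Icc s t)) : IsArc (f s) (f t) (f '' Icc s t) := by
  have hc' : Continuous (IccExtend hst.le ((Icc s t).domRestrict f)) :=
    hc.domRestrict.Icc_extend'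
  have key : ∀ u ∈ Icc s t, IccExtend hst.le ((Icc s t).domRestrict f) u = f u := by
    intro u hu
    rw [IccExtend_of_mem _ _ hu]
    rfl
  have hm : ∀ u ∈ Icc (0 : ℝ) 1, s + u * (t - s) ∈ Icc s t := by
    intro u hu
    constructor <;> nlinarith [hu.1, hu.2]
  have h := isArc_of_continuous
    (f := fun u => IccExtend hst.le ((Icc s t).domRestrict f) (s + u * (t - s)))
    (hc'.comp (by fun_prop)) (by
      intro a ha b hb hab
      simp only [key _ (hm a ha), key _ (hm b hb)] at hab
      have := hi (hm a ha) (hm b hb) hab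
      have h2 : (a - b) * (t - s) = 0 := by linarith
      rcases mul_eq_zero.1 h2 with h | h <;> linarith)
  have e0 : IccExtend hst.le ((Icc s t).domRestrict f) (s + 0 * (t - s)) = f s := by
    rw [key _ (hm 0 (by simp))]; simp
  have e1 : IccExtend hst.le ((Icc s t).domRestrict f) (s + 1 * (t - s)) = f t := by
    rw [key _ (hm 1 (by simp))]; simp
  have e2 : (fun u => IccExtend hst.le ((Icc s t).domRestrict f) (s + u * (t - s))) '' Icc 0 1
      = f '' Icc s t := by
    ext z
    constructor
    · rintro ⟨u, hu, rfl⟩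
      exact ⟨_, hm u hu, (key _ (hm u hu)).symm⟩
    · rintro ⟨w, hw, rfl⟩
      have hpos : 0 < t - s := by linarith
      have hu : (w - s) / (t - s) ∈ Icc (0 : ℝ) 1 :=
        ⟨div_nonneg (by linarith [hw.1]) hpos.le, (div_le_one hpos).2 (by linarith [hw.2])⟩
      refine ⟨(w - s) / (t - s), hu, ?_⟩
      have : s + (w - s) / (t - s) * (t - s) = w := by
        rw [div_mul_cancel₀ _ hpos.ne']; ring
      simp only [this, key _ hw]
  simp only [e0, e1, e2] at h
  exact h

/-- A parametrization continuous on all of `ℝ` and injective only on the unit interval avoids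
subtypes when arcs are cut or joined. -/
theorem IsArc.exists_real (h : IsArc p q A) : ∃ f : ℝ → X, Continuous f ∧ InjOn f (Icc 0 1) ∧
    f 0 = p ∧ f 1 = q ∧ f '' Icc 0 1 = A := by
  obtain ⟨γ, hγ, h0, h1, hA⟩ := h
  refine ⟨IccExtend zero_le_one γ, hγ.continuous.Icc_extend', ?_, ?_, ?_, ?_⟩
  · intro a ha b hb hab
    rw [IccExtend_of_mem _ _ ha, IccExtend_of_mem _ _ hb] at hab
    exact congrArg Subtype.val (hγ.injective hab)
  · rw [IccExtend_of_mem _ _ (by simp)]; exact h0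
  · rw [IccExtend_of_mem _ _ (by simp)]; exact h1
  · rw [← hA, ← IccExtend_range zero_le_one γ]
    apply (image_subset_range _ _).antisymm
    rintro _ ⟨t, rfl⟩
    refine ⟨projIcc 0 1 zero_le_one t, (projIcc 0 1 zero_le_one t).2, ?_⟩
    simp [IccExtend]

theorem IsArc.symm (h : IsArc p q A) : IsArc q p A := by
  obtain ⟨γ, hγ, h0, h1, hA⟩ := h
  refine ⟨γ ∘ unitInterval.symm, hγ.comp unitInterval.symmHomeomorph.isEmbedding, ?_, ?_, ?_⟩
  · simpa using h1
  · simpa using h0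
  · rw [unitInterval.symm_bijective.surjective.range_comp]; exact hA

theorem IsArc.left_mem (h : IsArc p q A) : p ∈ A := by
  obtain ⟨γ, hγ, h0, h1, hA⟩ := h
  exact hA ▸ h0 ▸ mem_range_self _

theorem IsArc.right_mem (h : IsArc p q A) : q ∈ A := by
  obtain ⟨γ, hγ, h0, h1, hA⟩ := h
  exact hA ▸ h1 ▸ mem_range_self _

theorem IsArc.ne (h : IsArc p q A) : p ≠ q := by
  obtain ⟨γ, hγ, h0, h1, hA⟩ := h
  rw [← h0, ← h1]
  exact fun h => zero_ne_one (hγ.injective h)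

theorem IsArc.isCompact (h : IsArc p q A) : IsCompact A := by
  obtain ⟨γ, hγ, h0, h1, hA⟩ := h
  exact hA ▸ isCompact_range hγ.continuous

theorem IsArc.isClosed (h : IsArc p q A) : IsClosed A := h.isCompact.isClosed

theorem IsArc.isPreconnected (h : IsArc p q A) : IsPreconnected A := by
  obtain ⟨γ, hγ, h0, h1, hA⟩ := h
  exact hA ▸ isPreconnected_range hγ.continuous

theorem image_Icc_diff {f : ℝ → X} {s t : ℝ} (hst : s < t) (hi : InjOn f (Icc s t)) :
    f '' Icc s t \ {f s, f t} = f '' Ioo s t := by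
  rw [← image_pair, ← hi.image_sdiff_subset, Icc_sdiff_both]
  rintro z (rfl | rfl)
  · exact ⟨le_rfl, hst.le⟩
  · exact ⟨hst.le, le_rfl⟩

theorem image_Icc_diff_left {f : ℝ → X} {s t : ℝ} (hst : s < t) (hi : InjOn f (Icc s t)) :
    f '' Icc s t \ {f s} = f '' Ioc s t := by
  rw [← image_singleton, ← hi.image_sdiff_subset, Icc_sdiff_left]
  rintro z rfl
  exact ⟨le_rfl, hst.le⟩

theorem IsArc.isPreconnected_diff (h : IsArc p q A) : IsPreconnected (A \ {p, q}) := by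
  obtain ⟨f, hc, hi, h0, h1, hA⟩ := h.exists_real
  subst h0 h1 hA
  rw [image_Icc_diff zero_lt_one hi]
  exact isPreconnected_Ioo.image _ hc.continuousOn

theorem IsArc.isPreconnected_diff_left (h : IsArc p q A) : IsPreconnected (A \ {p}) := by
  obtain ⟨f, hc, hi, h0, h1, hA⟩ := h.exists_real
  subst h0 h1 hA
  rw [image_Icc_diff_left zero_lt_one hi]
  exact isPreconnected_Ioc.image _ hc.continuousOn

theorem IsArc.isPreconnected_diff_right (h : IsArc p q A) : IsPreconnected (A \ {q}) :=
  h.symm.isPreconnected_diff_left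

theorem IsArc.nonempty_diff (h : IsArc p q A) : (A \ {p, q}).Nonempty := by
  obtain ⟨f, hc, hi, h0, h1, hA⟩ := h.exists_real
  subst h0 h1 hA
  rw [image_Icc_diff zero_lt_one hi]
  exact (nonempty_Ioo.2 zero_lt_one).image _

theorem IsArc.subset_closure (h : IsArc p q A) : A ⊆ closure (A \ {p, q}) := by
  obtain ⟨f, hc, hi, h0, h1, hA⟩ := h.exists_real
  subst h0 h1 hA
  rw [image_Icc_diff zero_lt_one hi, ← closure_Ioo zero_ne_one]
  exact image_closure_subset_closure_image hc

theorem isClosed_closure_image {f : ℝ → X} {s t : ℝ} (hst : s < t)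
    (hc : ContinuousOn f (Icc s t)) : closure (f '' Ioo s t) = f '' Icc s t := by
  apply subset_antisymm
  · exact closure_minimal (image_mono Ioo_subset_Icc_self)
      (isCompact_Icc.image_of_continuousOn hc).isClosed
  · rw [← closure_Ioo hst.ne] at hc ⊢
    exact hc.image_closure

/-- Cutting an arc at an interior point. -/
theorem IsArc.split (h : IsArc p q A) (hx : x ∈ A) (hxp : x ≠ p) (hxq : x ≠ q) :
    ∃ A₁ A₂ : Set X, IsArc p x A₁ ∧ IsArc x q A₂ ∧ A₁ ∪ A₂ = A ∧ A₁ ∩ A₂ = {x} ∧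
      IsSegment A₁ A ∧ IsSegment A₂ A := by
  obtain ⟨γ, hγ, g0, g1, gA⟩ := id h
  obtain ⟨f, hc, hi, h0, h1, hA⟩ : ∃ f : ℝ → X, Continuous f ∧ InjOn f (Icc 0 1) ∧
    f 0 = p ∧ f 1 = q ∧ f '' Icc 0 1 = A := h.exists_real
  subst h0 h1 hA
  obtain ⟨s, hs, rfl⟩ := hx
  have hs0 : 0 < s := lt_of_le_of_ne hs.1 (by rintro rfl; exact hxp rfl)
  have hs1 : s < 1 := lt_of_le_of_ne hs.2 (by rintro rfl; exact hxq rfl)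
  have hseg : ∀ a b : ℝ, 0 ≤ a → a < b → b ≤ 1 → IsSegment (f '' Icc a b) (f '' Icc 0 1) := by
    intro a b ha hab hb
    refine ⟨fun t => f t, ?_, ?_, ⟨a, ha, hab.le.trans hb⟩, ⟨b, ha.trans hab.le, hb⟩, hab, ?_⟩
    · refine (Continuous.isClosedEmbedding (hc.comp continuous_subtype_val) ?_).isEmbedding
      intro a b hab
      exact Subtype.ext (hi a.2 b.2 hab)
    · ext z
      simp [unitInterval]
    · ext z
      constructor
      · rintro ⟨u, hu, rfl⟩
        exact ⟨⟨u, ha.trans hu.1, hu.2.trans hb⟩, hu, rfl⟩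
      · rintro ⟨u, hu, rfl⟩
        exact ⟨u, hu, rfl⟩
  refine ⟨f '' Icc 0 s, f '' Icc s 1, isArc_image hs0 hc.continuousOn
    (hi.mono (Icc_subset_Icc_right hs1.le)), isArc_image hs1 hc.continuousOn
    (hi.mono (Icc_subset_Icc_left hs0.le)), ?_, ?_, hseg _ _ le_rfl hs0 hs1.le,
    hseg _ _ hs0.le hs1 le_rfl⟩
  · rw [← image_union, Icc_union_Icc_eq_Icc hs0.le hs1.le]
  · rw [← hi.image_inter (Icc_subset_Icc_right hs1.le) (Icc_subset_Icc_left hs0.le),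
      Icc_inter_Icc_eq_singleton hs0.le hs1.le, image_singleton]

/-- Arcs with one common end point can be concatenated. -/
theorem IsArc.concat (h : IsArc p q A) (h' : IsArc q r B) (hAB : A ∩ B = {q}) :
    IsArc p r (A ∪ B) := by
  obtain ⟨f, hc, hi, h0, h1, hA⟩ := h.exists_real
  obtain ⟨g, kc, ki, k0, k1, kB⟩ := h'.exists_real
  set F : ℝ → X := fun t => if t ≤ 1 then f t else g (t - 1) with hF
  have hFc : Continuous F := by
    refine Continuous.if_le hc (kc.comp (by fun_prop)) continuous_id continuous_const ?_
    intro t ht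
    change t = 1 at ht
    rw [ht, h1, sub_self, k0]
  have F1 : ∀ t ∈ Icc (0 : ℝ) 1, F t = f t := fun t ht => if_pos ht.2
  have F2 : ∀ t ∈ Icc (1 : ℝ) 2, F t = g (t - 1) := by
    intro t ht
    by_cases h : t ≤ 1
    · have : t = 1 := le_antisymm h ht.1
      simp [hF, this, h1, k0]
    · exact if_neg h
  have i1 : F '' Icc 0 1 = A := by rw [← hA]; exact image_congr F1
  have i2 : F '' Icc 1 2 = B := by
    rw [← kB, image_congr F2]
    have : (fun t : ℝ => t - 1) '' Icc 1 2 = Icc 0 1 := by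
      rw [image_sub_const_Icc]; norm_num
    rw [← this, image_image]
  have hinj : InjOn F (Icc 0 2) := by
    have i1' : InjOn F (Icc 0 1) := hi.congr (fun t ht => (F1 t ht).symm)
    have i2' : InjOn F (Icc 1 2) := by
      intro a ha b hb hab
      rw [F2 a ha, F2 b hb] at hab
      have := ki ⟨by linarith [ha.1], by linarith [ha.2]⟩
        ⟨by linarith [hb.1], by linarith [hb.2]⟩ hab
      linarith
    have F11 : F 1 = q := by rw [F1 1 (by simp), h1]
    have key : ∀ a ∈ Icc (0:ℝ) 1, ∀ b ∈ Icc (1 : ℝ) 2, F a = F b → a = b := by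
      intro a ha b hb hab
      have : F a ∈ A ∩ B := ⟨i1 ▸ mem_image_of_mem F ha, hab ▸ i2 ▸ mem_image_of_mem F hb⟩
      rw [hAB, mem_singleton_iff, ← F11] at this
      have e1 := i1' ha (by simp) this
      have e2 := i2' hb (by simp) (hab ▸ this)
      rw [e1, e2]
    intro a ha b hb hab
    rcases le_total a 1 with h | h <;> rcases le_total b 1 with h' | h'
    · exact i1' ⟨ha.1, h⟩ ⟨hb.1, h'⟩ hab
    · exact key a ⟨ha.1, h⟩ b ⟨h', hb.2⟩ hab
    · exact (key b ⟨hb.1, h'⟩ a ⟨h, ha.2⟩ hab.symm).symm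
    · exact i2' ⟨h, ha.2⟩ ⟨h', hb.2⟩ hab
  have := isArc_image (by norm_num : (0 : ℝ) < 2) hFc.continuousOn hinj
  rw [F1 0 (by simp), F2 2 (by norm_num), h0, show (2 : ℝ) - 1 = 1 by norm_num, k1,
    ← Icc_union_Icc_eq_Icc zero_le_one one_le_two, image_union, i1, i2] at this
  exact this

/-- An arc contained in another arc is a segment of it. -/
theorem IsArc.isSegment (h : IsArc u v S) (hC : IsArc x y C) (hSC : S ⊆ C) : IsSegment S C := by
  obtain ⟨γ, hγ, h0, h1, hC'⟩ := hC
  have himg : γ '' (γ ⁻¹' S) = S := by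
    rw [image_preimage_eq_inter_range, hC', inter_eq_left.2 hSC]
  have hcomp : IsCompact (γ ⁻¹' S) := (h.isClosed.preimage hγ.continuous).isCompact
  have hconn : IsConnected (γ ⁻¹' S) := by
    refine ⟨?_, ?_⟩
    · obtain ⟨t, ht⟩ := hC'.symm ▸ hSC h.left_mem
      exact ⟨t, by simpa [ht] using h.left_mem⟩
    · rw [← hγ.isInducing.isPreconnected_image, himg]
      exact h.isPreconnected
  have hI := eq_Icc_of_connected_compact hconn hcomp
  refine ⟨γ, hγ, hC', sInf (γ ⁻¹' S), sSup (γ ⁻¹' S), ?_, ?_⟩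
  · by_contra hlt
    have hsub : (γ ⁻¹' S).Subsingleton := by
      rw [hI]; exact subsingleton_Icc_of_ge (not_lt.1 hlt)
    have : S.Subsingleton := himg ▸ hsub.image γ
    exact h.ne (this h.left_mem h.right_mem)
  · rw [← hI, himg]

/-- Connected subsets of an arc have a connected intersection. -/
theorem IsArc.isPreconnected_inter (h : IsArc p q A) (hB : IsPreconnected B)
    (hC : IsPreconnected C) (hBA : B ⊆ A) (hCA : C ⊆ A) : IsPreconnected (B ∩ C) := by
  obtain ⟨γ, hγ, h0, h1, hA⟩ := h
  have key : ∀ D, IsPreconnected D → D ⊆ A → γ '' (γ ⁻¹' D) = D ∧ OrdConnected (γ ⁻¹' D) := by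
    intro D hD hDA
    have himg : γ '' (γ ⁻¹' D) = D := by
      rw [image_preimage_eq_inter_range, hA, inter_eq_left.2 hDA]
    refine ⟨himg, IsPreconnected.ordConnected ?_⟩
    rwa [← hγ.isInducing.isPreconnected_image, himg]
  obtain ⟨e1, o1⟩ := key B hB hBA
  obtain ⟨e2, o2⟩ := key C hC hCA
  rw [← e1, ← e2, ← image_inter hγ.injective]
  exact (o1.inter o2).isPreconnected.image _ hγ.continuous.continuousOn

end Arc

/-! ### Elementary arcs -/

/-- `A` is an elementary arc from `p` to `q`. -/
def EArc {X : Type*} [TopologicalSpace X] (E : Set (Set X)) (p q : X) (A : Set X) : Prop :=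
  A ∈ E ∧ IsArc p q A

section EArc

variable {X : Type*} [TopologicalSpace X] [T2Space X] {E : Set (Set X)} {p q r x y u v : X}
  {A B C S : Set X}

theorem EArc.symm (h : EArc E p q A) : EArc E q p A := ⟨h.1, h.2.symm⟩

theorem EArc.split (hE : IsElementaryFamily E) (h : EArc E p q A) (hx : x ∈ A) (hxp : x ≠ p)
    (hxq : x ≠ q) : ∃ A₁ A₂ : Set X, EArc E p x A₁ ∧ EArc E x q A₂ ∧ A₁ ∪ A₂ = A ∧
      A₁ ∩ A₂ = {x} := by
  obtain ⟨A₁, A₂, h1, h2, h3, h4, h5, h6⟩ := h.2.split hx hxp hxq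
  exact ⟨A₁, A₂, ⟨hE.segment_mem _ h.1 _ h5, h1⟩, ⟨hE.segment_mem _ h.1 _ h6, h2⟩, h3, h4⟩

theorem EArc.concat (hE : IsElementaryFamily E) (h : EArc E p q A) (h' : EArc E q r B)
    (hAB : A ∩ B = {q}) : EArc E p r (A ∪ B) := by
  refine ⟨hE.union_mem _ h.1 _ h'.1 q ?_ ?_ hAB, h.2.concat h'.2 hAB⟩
  · obtain ⟨γ, h1, h2, h3, h4⟩ := h.2
    exact ⟨γ, h1, h4, Or.inr h3.symm⟩
  · obtain ⟨γ, h1, h2, h3, h4⟩ := h'.2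
    exact ⟨γ, h1, h4, Or.inl h2.symm⟩

theorem EArc.of_subset (hE : IsElementaryFamily E) (h : EArc E x y C) (h' : IsArc u v S)
    (hSC : S ⊆ C) : EArc E u v S := ⟨hE.segment_mem _ h.1 _ (h'.isSegment h.2 hSC), h'⟩

end EArc


/-! ### Closed curves composed of two elementary arcs -/

section Loop

variable {X : Type*} [TopologicalSpace X] [T2Space X] {E : Set (Set X)} {p q r x y u v : X}
  {A B C S J U V N : Set X}

theorem circle_exp_injOn (s : ℝ) : InjOn Circle.exp (Ico s (s + 2 * Real.pi)) := by
  intro a ha b hb hab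
  obtain ⟨m, hm⟩ := Circle.exp_eq_exp.1 hab
  have hpi := Real.pi_pos
  have h1 : (m : ℝ) < 1 := by
    by_contra h
    nlinarith [ha.1, ha.2, hb.1, hb.2]
  have h2 : (-1 : ℝ) < m := by
    by_contra h
    nlinarith [ha.1, ha.2, hb.1, hb.2]
  have h3 : m = 0 := by
    have h1' : m < 1 := by exact_mod_cast h1
    have h2' : -1 < m := by exact_mod_cast h2
    omega
  rw [hm, h3]; simp

theorem exists_circle_exp (s : ℝ) (z : Circle) :
    ∃ t ∈ Ico s (s + 2 * Real.pi), Circle.exp t = z := by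
  refine ⟨toIcoMod Real.two_pi_pos s (Complex.arg z), toIcoMod_mem_Ico _ _ _, ?_⟩
  rw [← Circle.exp_arg z, Circle.exp_eq_exp]
  refine ⟨-toIcoDiv Real.two_pi_pos s (Complex.arg z), ?_⟩
  rw [Circle.exp_arg, toIcoMod]
  push_cast
  simp only [zsmul_eq_mul]
  ring

theorem isArc_arcImage {γ : Circle → X} (hγ : IsSimpleClosedPath γ) {s t : ℝ} (hst : s < t)
    (ht : t < s + 2 * Real.pi) :
    IsArc (γ (Circle.exp s)) (γ (Circle.exp t)) (arcImage γ s t) := by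
  refine isArc_image (f := fun u => γ (Circle.exp u)) hst
    (hγ.continuous.comp Circle.exp.continuous).continuousOn ?_
  intro a ha b hb hab
  exact circle_exp_injOn s ⟨ha.1, ha.2.trans_lt ht⟩ ⟨hb.1, hb.2.trans_lt ht⟩
    (hγ.injective hab)

/-- `A` and `B` are elementary arcs from `p` to `q` that form a simple closed curve. -/
structure Loop {X : Type*} [TopologicalSpace X] (E : Set (Set X)) (p q : X) (A B : Set X) :
    Prop where
  left : EArc E p q A
  right : EArc E p q B
  inter : A ∩ B = {p, q}

theorem Loop.swap (h : Loop E p q A B) : Loop E p q B A :=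
  ⟨h.right, h.left, by rw [inter_comm, h.inter]⟩

theorem Loop.symm (h : Loop E p q A B) : Loop E q p A B :=
  ⟨h.left.symm, h.right.symm, by rw [h.inter, pair_comm]⟩

/-- Moving a base point of a loop. -/
theorem Loop.of_split (hE : IsElementaryFamily E) (h : Loop E p q A B) {A₁ A₂ : Set X}
    (h1 : EArc E p x A₁) (h2 : EArc E x q A₂) (h3 : A₁ ∪ A₂ = A) (h4 : A₁ ∩ A₂ = {x}) :
    Loop E p x A₁ (B ∪ A₂) ∧ Loop E x q A₂ (A₁ ∪ B) := by
  have hi := h.inter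
  have hp1 := h1.2.left_mem
  have hq2 := h2.2.right_mem
  have hp2 : p ∉ A₂ := fun hp => h1.2.ne (by
    have : p ∈ A₁ ∩ A₂ := ⟨hp1, hp⟩
    rw [h4] at this; exact this)
  have hq1 : q ∉ A₁ := fun hq => h2.2.ne (by
    have : q ∈ A₁ ∩ A₂ := ⟨hq, hq2⟩
    rw [h4] at this; exact this.symm)
  have e1 : A₁ ∩ B = {p} := by
    ext z
    constructor
    · rintro ⟨hz1, hz2⟩
      have : z ∈ A ∩ B := ⟨h3 ▸ Or.inl hz1, hz2⟩
      rw [hi] at this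
      rcases this with rfl | rfl
      · rfl
      · exact absurd hz1 hq1
    · rintro rfl
      exact ⟨hp1, h.right.2.left_mem⟩
  have e2 : A₂ ∩ B = {q} := by
    ext z
    constructor
    · rintro ⟨hz1, hz2⟩
      have : z ∈ A ∩ B := ⟨h3 ▸ Or.inr hz1, hz2⟩
      rw [hi] at this
      rcases this with rfl | rfl
      · exact absurd hz1 hp2
      · rfl
    · rintro rfl
      exact ⟨hq2, h.right.2.right_mem⟩
  refine ⟨⟨h1, ?_, ?_⟩, ⟨h2, ?_, ?_⟩⟩
  · exact h.right.concat hE h2.symm (by rw [inter_comm, e2])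
  · rw [inter_union_distrib_left, e1, h4]; rfl
  · exact h1.symm.concat hE h.right e1
  · rw [inter_union_distrib_left, inter_comm A₂, h4, e2]; rfl

/-- The upper half circle runs along `A` and the lower one backwards along `B`, which places `p` at
angle 0 and `q` at angle π. -/
theorem Loop.exists_path (h : Loop E p q A B) : ∃ γ : Circle → X, IsSimpleClosedPath γ ∧
    range γ = A ∪ B ∧ γ (Circle.exp 0) = p ∧ γ (Circle.exp Real.pi) = q ∧
    arcImage γ 0 Real.pi = A ∧ arcImage γ Real.pi (2 * Real.pi) = B := by
  obtain ⟨f, hc, hi, h0, h1, hA⟩ := h.left.2.exists_real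
  obtain ⟨g, kc, ki, k0, k1, kB⟩ := h.right.2.exists_real
  have hpi := Real.pi_pos
  set F : ℝ → X := fun t => if t ≤ Real.pi then f (t / Real.pi)
    else g ((2 * Real.pi - t) / Real.pi) with hF
  have hFc : Continuous F := by
    refine Continuous.if_le (hc.comp (by fun_prop)) (kc.comp (by fun_prop)) continuous_id
      continuous_const ?_
    intro t ht
    change t = Real.pi at ht
    rw [ht, show (2 * Real.pi - Real.pi) / Real.pi = 1 by field_simp; ring, div_self hpi.ne',
      h1, k1]
  have F1 : ∀ t ∈ Icc 0 Real.pi, F t = f (t / Real.pi) := fun t ht => if_pos ht.2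
  have F2 : ∀ t ∈ Icc Real.pi (2 * Real.pi), F t = g ((2 * Real.pi - t) / Real.pi) := by
    intro t ht
    by_cases h : t ≤ Real.pi
    · have : t = Real.pi := le_antisymm h ht.1
      rw [F1 t ⟨hpi.le.trans ht.1, h⟩, this, div_self hpi.ne', h1,
        show (2 * Real.pi - Real.pi) / Real.pi = 1 by field_simp; ring, k1]
    · exact if_neg h
  have m1 : ∀ t ∈ Icc 0 Real.pi, t / Real.pi ∈ Icc (0 : ℝ) 1 := fun t ht =>
    ⟨div_nonneg ht.1 hpi.le, (div_le_one hpi).2 ht.2⟩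
  have m2 : ∀ t ∈ Icc Real.pi (2 * Real.pi), (2 * Real.pi - t) / Real.pi ∈ Icc (0 : ℝ) 1 :=
    fun t ht => ⟨div_nonneg (by linarith [ht.2]) hpi.le, (div_le_one hpi).2 (by linarith [ht.1])⟩
  have i1 : F '' Icc 0 Real.pi = A := by
    rw [← hA]
    ext z
    constructor
    · rintro ⟨t, ht, rfl⟩
      exact ⟨_, m1 t ht, (F1 t ht).symm⟩
    · rintro ⟨t, ht, rfl⟩
      have ht' : t * Real.pi ∈ Icc 0 Real.pi :=
        ⟨mul_nonneg ht.1 hpi.le, by nlinarith [ht.2]⟩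
      refine ⟨_, ht', ?_⟩
      rw [F1 _ ht', mul_div_cancel_right₀ _ hpi.ne']
  have i2 : F '' Icc Real.pi (2 * Real.pi) = B := by
    rw [← kB]
    ext z
    constructor
    · rintro ⟨t, ht, rfl⟩
      exact ⟨_, m2 t ht, (F2 t ht).symm⟩
    · rintro ⟨t, ht, rfl⟩
      have ht' : 2 * Real.pi - t * Real.pi ∈ Icc Real.pi (2 * Real.pi) :=
        ⟨by nlinarith [ht.2], by nlinarith [ht.1]⟩
      refine ⟨_, ht', ?_⟩
      rw [F2 _ ht', sub_sub_cancel, mul_div_cancel_right₀ _ hpi.ne']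
  have F0 : F 0 = p := by rw [F1 0 ⟨le_rfl, hpi.le⟩, zero_div, h0]
  have Fpi : F Real.pi = q := by rw [F1 _ ⟨hpi.le, le_rfl⟩, div_self hpi.ne', h1]
  have F2pi : F (2 * Real.pi) = p := by
    rw [F2 _ ⟨by linarith, le_rfl⟩, sub_self, zero_div, k0]
  have j1 : InjOn F (Icc 0 Real.pi) := by
    intro a ha b hb hab
    rw [F1 a ha, F1 b hb] at hab
    exact (div_left_inj' hpi.ne').1 (hi (m1 a ha) (m1 b hb) hab)
  have j2 : InjOn F (Icc Real.pi (2 * Real.pi)) := by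
    intro a ha b hb hab
    rw [F2 a ha, F2 b hb] at hab
    have := (div_left_inj' hpi.ne').1 (ki (m2 a ha) (m2 b hb) hab)
    linarith
  have hinj : InjOn F (Ico 0 (2 * Real.pi)) := by
    have key : ∀ a ∈ Icc 0 Real.pi, ∀ b ∈ Ico Real.pi (2 * Real.pi), F a = F b → a = b := by
      intro a ha b hb hab
      have hb' : b ∈ Icc Real.pi (2 * Real.pi) := ⟨hb.1, hb.2.le⟩
      have : F b ∈ A ∩ B := ⟨hab ▸ i1 ▸ mem_image_of_mem F ha, i2 ▸ mem_image_of_mem F hb'⟩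
      rw [h.inter] at this
      rcases this with e | e
      · rw [← F2pi] at e
        exact absurd (j2 hb' ⟨by linarith, le_rfl⟩ e) hb.2.ne
      · rw [mem_singleton_iff, ← Fpi] at e
        have e1 := j2 hb' ⟨le_rfl, by linarith⟩ e
        have e2 := j1 ha ⟨hpi.le, le_rfl⟩ (hab.trans e)
        rw [e1, e2]
    intro a ha b hb hab
    rcases le_total a Real.pi with h | h <;> rcases le_total b Real.pi with h' | h'
    · exact j1 ⟨ha.1, h⟩ ⟨hb.1, h'⟩ hab
    · exact key a ⟨ha.1, h⟩ b ⟨h', hb.2⟩ hab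
    · exact (key b ⟨hb.1, h'⟩ a ⟨h, ha.2⟩ hab.symm).symm
    · exact j2 ⟨h, ha.2.le⟩ ⟨h', hb.2.le⟩ hab
  have : Fact (0 < 2 * Real.pi) := ⟨Real.two_pi_pos⟩
  set γ : Circle → X := fun z =>
    AddCircle.liftIco (2 * Real.pi) 0 F (AddCircle.homeomorphCircle'.symm z) with hγ
  have hl : Continuous (AddCircle.liftIco (2 * Real.pi) 0 F) :=
    AddCircle.liftIco_continuous (by rw [zero_add, F0, F2pi]) hFc.continuousOn
  have hγc : Continuous γ := hl.comp AddCircle.homeomorphCircle'.symm.continuous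
  have hγF : ∀ t ∈ Icc 0 (2 * Real.pi), γ (Circle.exp t) = F t := by
    have h1 : ∀ t ∈ Ico 0 (2 * Real.pi), γ (Circle.exp t) = F t := by
      intro t ht
      have : AddCircle.homeomorphCircle'.symm (Circle.exp t) = (t : AddCircle (2 * Real.pi)) := by
        rw [← AddCircle.homeomorphCircle'_apply_mk, Homeomorph.symm_apply_apply]
      simp only [hγ, this]
      rw [AddCircle.liftIco_coe_apply]
      rwa [zero_add]
    intro t ht
    rcases ht.2.lt_or_eq with h | h
    · exact h1 t ⟨ht.1, h⟩
    · rw [h, Circle.exp_two_pi, F2pi, ← F0, ← h1 0 ⟨le_rfl, Real.two_pi_pos⟩, Circle.exp_zero]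
  have a1 : arcImage γ 0 Real.pi = A := by
    rw [← i1]
    exact image_congr fun t ht => hγF t ⟨ht.1, by linarith [ht.2]⟩
  have a2 : arcImage γ Real.pi (2 * Real.pi) = B := by
    rw [← i2]
    exact image_congr fun t ht => hγF t ⟨by linarith [ht.1], ht.2⟩
  refine ⟨γ, ?_, ?_, ?_, ?_, a1, a2⟩
  · refine (Continuous.isClosedEmbedding hγc ?_).isEmbedding
    intro z w hzw
    obtain ⟨s, hs, rfl⟩ := exists_circle_exp 0 z
    obtain ⟨t, ht, rfl⟩ := exists_circle_exp 0 w
    rw [zero_add] at hs ht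
    rw [hγF s ⟨hs.1, hs.2.le⟩, hγF t ⟨ht.1, ht.2.le⟩] at hzw
    rw [hinj hs ht hzw]
  · rw [← a1, ← a2, arcImage, arcImage, ← image_union,
      Icc_union_Icc_eq_Icc hpi.le (by linarith)]
    apply subset_antisymm
    · rintro _ ⟨z, rfl⟩
      obtain ⟨s, hs, rfl⟩ := exists_circle_exp 0 z
      rw [zero_add] at hs
      exact ⟨s, ⟨hs.1, hs.2.le⟩, rfl⟩
    · rintro _ ⟨s, -, rfl⟩
      exact mem_range_self _
  · rw [hγF 0 ⟨le_rfl, by linarith⟩, F0]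
  · rw [hγF _ ⟨hpi.le, by linarith⟩, Fpi]

/-- A closed set missing `p` stays away from an initial piece of the arc, which can be cut off
without losing any point of `S`. -/
theorem EArc.trim (hE : IsElementaryFamily E) (h : EArc E p q A) (hS : IsClosed S)
    (hp : p ∉ S) : ∃ a' A', EArc E a' q A' ∧ A' ⊆ A ∧ p ∉ A' ∧ S ∩ A ⊆ A' := by
  obtain ⟨f, hc, hi, h0, h1, hA⟩ := h.2.exists_real
  have hn : {t | f t ∉ S} ∈ 𝓝 (0 : ℝ) :=
    (hS.isOpen_compl.preimage hc).mem_nhds (by simpa [h0] using hp)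
  obtain ⟨δ, hδ, hball⟩ := Metric.mem_nhds_iff.1 hn
  set d := min (δ / 2) (1 / 2) with hd
  have hd0 : 0 < d := by positivity
  have hd1 : d < 1 := (min_le_right _ _).trans_lt (by norm_num)
  have hd2 : d < δ := (min_le_left _ _).trans_lt (by linarith)
  have hsub : f '' Icc d 1 ⊆ A := hA ▸ image_mono (Icc_subset_Icc_left hd0.le)
  refine ⟨f d, f '' Icc d 1, ?_, hsub, ?_, ?_⟩
  · refine EArc.of_subset hE h ?_ hsub
    rw [← h1]
    exact isArc_image hd1 hc.continuousOn (hi.mono (Icc_subset_Icc_left hd0.le))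
  · rintro ⟨t, ht, htp⟩
    rw [← h0] at htp
    have := hi ⟨hd0.le.trans ht.1, ht.2⟩ (by simp) htp
    linarith [ht.1]
  · rintro z ⟨hz, hzA⟩
    rw [← hA] at hzA
    obtain ⟨t, ht, rfl⟩ := hzA
    refine ⟨t, ⟨?_, ht.2⟩, rfl⟩
    by_contra hlt
    push Not at hlt
    have : t ∈ Metric.ball (0 : ℝ) δ := by
      rw [Metric.mem_ball, Real.dist_eq, sub_zero, abs_of_nonneg ht.1]; linarith
    exact hball this hz

/-- The family `E` is closed only under gluing at a single end point, so the loop is first opened: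
trimming both arcs near `p` leaves one elementary arc through `q` that still contains `S`. -/
theorem Loop.segment_of_left (hE : IsElementaryFamily E) (h : Loop E p q A B)
    (hS : IsArc u v S) (hSJ : S ⊆ A ∪ B) (hp : p ∉ S) : S ∈ E := by
  obtain ⟨a', A', a1, a2, a3, a4⟩ := h.left.trim hE hS.isClosed hp
  obtain ⟨b', B', b1, b2, b3, b4⟩ := h.right.trim hE hS.isClosed hp
  have hAB : A' ∩ B' = {q} := by
    ext z
    constructor
    · rintro ⟨hz1, hz2⟩
      have : z ∈ A ∩ B := ⟨a2 hz1, b2 hz2⟩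
      rw [h.inter] at this
      rcases this with rfl | rfl
      · exact absurd hz1 a3
      · rfl
    · rintro rfl
      exact ⟨a1.2.right_mem, b1.2.right_mem⟩
  refine (EArc.of_subset hE (a1.concat hE b1.symm hAB) hS ?_).1
  intro z hz
  rcases hSJ hz with h | h
  · exact Or.inl (a4 ⟨hz, h⟩)
  · exact Or.inr (b4 ⟨hz, h⟩)

/-- If the omitted point is not already `p` or `q`, the loop is rebased so that it becomes a base
point. -/
theorem Loop.segment_mem (hE : IsElementaryFamily E) (h : Loop E p q A B)
    (hS : IsArc u v S) (hSJ : S ⊆ A ∪ B) (ho : x ∈ A ∪ B) (hx : x ∉ S) : S ∈ E := by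
  have key : ∀ A B : Set X, Loop E p q A B → S ⊆ A ∪ B → x ∈ A → S ∈ E := by
    intro A B h hSJ hxA
    by_cases hxp : x = p
    · exact h.segment_of_left hE hS hSJ (hxp ▸ hx)
    by_cases hxq : x = q
    · exact h.symm.segment_of_left hE hS hSJ (hxq ▸ hx)
    obtain ⟨A₁, A₂, h1, h2, h3, h4⟩ := h.left.split hE hxA hxp hxq
    refine (h.of_split hE h1 h2 h3 h4).2.segment_of_left hE hS ?_ hx
    rw [← h3] at hSJ
    intro z hz
    have := hSJ hz
    simp only [mem_union] at this ⊢
    tauto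
  rcases ho with ho | ho
  · exact key A B h hSJ ho
  · exact key B A h.swap (by rwa [union_comm]) ho

theorem Loop.isElementaryClosedCurve (hE : IsElementaryFamily E) (h : Loop E p q A B) :
    IsElementaryClosedCurve E (A ∪ B) := by
  obtain ⟨γ, h1, h2, -⟩ := h.exists_path
  refine ⟨⟨γ, h1, h2⟩, ?_⟩
  rintro S ⟨γ', k1, k2, s, t, hst, ht, rfl⟩
  -- A proper arc from angle `s` to angle `t` omits the midpoint of the complementary arc.
  refine h.segment_mem hE (isArc_arcImage k1 hst ht) ?_
    (x := γ' (Circle.exp ((t + (s + 2 * Real.pi)) / 2))) (k2 ▸ mem_range_self _) ?_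
  · rw [← k2]
    rintro _ ⟨w, -, rfl⟩
    exact mem_range_self _
  · rintro ⟨w, hw, hw'⟩
    have := circle_exp_injOn s ⟨hw.1, hw.2.trans_lt ht⟩ ⟨by linarith, by linarith⟩
      (k1.injective hw')
    linarith [hw.2]

theorem loop_of_path {γ : Circle → X} (hγ : IsSimpleClosedPath γ)
    (hJ : IsElementaryClosedCurve E (range γ)) {s t : ℝ} (hst : s < t)
    (ht : t < s + 2 * Real.pi) :
    Loop E (γ (Circle.exp s)) (γ (Circle.exp t)) (arcImage γ s t)
      (arcImage γ t (s + 2 * Real.pi)) ∧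
    arcImage γ s t ∪ arcImage γ t (s + 2 * Real.pi) = range γ := by
  have hexp : Circle.exp (s + 2 * Real.pi) = Circle.exp s := by
    rw [Circle.exp_eq_exp]; exact ⟨1, by simp⟩
  refine ⟨⟨⟨?_, isArc_arcImage hγ hst ht⟩, ⟨?_, ?_⟩, ?_⟩, ?_⟩
  · exact hJ.2 _ ⟨γ, hγ, rfl, s, t, hst, ht, rfl⟩
  · exact hJ.2 _ ⟨γ, hγ, rfl, t, s + 2 * Real.pi, ht, by linarith, rfl⟩
  · have := (isArc_arcImage hγ ht (by linarith)).symm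
    rwa [hexp] at this
  · ext z
    constructor
    · rintro ⟨⟨a, ha, rfl⟩, ⟨b, hb, hab⟩⟩
      have hab' := hγ.injective hab
      rcases hb.2.lt_or_eq with h | h
      · have := circle_exp_injOn s ⟨by linarith [hb.1], h⟩ ⟨ha.1, by linarith [ha.2]⟩ hab'
        have hat : a = t := le_antisymm ha.2 (this ▸ hb.1)
        exact Or.inr (by rw [hat]; rfl)
      · rw [h, hexp] at hab'
        have := circle_exp_injOn s ⟨le_rfl, by linarith⟩ ⟨ha.1, by linarith [ha.2]⟩ hab'
        exact Or.inl (by rw [← this])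
    · rintro (rfl | rfl)
      · exact ⟨⟨s, ⟨le_rfl, hst.le⟩, rfl⟩, ⟨s + 2 * Real.pi, ⟨ht.le, le_rfl⟩,
          by simp only [hexp]⟩⟩
      · exact ⟨⟨t, ⟨hst.le, le_rfl⟩, rfl⟩, ⟨t, ⟨le_rfl, ht.le⟩, rfl⟩⟩
  · rw [arcImage, arcImage, ← image_union, Icc_union_Icc_eq_Icc hst.le ht.le]
    apply subset_antisymm
    · rintro _ ⟨w, -, rfl⟩
      exact mem_range_self _
    · rintro _ ⟨z, rfl⟩
      obtain ⟨w, hw, rfl⟩ := exists_circle_exp s z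
      exact ⟨w, ⟨hw.1, hw.2.le⟩, rfl⟩

theorem IsElementaryClosedCurve.exists_loop (hJ : IsElementaryClosedCurve E J) (hp : p ∈ J)
    (hq : q ∈ J) (hpq : p ≠ q) : ∃ A B, Loop E p q A B ∧ A ∪ B = J := by
  obtain ⟨γ, hγ, rfl⟩ := hJ.1
  obtain ⟨z, rfl⟩ := hp
  obtain ⟨w, rfl⟩ := hq
  obtain ⟨s, -, rfl⟩ := exists_circle_exp 0 z
  obtain ⟨t, ht, rfl⟩ := exists_circle_exp s w
  have hst : s < t := lt_of_le_of_ne ht.1 (by rintro rfl; exact hpq rfl)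
  obtain ⟨h1, h2⟩ := loop_of_path hγ hJ hst ht.2
  exact ⟨_, _, h1, h2⟩

end Loop


/-! ### Domains of elementary closed curves and their crosscuts -/

/-- All the axioms on a set of elementary curves. -/
structure Axioms {X : Type*} [TopologicalSpace X] (E : Set (Set X)) : Prop where
  family : IsElementaryFamily E
  jordan : JordanDomainAxiom E
  extension : ExtensionAxiom E
  covering : CoveringAxiom E

/-- `U` is one of the domains cut out by the elementary closed curve `J`. -/
def Dom {X : Type*} [TopologicalSpace X] (E : Set (Set X)) (J U : Set X) : Prop :=
  IsElementaryClosedCurve E J ∧ U ∈ components Jᶜ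

section Dom

variable {X : Type*} [TopologicalSpace X] [T2Space X] {E : Set (Set X)} {p q r x y u v : X}
  {A B C S J U V N : Set X}

theorem IsElementaryClosedCurve.isClosed (hJ : IsElementaryClosedCurve E J) : IsClosed J := by
  obtain ⟨γ, hγ, rfl⟩ := hJ.1
  exact (isCompact_range hγ.continuous).isClosed

theorem Dom.isPreconnected (h : Dom E J U) : IsPreconnected U := by
  obtain ⟨x, hx, rfl⟩ := h.2
  exact isPreconnected_connectedComponentIn

theorem Dom.nonempty (h : Dom E J U) : U.Nonempty := by
  obtain ⟨x, hx, rfl⟩ := h.2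
  exact ⟨x, mem_connectedComponentIn hx⟩

theorem Dom.subset_compl (h : Dom E J U) : U ⊆ Jᶜ := by
  obtain ⟨x, hx, rfl⟩ := h.2
  exact connectedComponentIn_subset _ _

theorem Dom.subset_of_mem (h : Dom E J U) (hS : IsPreconnected S) (hSJ : S ⊆ Jᶜ) (hx : x ∈ S)
    (hxU : x ∈ U) : S ⊆ U := by
  obtain ⟨y, hy, rfl⟩ := h.2
  rw [connectedComponentIn_eq hxU]
  exact hS.subset_connectedComponentIn hx hSJ

theorem Dom.notMem (h : Dom E J U) (hx : x ∈ U) : x ∉ J := h.subset_compl hx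

theorem IsElementaryClosedCurve.exists_doms (hE : Axioms E) (hJ : IsElementaryClosedCurve E J) :
    ∃ U V, U ≠ V ∧ components Jᶜ = {U, V} := encard_eq_two.1 (hE.jordan J hJ)

/-- Local connectedness is not assumed, so openness of components needs an argument: each component
is relatively closed in the open set `Jᶜ`, and as there are only two of them each is the complement
of the other. -/
theorem Dom.exists_other (hE : Axioms E) (h : Dom E J U) : ∃ V, Dom E J V ∧ IsOpen U ∧
    IsOpen V ∧ Disjoint U V ∧ U ∪ V = Jᶜ := by
  obtain ⟨V, hUV, hC⟩ : ∃ V, U ≠ V ∧ components Jᶜ = {U, V} := by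
    obtain ⟨U', V', hne, hC⟩ := h.1.exists_doms hE
    have := h.2
    rw [hC] at this
    rcases this with rfl | rfl
    · exact ⟨V', hne, hC⟩
    · exact ⟨U', hne.symm, by rw [hC, pair_comm]⟩
  have hV : Dom E J V := ⟨h.1, hC ▸ Or.inr rfl⟩
  have hdis : ∀ A B, A ∈ components Jᶜ → B ∈ components Jᶜ → A ≠ B → Disjoint A B := by
    rintro _ _ ⟨x, hx, rfl⟩ ⟨y, hy, rfl⟩ hne
    rw [Set.disjoint_left]
    intro z hz1 hz2
    exact hne ((connectedComponentIn_eq hz1).trans (connectedComponentIn_eq hz2).symm)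
  have hun : U ∪ V = Jᶜ := by
    apply (union_subset h.subset_compl hV.subset_compl).antisymm
    intro x hx
    have : connectedComponentIn Jᶜ x ∈ components Jᶜ := ⟨x, hx, rfl⟩
    rw [hC] at this
    have hm := mem_connectedComponentIn hx
    rcases this with e | e
    · exact Or.inl (e ▸ hm)
    · exact Or.inr (e ▸ hm)
  have hd := hdis U V h.2 hV.2 hUV
  have hopen : ∀ A B, A ∈ components Jᶜ → Disjoint A B → A ∪ B = Jᶜ → IsOpen B := by
    rintro _ B ⟨x, hx, rfl⟩ hAB hun
    have hcl : closure (connectedComponentIn Jᶜ x) ∩ Jᶜ ⊆ connectedComponentIn Jᶜ x := by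
      apply IsPreconnected.subset_connectedComponentIn
      · exact isPreconnected_connectedComponentIn.subset_closure
          (subset_inter subset_closure (connectedComponentIn_subset _ _)) inter_subset_left
      · exact ⟨subset_closure (mem_connectedComponentIn hx), hx⟩
      · exact inter_subset_right
    have : B = Jᶜ ∩ (closure (connectedComponentIn Jᶜ x))ᶜ := by
      ext z
      constructor
      · intro hz
        have hzJ : z ∈ Jᶜ := hun ▸ Or.inr hz
        exact ⟨hzJ, fun hz' => Set.disjoint_left.1 hAB (hcl ⟨hz', hzJ⟩) hz⟩
      · rintro ⟨hz1, hz2⟩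
        rw [← hun] at hz1
        exact hz1.resolve_left fun h => hz2 (subset_closure h)
    rw [this]
    exact h.1.isClosed.isOpen_compl.inter isClosed_closure.isOpen_compl
  exact ⟨V, hV, hopen V U hV.2 hd.symm (by rw [union_comm, hun]), hopen U V h.2 hd hun, hd, hun⟩

theorem Dom.isOpen (hE : Axioms E) (h : Dom E J U) : IsOpen U := by
  obtain ⟨V, -, h', -⟩ := h.exists_other hE
  exact h'

/-- Joining the end point of a crossing curve on the boundary to the other end point. -/
theorem Quadrilateral.Crosses.exists_arc {Q : Quadrilateral X} {S T : Set X}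
    (h : Q.Crosses S T A) : ∃ p ∈ S, ∃ q ∈ T, IsArc p q A ∧ A \ {p, q} ⊆ Q.interior := by
  obtain ⟨γ, hγ, hA, h0, h1, hint⟩ := h
  refine ⟨_, h0, _, h1, ⟨γ, hγ, rfl, rfl, hA⟩, ?_⟩
  rw [← hA]
  rintro _ ⟨⟨t, rfl⟩, ht⟩
  refine hint t (unitInterval.pos_iff_ne_zero.2 ?_) (unitInterval.lt_one_iff_ne_one.2 ?_)
  · rintro rfl
    exact ht (Or.inl rfl)
  · rintro rfl
    exact ht (Or.inr rfl)

theorem IsEndpoint.mem (h : IsEndpoint x A) : x ∈ A := by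
  obtain ⟨γ, -, rfl, rfl | rfl⟩ := h <;> exact mem_range_self _

/-- In a quadrilateral there is a curve joining a given point of a side to a point of the
opposite side. -/
theorem Dom.exists_crosscut_path (hE : Axioms E) {γ : Circle → X} (hγ : IsSimpleClosedPath γ)
    (h : Dom E (range γ) U) {ta tx tb tc td : ℝ} (h1 : ta < tx) (h2 : tx < tb) (h3 : tb < tc)
    (h4 : tc < td) (h5 : td < ta + 2 * Real.pi) :
    ∃ y ∈ arcImage γ tc td, ∃ C, EArc E (γ (Circle.exp tx)) y C ∧
      C \ {γ (Circle.exp tx), y} ⊆ U := by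
  set Q : Quadrilateral X := ⟨γ, hγ, ta, tb, tc, td, h1.trans h2, h3, h4, h5, U, h.2⟩ with hQ
  have hinj : ∀ t ∈ Ico ta (ta + 2 * Real.pi), γ (Circle.exp tx) = γ (Circle.exp t) → tx = t :=
    fun t ht e => circle_exp_injOn ta ⟨h1.le, by linarith⟩ ht (hγ.injective e)
  have hexp : Circle.exp (ta + 2 * Real.pi) = Circle.exp ta := by
    rw [Circle.exp_eq_exp]; exact ⟨1, by simp⟩
  have hBC : γ (Circle.exp tx) ∉ Q.sideBC := by
    rintro ⟨t, ht, e⟩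
    have := hinj t ⟨by linarith [ht.1], by linarith [ht.2]⟩ e.symm
    linarith [ht.1]
  have hCD : γ (Circle.exp tx) ∉ Q.sideCD := by
    rintro ⟨t, ht, e⟩
    have := hinj t ⟨by linarith [ht.1], by linarith [ht.2]⟩ e.symm
    linarith [ht.1]
  have hDA : γ (Circle.exp tx) ∉ Q.sideDA := by
    rintro ⟨t, ht, e⟩
    change t ∈ Icc td (ta + 2 * Real.pi) at ht
    rcases ht.2.lt_or_eq with h' | h'
    · have := hinj t ⟨by linarith [ht.1], h'⟩ e.symm
      linarith [ht.1]
    · rw [h'] at e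
      simp only [hexp] at e
      have := hinj ta ⟨le_rfl, by linarith⟩ e.symm
      linarith
  have hvert : γ (Circle.exp tx) ∉ Q.vertices := by
    rintro (e | e | e | e)
    · have := hinj ta ⟨le_rfl, by linarith⟩ e
      linarith
    · have := hinj tb ⟨by linarith, by linarith⟩ e
      linarith
    · have := hinj tc ⟨by linarith, by linarith⟩ e
      linarith
    · have := hinj td ⟨by linarith, by linarith⟩ e
      linarith
  obtain ⟨C, hC, hvh, hend⟩ := hE.extension Q h.1 _ (mem_range_self _) hvert
  have hxC := hend.mem
  have hxU : γ (Circle.exp tx) ∉ U := fun h' => h.notMem h' (mem_range_self _)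
  have key : ∀ S T, Q.Crosses S T C → γ (Circle.exp tx) ∉ T →
      γ (Circle.exp tx) ∈ S ∧ ∃ y ∈ T, IsArc (γ (Circle.exp tx)) y C ∧
        C \ {γ (Circle.exp tx), y} ⊆ U := by
    intro S T hcr hT
    obtain ⟨p, hp, q, hq, hpq, hint⟩ := hcr.exists_arc
    have : γ (Circle.exp tx) = p := by
      by_contra hne
      have hne' : γ (Circle.exp tx) ≠ q := fun e => hT (e ▸ hq)
      exact hxU (hint ⟨hxC, by simp [hne, hne']⟩)
    rw [this]
    exact ⟨hp, q, hq, hpq, hint⟩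
  -- A horizontal curve is impossible: its ends lie on `[b,c]` and `[d,a]`, and neither side
  -- contains the chosen point.
  rcases hvh with hv | hh
  · obtain ⟨-, y, hy, harc, hint⟩ := key _ _ hv hCD
    exact ⟨y, hy, C, ⟨hC, harc⟩, hint⟩
  · exact absurd (key _ _ hh hDA).1 hBC

/-- Each boundary point is the end of a crosscut whose inner points lie in `U` and accumulate at it.
-/
theorem Dom.subset_closure (hE : Axioms E) (h : Dom E J U) : J ⊆ closure U := by
  obtain ⟨γ, hγ, rfl⟩ := id h.1.1
  rintro _ ⟨z, rfl⟩
  obtain ⟨t, -, rfl⟩ := exists_circle_exp 0 z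
  -- The point at angle `t` becomes an inner point of a side; the four vertices span an angle of 4,
  -- less than 2π.
  obtain ⟨y, -, C, hC, hint⟩ := h.exists_crosscut_path hE hγ (ta := t - 1) (tx := t) (tb := t + 1)
    (tc := t + 2) (td := t + 3) (by linarith) (by linarith) (by linarith) (by linarith)
    (by linarith [Real.pi_gt_three])
  exact closure_mono hint (hC.2.subset_closure hC.2.left_mem)

theorem Dom.closure_eq (hE : Axioms E) (h : Dom E J U) : closure U = U ∪ J := by
  obtain ⟨V, hV, hUo, hVo, hd, hun⟩ := h.exists_other hE
  apply subset_antisymm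
  · intro x hx
    by_contra hx'
    simp only [mem_union, not_or] at hx'
    have hxV : x ∈ V := by
      have : x ∈ U ∪ V := hun ▸ hx'.2
      exact this.resolve_left hx'.1
    obtain ⟨y, hy1, hy2⟩ := mem_closure_iff.1 hx V hVo hxV
    exact Set.disjoint_left.1 hd hy2 hy1
  · exact union_subset _root_.subset_closure (h.subset_closure hE)

/-- In a domain bounded by two arcs there is a crosscut from a given point of one arc to a
point of the other one close to a given point. -/
theorem Loop.exists_crosscut (hE : Axioms E) (hl : Loop E p q A B) (h : Dom E (A ∪ B) U)
    (hx : x ∈ A) (hxp : x ≠ p) (hxq : x ≠ q) (hr : r ∈ B) (hrp : r ≠ p) (hrq : r ≠ q)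
    (hN : IsOpen N) (hrN : r ∈ N) : ∃ y C, y ∈ B ∧ y ∈ N ∧ y ≠ p ∧ y ≠ q ∧ EArc E x y C ∧
      C \ {x, y} ⊆ U := by
  obtain ⟨γ, hγ, hJ, h0, hpi, hA, hB⟩ := hl.exists_path
  have pi_pos := Real.pi_pos
  rw [← hA] at hx
  rw [← hB] at hr
  obtain ⟨tx, htx, rfl⟩ := hx
  obtain ⟨tr, htr, rfl⟩ := hr
  have e2pi : γ (Circle.exp (2 * Real.pi)) = p := by
    rw [Circle.exp_two_pi, ← Circle.exp_zero, h0]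
  have tx0 : 0 < tx := lt_of_le_of_ne htx.1 (by rintro rfl; exact hxp h0)
  have tx1 : tx < Real.pi := lt_of_le_of_ne htx.2 (by rintro rfl; exact hxq hpi)
  have tr0 : Real.pi < tr := lt_of_le_of_ne htr.1 (by rintro rfl; exact hrq hpi)
  have tr1 : tr < 2 * Real.pi := lt_of_le_of_ne htr.2 (by rintro rfl; exact hrp e2pi)
  have hcont : Continuous fun t : ℝ => γ (Circle.exp t) :=
    hγ.continuous.comp Circle.exp.continuous
  have hn : (fun t : ℝ => γ (Circle.exp t)) ⁻¹' N ∩ Ioo Real.pi (2 * Real.pi) ∈ 𝓝 tr :=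
    Filter.inter_mem ((hN.preimage hcont).mem_nhds hrN) (Ioo_mem_nhds tr0 tr1)
  -- A short closed interval around the parameter of `r` serves as the side `[c,d]`, which keeps the
  -- other end of the crosscut inside `N` and away from `p` and `q`.
  obtain ⟨ε, hε, hball⟩ := Metric.nhds_basis_closedBall.mem_iff.1 hn
  rw [Real.closedBall_eq_Icc] at hball
  have m1 := (hball ⟨le_rfl, by linarith⟩).2
  have m2 := (hball (⟨by linarith, le_rfl⟩ : tr + ε ∈ Icc (tr - ε) (tr + ε))).2
  rw [← hJ] at h
  obtain ⟨y, ⟨t, ht, rfl⟩, C, hC, hint⟩ := h.exists_crosscut_path hE hγ tx0 tx1 m1.1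
    (by linarith : tr - ε < tr + ε) (by linarith [m2.2] : tr + ε < 0 + 2 * Real.pi)
  have htm := hball ht
  have hinj := circle_exp_injOn 0
  rw [zero_add] at hinj
  refine ⟨_, C, ?_, htm.1, ?_, ?_, hC, hint⟩
  · rw [← hB]
    exact ⟨t, ⟨htm.2.1.le, htm.2.2.le⟩, rfl⟩
  · intro e
    have := hinj ⟨by linarith [htm.2.1], htm.2.2⟩ ⟨le_rfl, by linarith⟩
      (hγ.injective (e.trans h0.symm))
    linarith [htm.2.1]
  · intro e
    have := hinj ⟨by linarith [htm.2.1], htm.2.2⟩ ⟨pi_pos.le, by linarith⟩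
      (hγ.injective (e.trans hpi.symm))
    linarith [htm.2.1]

end Dom


/-! ### The theta lemma -/

section Theta

variable {X : Type*} [TopologicalSpace X] [T2Space X] {E : Set (Set X)} {p q r x y u v : X}
  {A B C S J J₁ J₂ U V N : Set X}

theorem _root_.IsPreconnected.false_of_relatively_clopen {D W : Set X} (hD : IsPreconnected D)
    (hW : IsOpen W) (hx : x ∈ D) (hxW : x ∈ W) (hcl : closure W ∩ D ⊆ W) (hy : y ∈ D)
    (hyW : y ∉ W) : False := by
  obtain ⟨z, hz, hz1, hz2⟩ := hD W (closure W)ᶜ hW isClosed_closure.isOpen_compl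
    (fun z hz => by
      by_cases h : z ∈ closure W
      · exact Or.inl (hcl ⟨h, hz⟩)
      · exact Or.inr h)
    ⟨x, hx, hxW⟩ ⟨y, hy, fun h => hyW (hcl ⟨h, hy⟩)⟩
  exact hz2 (subset_closure hz1)

theorem _root_.IsOpen.notMem_closure_of_disjoint {O W : Set X} (hO : IsOpen O)
    (h : Disjoint O W) (hx : x ∈ O) : x ∉ closure W := by
  intro hx'
  obtain ⟨z, h1, h2⟩ := mem_closure_iff.1 hx' O hO hx
  exact Set.disjoint_left.1 h h1 h2

/-- The curve `J₁ ∪ A` misses `V`, so `V` lies in one of its domains, called `C'`. The open arc of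
`J₂` follows `V` there, being in the closure of `V`. The other domain `C` then avoids both `V` and
`J₂`, and so lies in `U`. -/
theorem theta_side (hE : Axioms E) (hl : Loop E p q J₁ J₂) (hU : Dom E (J₁ ∪ J₂) U)
    (hV : Dom E (J₁ ∪ J₂) V) (hUV : Disjoint U V) (hun : U ∪ V = (J₁ ∪ J₂)ᶜ)
    (hA : EArc E p q A) (hAU : A \ {p, q} ⊆ U) :
    Loop E p q J₁ A ∧ ∃ C C', Dom E (J₁ ∪ A) C ∧ Dom E (J₁ ∪ A) C' ∧ Disjoint C C' ∧
      C ∪ C' = (J₁ ∪ A)ᶜ ∧ V ⊆ C' ∧ J₂ \ {p, q} ⊆ C' ∧ C ⊆ U := by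
  have hlA : Loop E p q J₁ A := by
    refine ⟨hl.left, hA, ?_⟩
    ext z
    constructor
    · rintro ⟨h1, h2⟩
      by_contra h3
      exact hU.notMem (hAU ⟨h2, h3⟩) (Or.inl h1)
    · rintro (rfl | rfl)
      · exact ⟨hl.left.2.left_mem, hA.2.left_mem⟩
      · exact ⟨hl.left.2.right_mem, hA.2.right_mem⟩
  refine ⟨hlA, ?_⟩
  have hJ := hlA.isElementaryClosedCurve hE.family
  obtain ⟨v, hv⟩ := hV.nonempty
  have hVc : V ⊆ (J₁ ∪ A)ᶜ := by
    rintro z hz (h | h)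
    · exact hV.notMem hz (Or.inl h)
    · by_cases h3 : z ∈ ({p, q} : Set X)
      · rw [← hlA.inter] at h3
        exact hV.notMem hz (Or.inl h3.1)
      · exact Set.disjoint_left.1 hUV (hAU ⟨h, h3⟩) hz
  have hC' : Dom E (J₁ ∪ A) (connectedComponentIn (J₁ ∪ A)ᶜ v) := ⟨hJ, v, hVc hv, rfl⟩
  set C' := connectedComponentIn (J₁ ∪ A)ᶜ v
  have hvC' : v ∈ C' := mem_connectedComponentIn (hVc hv)
  obtain ⟨C, hC, ho', ho, hd, hun'⟩ := hC'.exists_other hE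
  have hVC' : V ⊆ C' := hC'.subset_of_mem hV.isPreconnected hVc hv hvC'
  have hJ2 : J₂ \ {p, q} ⊆ C' := by
    intro z hz
    have hzc : z ∈ (J₁ ∪ A)ᶜ := by
      rintro (h | h)
      · exact hz.2 (hl.inter ▸ ⟨h, hz.1⟩)
      · exact hU.notMem (hAU ⟨h, hz.2⟩) (Or.inr hz.1)
    rw [← hun'] at hzc
    refine hzc.resolve_right fun hzC => ?_
    have := hV.subset_closure hE (Or.inr hz.1 : z ∈ J₁ ∪ J₂)
    exact ho.notMem_closure_of_disjoint (hd.symm.mono_right hVC') hzC this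
  refine ⟨C, C', hC, hC', hd.symm, by rw [union_comm, hun'], hVC', hJ2, ?_⟩
  intro z hz
  have hzc := hC.notMem hz
  have hzC' := Set.disjoint_right.1 hd hz
  have : z ∈ U ∪ V := by
    rw [hun]
    rintro (h | h)
    · exact hzc (Or.inl h)
    · by_cases h3 : z ∈ ({p, q} : Set X)
      · rw [← hlA.inter] at h3
        exact hzc (Or.inl h3.1)
      · exact hzC' (hJ2 ⟨h, h3⟩)
  exact this.resolve_right fun h => hzC' (hVC' h)

-- A remainder `W` would be open, with frontier on the theta curve. Connectedness of `U` makes `W`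
-- accumulate at an inner point `w` of `A`, and connectedness of `D'` makes every relatively clopen
-- piece of `W` accumulate on `J₁`. A closed curve is drawn around `w` from crosscuts `B1` in `C`
-- and `B2` in `D` and a piece of `A`. Let `O` be its domain containing `J₁ ∪ J₂`, and `I` the
-- other. If `w` is in `I`, the part of `W` in `I` cannot reach `J₁`. If `w` is in `O`, then `I` is
-- covered by the disjoint open sets `C` and `D ∪ W` and meets both.
set_option maxHeartbeats 2000000 in
theorem theta_exhaust (hE : Axioms E) (hl : Loop E p q J₁ J₂) (hU : Dom E (J₁ ∪ J₂) U)
    (hV : Dom E (J₁ ∪ J₂) V) (hUV : Disjoint U V) (hun : U ∪ V = (J₁ ∪ J₂)ᶜ)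
    (hA : EArc E p q A) (hAU : A \ {p, q} ⊆ U) (hlA : Loop E p q J₁ A) (hlA' : Loop E p q J₂ A)
    {C D D' : Set X} (hC : Dom E (J₁ ∪ A) C) (hCU : C ⊆ U)
    (hD : Dom E (J₂ ∪ A) D) (hD' : Dom E (J₂ ∪ A) D') (hDD : D ∪ D' = (J₂ ∪ A)ᶜ)
    (hDU : D ⊆ U) (hVD : V ⊆ D') (hCD : Disjoint C D) : U \ A ⊆ C ∪ D := by
  have hVo := hV.isOpen hE
  have hCo := hC.isOpen hE
  have hDo := hD.isOpen hE
  set θ := J₁ ∪ J₂ ∪ A with hθ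
  set W := (U \ A) \ (C ∪ D) with hW
  by_contra hne
  obtain ⟨w₀, hw₀⟩ : W.Nonempty := by
    obtain ⟨w, h1, h2⟩ := not_subset.1 hne
    exact ⟨w, h1, h2⟩
  have hpA := hA.2.left_mem
  have hqA := hA.2.right_mem
  have hJA : ∀ z ∈ A, z ∈ J₁ ∪ J₂ → z = p ∨ z = q := by
    intro z hz hzJ
    by_contra h
    exact hU.notMem (hAU ⟨hz, h⟩) hzJ
  -- The closures of `V`, `C` and `D` add to these domains exactly the theta curve, so `W` is the
  -- complement of three closed sets.
  have hWo : IsOpen W := by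
    have : W = (closure V ∪ closure C ∪ closure D)ᶜ := by
      rw [hV.closure_eq hE, hC.closure_eq hE, hD.closure_eq hE]
      ext z
      have h1 : z ∈ U ∪ V ↔ z ∉ J₁ ∪ J₂ := by rw [hun]; rfl
      have h2 : z ∈ U → z ∉ V := fun h => Set.disjoint_left.1 hUV h
      simp only [hW, mem_sdiff, mem_union, mem_compl_iff] at *
      tauto
    rw [this]
    exact (((isClosed_closure.union isClosed_closure).union isClosed_closure)).isOpen_compl
  have hCA : Disjoint C A := Set.disjoint_left.2 fun z h h' => hC.notMem h (Or.inr h')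
  have hDA : Disjoint D A := Set.disjoint_left.2 fun z h h' => hD.notMem h (Or.inr h')
  have hWV : Disjoint V W := (hUV.symm).mono_right fun z hz => hz.1.1
  have hWC : Disjoint C W := Set.disjoint_left.2 fun z h h' => h'.2 (Or.inl h)
  have hWD : Disjoint D W := Set.disjoint_left.2 fun z h h' => h'.2 (Or.inr h)
  have hcover : ∀ z, z ∈ V ∨ z ∈ C ∨ z ∈ D ∨ z ∈ W ∨ z ∈ θ := by
    intro z
    have h1 : z ∈ U ∪ V ↔ z ∉ J₁ ∪ J₂ := by rw [hun]; rfl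
    simp only [hW, hθ, mem_sdiff, mem_union] at *
    tauto
  have hclW : ∀ W', W' ⊆ W → IsOpen (W \ W') → closure W' ⊆ W' ∪ θ := by
    intro W' hsub ho z hz
    rcases hcover z with h | h | h | h | h
    · exact absurd hz (hVo.notMem_closure_of_disjoint (hWV.mono_right hsub) h)
    · exact absurd hz (hCo.notMem_closure_of_disjoint (hWC.mono_right hsub) h)
    · exact absurd hz (hDo.notMem_closure_of_disjoint (hWD.mono_right hsub) h)
    · by_cases hz' : z ∈ W'
      · exact Or.inl hz'
      · exact absurd hz (ho.notMem_closure_of_disjoint disjoint_sdiff_left ⟨h, hz'⟩)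
    · exact Or.inr h
  -- the closure of `W` meets the interior of `A`
  obtain ⟨w, hwA, hwp, hwq, hwW⟩ : ∃ w ∈ A, w ≠ p ∧ w ≠ q ∧ w ∈ closure W := by
    by_contra hno
    push Not at hno
    obtain ⟨c, hc⟩ := hC.nonempty
    refine hU.isPreconnected.false_of_relatively_clopen hWo hw₀.1.1 hw₀ ?_ (hCU hc)
      (Set.disjoint_left.1 hWC hc)
    rintro z ⟨hz, hzU⟩
    rcases hclW W subset_rfl (by simp) hz with h | h
    · exact h
    · have hzJ := hU.notMem hzU
      have hzA : z ∈ A := h.resolve_left hzJ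
      refine absurd hz (hno z hzA ?_ ?_)
      · rintro rfl; exact hzJ (Or.inl hl.left.2.left_mem)
      · rintro rfl; exact hzJ (Or.inl hl.left.2.right_mem)
  -- the closure of every piece of `W` meets `J₁`
  have hpiece : ∀ W', W' ⊆ W → IsOpen W' → IsOpen (W \ W') → W'.Nonempty →
      ∃ z ∈ J₁, z ∈ closure W' := by
    rintro W' hsub ho ho' ⟨w', hw'⟩
    by_contra hno
    push Not at hno
    obtain ⟨v, hv⟩ := hV.nonempty
    refine hD'.isPreconnected.false_of_relatively_clopen ho (x := w') ?_ hw' ?_ (hVD hv)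
      (fun h => Set.disjoint_left.1 hWV hv (hsub h))
    · have : w' ∈ D ∪ D' := by
        rw [hDD]
        rintro (h | h)
        · exact hU.notMem (hsub hw').1.1 (Or.inr h)
        · exact (hsub hw').1.2 h
      exact this.resolve_left fun h => Set.disjoint_left.1 hWD h (hsub hw')
    · rintro z ⟨hz, hzD⟩
      rcases hclW W' hsub ho' hz with h | (h | h) | h
      · exact h
      · exact absurd hz (hno z h)
      · exact absurd (Or.inl h) (hD'.notMem hzD)
      · exact absurd (Or.inr h) (hD'.notMem hzD)
  obtain ⟨A1, A2, a1, a2, a3, a4⟩ := hA.split hE.family hwA hwp hwq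
  obtain ⟨x, hx1, hxne⟩ := a1.2.nonempty_diff
  have hl1 := (hlA.swap.of_split hE.family a1 a2 a3 a4).1
  have hl2 := (hlA'.swap.of_split hE.family a1 a2 a3 a4).1
  have mem12 : ∀ z, z ∈ A ↔ z ∈ A1 ∨ z ∈ A2 := fun z => by rw [← a3]; rfl
  have int12 : ∀ z, z ∈ A1 → z ∈ A2 → z = w := fun z h h' => by
    have : z ∈ A1 ∩ A2 := ⟨h, h'⟩
    rwa [a4] at this
  have hwA1 := a1.2.right_mem
  have hwA2 := a2.2.left_mem
  have hpA1 := a1.2.left_mem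
  have hqA2 := a2.2.right_mem
  have hpJ1 := hl.left.2.left_mem
  have hqJ1 := hl.left.2.right_mem
  have hpJ2 := hl.right.2.left_mem
  have hqJ2 := hl.right.2.right_mem
  have hxp : x ≠ p := fun h => hxne (Or.inl h)
  have hxw : x ≠ w := fun h => hxne (Or.inr h)
  obtain ⟨r1, hr1, hr1ne⟩ := a2.2.nonempty_diff
  have hr1w : r1 ≠ w := fun h => hr1ne (Or.inl h)
  have hr1q : r1 ≠ q := fun h => hr1ne (Or.inr h)
  have hr1A1 : r1 ∉ A1 := fun h => hr1w (int12 _ h hr1)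
  have hr1p : r1 ≠ p := by rintro rfl; exact hr1A1 hpA1
  have hr1J : r1 ∉ J₁ ∪ J₂ := fun h => by
    rcases hJA r1 ((mem12 _).2 (Or.inr hr1)) h with h | h
    · exact hr1p h
    · exact hr1q h
  have eC : A1 ∪ (J₁ ∪ A2) = J₁ ∪ A := by rw [← a3, union_left_comm]
  have eD : A1 ∪ (J₂ ∪ A2) = J₂ ∪ A := by rw [← a3, union_left_comm]
  obtain ⟨y1, B1, hy1, hy1N, -, -, b1, b1C⟩ := hl1.exists_crosscut hE (by rw [eC]; exact hC)
    hx1 hxp hxw (r := r1) (N := (J₁ ∪ A1)ᶜ) (Or.inr hr1) hr1p hr1w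
    (hl.left.2.isClosed.union a1.2.isClosed).isOpen_compl
    (by rintro (h | h); exacts [hr1J (Or.inl h), hr1A1 h])
  have hy1J : y1 ∉ J₁ := fun h => hy1N (Or.inl h)
  have hy1A1 : y1 ∉ A1 := fun h => hy1N (Or.inr h)
  have hy1A2 : y1 ∈ A2 := hy1.resolve_left hy1J
  have hy1w : y1 ≠ w := by rintro rfl; exact hy1A1 hwA1
  have hy1q : y1 ≠ q := by rintro rfl; exact hy1J hqJ1
  obtain ⟨A3, A4, a31, a32, a33, a34⟩ := a2.split hE.family hy1A2 hy1w hy1q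
  have mem34 : ∀ z, z ∈ A2 ↔ z ∈ A3 ∨ z ∈ A4 := fun z => by rw [← a33]; rfl
  have int34 : ∀ z, z ∈ A3 → z ∈ A4 → z = y1 := fun z h h' => by
    have : z ∈ A3 ∩ A4 := ⟨h, h'⟩
    rwa [a34] at this
  obtain ⟨r2, hr2, hr2ne⟩ := a31.2.nonempty_diff
  have hr2w : r2 ≠ w := fun h => hr2ne (Or.inl h)
  have hr2y : r2 ≠ y1 := fun h => hr2ne (Or.inr h)
  have hr2A2 : r2 ∈ A2 := (mem34 _).2 (Or.inl hr2)
  have hr2A1 : r2 ∉ A1 := fun h => hr2w (int12 _ h hr2A2)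
  have hr2A4 : r2 ∉ A4 := fun h => hr2y (int34 _ hr2 h)
  have hr2p : r2 ≠ p := by rintro rfl; exact hr2A1 hpA1
  have hr2q : r2 ≠ q := by rintro rfl; exact hr2A4 a32.2.right_mem
  have hr2J : r2 ∉ J₁ ∪ J₂ := fun h => by
    rcases hJA r2 ((mem12 _).2 (Or.inr hr2A2)) h with h | h
    · exact hr2p h
    · exact hr2q h
  -- Aiming at `r2` while avoiding `A1` and `A4` places `y2` strictly between `w` and `y1`, so that
  -- `B2` continued along `A6` closes up with `B1`.
  obtain ⟨y2, B2, hy2, hy2N, -, -, b2, b2D⟩ := hl2.exists_crosscut hE (by rw [eD]; exact hD)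
    hx1 hxp hxw (r := r2) (N := (J₂ ∪ A1 ∪ A4)ᶜ) (Or.inr hr2A2) hr2p hr2w
    ((hl.right.2.isClosed.union a1.2.isClosed).union a32.2.isClosed).isOpen_compl
    (by rintro ((h | h) | h); exacts [hr2J (Or.inr h), hr2A1 h, hr2A4 h])
  have hy2J : y2 ∉ J₂ := fun h => hy2N (Or.inl (Or.inl h))
  have hy2A1 : y2 ∉ A1 := fun h => hy2N (Or.inl (Or.inr h))
  have hy2A4 : y2 ∉ A4 := fun h => hy2N (Or.inr h)
  have hy2A2 : y2 ∈ A2 := hy2.resolve_left hy2J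
  have hy2A3 : y2 ∈ A3 := ((mem34 _).1 hy2A2).resolve_right hy2A4
  have hy2w : y2 ≠ w := by rintro rfl; exact hy2A1 hwA1
  have hy1A4 := a32.2.left_mem
  have hy1A3 := a31.2.right_mem
  have hy2y1 : y2 ≠ y1 := by rintro rfl; exact hy2A4 hy1A4
  obtain ⟨A5, A6, a51, a52, a53, a54⟩ := a31.split hE.family hy2A3 hy2w hy2y1
  have mem56 : ∀ z, z ∈ A3 ↔ z ∈ A5 ∨ z ∈ A6 := fun z => by rw [← a53]; rfl
  have int56 : ∀ z, z ∈ A5 → z ∈ A6 → z = y2 := fun z h h' => by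
    have : z ∈ A5 ∩ A6 := ⟨h, h'⟩
    rwa [a54] at this
  obtain ⟨A7, A8, a71, a72, a73, a74⟩ := a1.split hE.family hx1 hxp hxw
  have mem78 : ∀ z, z ∈ A1 ↔ z ∈ A7 ∨ z ∈ A8 := fun z => by rw [← a73]; rfl
  have int78 : ∀ z, z ∈ A7 → z ∈ A8 → z = x := fun z h h' => by
    have : z ∈ A7 ∩ A8 := ⟨h, h'⟩
    rwa [a74] at this
  have hy2A5 := a51.2.right_mem
  have hy2A6 := a52.2.left_mem
  have hy1A6 := a52.2.right_mem
  have hwA5 := a51.2.left_mem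
  have hqA4 := a32.2.right_mem
  have hpA7 := a71.2.left_mem
  have hxA7 := a71.2.right_mem
  have hxA8 := a72.2.left_mem
  have hwA8 := a72.2.right_mem
  have hB1 : ∀ z ∈ B1, z = x ∨ z = y1 ∨ z ∈ C := fun z hz => by
    by_cases h : z = x
    · exact Or.inl h
    by_cases h' : z = y1
    · exact Or.inr (Or.inl h')
    exact Or.inr (Or.inr (b1C ⟨hz, by simp [h, h']⟩))
  have hB2 : ∀ z ∈ B2, z = x ∨ z = y2 ∨ z ∈ D := fun z hz => by
    by_cases h : z = x
    · exact Or.inl h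
    by_cases h' : z = y2
    · exact Or.inr (Or.inl h')
    exact Or.inr (Or.inr (b2D ⟨hz, by simp [h, h']⟩))
  have hCA' : ∀ z ∈ C, z ∉ A := fun z hz => Set.disjoint_left.1 hCA hz
  have hDA' : ∀ z ∈ D, z ∉ A := fun z hz => Set.disjoint_left.1 hDA hz
  have hCD' : ∀ z ∈ C, z ∉ D := fun z hz => Set.disjoint_left.1 hCD hz
  have hxB1 := b1.2.left_mem
  have hy1B1 := b1.2.right_mem
  have hxB2 := b2.2.left_mem
  have hy2B2 := b2.2.right_mem
  have k1 : EArc E x y1 (B2 ∪ A6) := by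
    refine b2.concat hE.family a52 ?_
    ext z
    simp only [mem_inter_iff, mem_singleton_iff]
    constructor
    · grind
    · rintro rfl; exact ⟨hy2B2, hy2A6⟩
  have hls : Loop E x y1 B1 (B2 ∪ A6) := by
    refine ⟨b1, k1, ?_⟩
    ext z
    simp only [mem_inter_iff, mem_singleton_iff, mem_insert_iff, mem_union]
    constructor
    · grind
    · grind
  have hCJ : ∀ z ∈ C, z ∉ J₁ ∪ J₂ := fun z hz => hU.notMem (hCU hz)
  have hDJ : ∀ z ∈ D, z ∉ J₁ ∪ J₂ := fun z hz => hU.notMem (hDU hz)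
  have hVs : V ⊆ (B1 ∪ (B2 ∪ A6))ᶜ := by
    have h1 : ∀ z ∈ V, z ∉ C := fun z hz hz' => Set.disjoint_left.1 hUV (hCU hz') hz
    have h2 : ∀ z ∈ V, z ∉ D := fun z hz hz' => Set.disjoint_left.1 hUV (hDU hz') hz
    have h3 : ∀ z ∈ V, z ∉ A := fun z hz hz' => by
      by_cases h : z = p ∨ z = q
      · rcases h with rfl | rfl
        exacts [hV.notMem hz (Or.inl hpJ1), hV.notMem hz (Or.inl hqJ1)]
      · exact Set.disjoint_left.1 hUV (hAU ⟨hz', h⟩) hz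
    intro z hz
    simp only [mem_compl_iff, mem_union]
    grind
  -- The new closed curve cuts the theta curve into two connected remnants: the stretch of `A`
  -- around `w`, and everything attached to `J₁ ∪ J₂`.
  set inner := A8 \ {x} ∪ A5 \ {y2} with hinner
  set outer := (J₁ ∪ J₂) ∪ (A7 \ {x} ∪ A4 \ {y1}) with houter
  have hin : IsPreconnected inner :=
    IsPreconnected.union w ⟨hwA8, hxw.symm⟩ ⟨hwA5, hy2w.symm⟩ a72.2.isPreconnected_diff_left
      a51.2.isPreconnected_diff_right
  have hout : IsPreconnected outer := by
    have h1 : IsPreconnected (J₁ ∪ J₂) := IsPreconnected.union p hpJ1 hpJ2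
      hl.left.2.isPreconnected hl.right.2.isPreconnected
    have h2 : IsPreconnected ((J₁ ∪ J₂) ∪ A7 \ {x}) := IsPreconnected.union p (Or.inl hpJ1)
      ⟨hpA7, hxp.symm⟩ h1 a71.2.isPreconnected_diff_right
    rw [houter, ← union_assoc]
    exact IsPreconnected.union q (Or.inl (Or.inl hqJ1)) ⟨hqA4, hy1q.symm⟩ h2
      a32.2.isPreconnected_diff_left
  have hinc : inner ⊆ (B1 ∪ (B2 ∪ A6))ᶜ := by
    intro z
    simp only [mem_compl_iff, mem_union, hinner, mem_sdiff, mem_singleton_iff]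
    grind
  have houtc : outer ⊆ (B1 ∪ (B2 ∪ A6))ᶜ := by
    intro z
    simp only [mem_compl_iff, mem_union, houter, mem_sdiff, mem_singleton_iff] at *
    grind
  have hθs : ∀ z ∈ θ, z ∈ inner ∨ z ∈ outer ∨ z ∈ B1 ∪ (B2 ∪ A6) := by
    intro z
    simp only [mem_union, hθ, hinner, houter, mem_sdiff, mem_singleton_iff]
    grind
  have hWs : W ⊆ (B1 ∪ (B2 ∪ A6))ᶜ := by
    have h1 : ∀ z ∈ W, z ∉ C := fun z hz hz' => hz.2 (Or.inl hz')
    have h2 : ∀ z ∈ W, z ∉ D := fun z hz hz' => hz.2 (Or.inr hz')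
    have h3 : ∀ z ∈ W, z ∉ A := fun z hz => hz.1.2
    have hxA : x ∈ A := (mem12 _).2 (Or.inl hx1)
    have hy1A : y1 ∈ A := (mem12 _).2 (Or.inr hy1A2)
    have hy2A : y2 ∈ A := (mem12 _).2 (Or.inr hy2A2)
    rintro z hz (h | h | h)
    · rcases hB1 z h with rfl | rfl | h
      exacts [h3 _ hz hxA, h3 _ hz hy1A, h1 _ hz h]
    · rcases hB2 z h with rfl | rfl | h
      exacts [h3 _ hz hxA, h3 _ hz hy2A, h2 _ hz h]
    · exact h3 _ hz ((mem12 _).2 (Or.inr ((mem34 _).2 (Or.inl ((mem56 _).2 (Or.inr h))))))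
  have hpO : p ∈ outer := Or.inl (Or.inl hpJ1)
  have hwI : w ∈ inner := Or.inl ⟨hwA8, hxw.symm⟩
  have hO : Dom E (B1 ∪ (B2 ∪ A6)) (connectedComponentIn (B1 ∪ (B2 ∪ A6))ᶜ p) :=
    ⟨hls.isElementaryClosedCurve hE.family, p, houtc hpO, rfl⟩
  set O := connectedComponentIn (B1 ∪ (B2 ∪ A6))ᶜ p
  have hpO' : p ∈ O := mem_connectedComponentIn (houtc hpO)
  obtain ⟨I, hI, hOo, hIo, hOI, hOIun⟩ := hO.exists_other hE
  have houtO : outer ⊆ O := hO.subset_of_mem hout houtc hpO hpO'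
  have hWOI : W ⊆ O ∪ I := hOIun ▸ hWs
  rcases (hOIun ▸ hinc hwI : w ∈ O ∪ I) with hw | hw
  · have hinO : inner ⊆ O := hO.subset_of_mem hin hinc hwI hw
    have hVO : V ⊆ O := by
      obtain ⟨z, hz1, hz2⟩ := mem_closure_iff.1 (hV.subset_closure hE (Or.inl hpJ1)) O hOo hpO'
      exact hO.subset_of_mem hV.isPreconnected hVs hz2 hz1
    have hIcov : I ⊆ C ∪ (D ∪ W) := by
      intro z hz
      have hzO : z ∉ O := Set.disjoint_right.1 hOI hz
      rcases hcover z with h | h | h | h | h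
      · exact absurd (hVO h) hzO
      · exact Or.inl h
      · exact Or.inr (Or.inl h)
      · exact Or.inr (Or.inr h)
      · rcases hθs z h with h | h | h
        · exact absurd (hinO h) hzO
        · exact absurd (houtO h) hzO
        · exact absurd h (hI.notMem hz)
    obtain ⟨z1, hz1, hz1ne⟩ := b1.2.nonempty_diff
    obtain ⟨z2, hz2, hz2ne⟩ := b2.2.nonempty_diff
    -- Every point of the new curve is a limit of `I`, so near inner points of `B1` and `B2` the
    -- domain `I` meets `C` and `D`.
    obtain ⟨c, hc1, hc2⟩ := mem_closure_iff.1 (hI.subset_closure hE (Or.inl hz1)) C hCo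
      (b1C ⟨hz1, hz1ne⟩)
    obtain ⟨d, hd1, hd2⟩ := mem_closure_iff.1
      (hI.subset_closure hE (Or.inr (Or.inl hz2))) D hDo (b2D ⟨hz2, hz2ne⟩)
    obtain ⟨z, -, hzC, hzD⟩ := hI.isPreconnected C (D ∪ W) hCo (hDo.union hWo) hIcov
      ⟨c, hc2, hc1⟩ ⟨d, hd2, Or.inl hd1⟩
    rcases hzD with h | h
    · exact Set.disjoint_left.1 hCD hzC h
    · exact Set.disjoint_left.1 hWC hzC h
  · obtain ⟨w', hw'I, hw'W⟩ := mem_closure_iff.1 hwW I hIo hw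
    -- Since `W` misses the new curve, `W ∩ I` is relatively clopen in `W` and `hpiece` applies to
    -- it.
    have hWI : W \ (W ∩ I) = W ∩ O := by
      ext z
      have h1 := @hWOI z
      have h2 : z ∈ O → z ∉ I := fun h => Set.disjoint_left.1 hOI h
      simp only [mem_sdiff, mem_inter_iff, mem_union] at *
      tauto
    obtain ⟨z, hz1, hz2⟩ := hpiece (W ∩ I) inter_subset_left (hWo.inter hIo)
      (hWI ▸ hWo.inter hOo) ⟨w', hw'W, hw'I⟩
    exact hOo.notMem_closure_of_disjoint (hOI.mono_right inter_subset_right)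
      (houtO (Or.inl (Or.inl hz1))) hz2

/-- A cross-cut of a domain splits it into exactly two domains. -/
theorem theta (hE : Axioms E) (hl : Loop E p q J₁ J₂) (hU : Dom E (J₁ ∪ J₂) U)
    (hA : EArc E p q A) (hAU : A \ {p, q} ⊆ U) : ∃ U₁ U₂, Dom E (J₁ ∪ A) U₁ ∧
      Dom E (J₂ ∪ A) U₂ ∧ Disjoint U₁ U₂ ∧ U \ A = U₁ ∪ U₂ := by
  obtain ⟨V, hV, -, -, hUV, hun⟩ := hU.exists_other hE
  obtain ⟨hlA, C, C', hC, -, -, -, -, -, hCU⟩ := theta_side hE hl hU hV hUV hun hA hAU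
  obtain ⟨hlA', D, D', hD, hD', hDD, hDun, hVD, hJD, hDU⟩ := theta_side hE hl.swap
    (by rwa [union_comm]) (by rwa [union_comm]) hUV (by rw [hun, union_comm]) hA hAU
  have hCc : C ⊆ (J₂ ∪ A)ᶜ := by
    rintro z hz (h | h)
    · exact hU.notMem (hCU hz) (Or.inr h)
    · exact hC.notMem hz (Or.inr h)
  -- If they met, connectedness would give `C ⊆ D`, and the inner points of `J₁` would be limits of
  -- `D`; but they lie in the open set `D'`, which is disjoint from `D`.
  have hCD : Disjoint C D := by
    rw [Set.disjoint_left]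
    intro z hz hzD
    have hsub := hD.subset_of_mem hC.isPreconnected hCc hz hzD
    obtain ⟨j, hj, hjne⟩ := hl.left.2.nonempty_diff
    have := closure_mono hsub (hC.subset_closure hE (Or.inl hj))
    exact (hD'.isOpen hE).notMem_closure_of_disjoint hDD.symm (hJD ⟨hj, hjne⟩) this
  refine ⟨C, D, hC, hD, hCD, subset_antisymm ?_ ?_⟩
  · exact theta_exhaust hE hl hU hV hUV hun hA hAU hlA hlA' hC hCU hD hD' hDun hDU hVD hCD
  · apply union_subset
    · exact fun z hz => ⟨hCU hz, fun h => hC.notMem hz (Or.inr h)⟩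
    · exact fun z hz => ⟨hDU hz, fun h => hD.notMem hz (Or.inr h)⟩

end Theta


/-! ### Finite families of crosscuts and what they separate -/

/-- `x` and `y` lie in a connected subset of `S`. -/
def Joined {X : Type*} [TopologicalSpace X] (S : Set X) (x y : X) : Prop :=
  ∃ C, IsPreconnected C ∧ C ⊆ S ∧ x ∈ C ∧ y ∈ C

/-- `A` is an elementary cross-cut of the domain `U` bounded by `J`. -/
def Crosscut {X : Type*} [TopologicalSpace X] (E : Set (Set X)) (J U A : Set X) : Prop :=
  ∃ p q, p ∈ J ∧ q ∈ J ∧ EArc E p q A ∧ A \ {p, q} ⊆ U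

/-- Each side of `A` in `U` meets `B` in a connected set. -/
def Nice {X : Type*} [TopologicalSpace X] (U A B : Set X) : Prop :=
  ∀ u ∈ (B ∩ U) \ A, ∀ v ∈ (B ∩ U) \ A, Joined (U \ A) u v → Joined ((B ∩ U) \ A) u v

section Web

variable {X : Type*} [TopologicalSpace X] [T2Space X] {E : Set (Set X)} {p q r x y z u v : X}
  {A B C S T J J₁ J₂ L L₁ U U₁ V N : Set X}

theorem Joined.symm (h : Joined S x y) : Joined S y x := by
  obtain ⟨C, h1, h2, h3, h4⟩ := h
  exact ⟨C, h1, h2, h4, h3⟩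

theorem Joined.trans (h : Joined S x y) (h' : Joined S y z) : Joined S x z := by
  obtain ⟨C, h1, h2, h3, h4⟩ := h
  obtain ⟨D, k1, k2, k3, k4⟩ := h'
  exact ⟨C ∪ D, h1.union y h4 k3 k1, union_subset h2 k2, Or.inl h3, Or.inr k4⟩

theorem Joined.mono (h : Joined S x y) (hST : S ⊆ T) : Joined T x y := by
  obtain ⟨C, h1, h2, h3, h4⟩ := h
  exact ⟨C, h1, h2.trans hST, h3, h4⟩

theorem Joined.left_mem (h : Joined S x y) : x ∈ S := by
  obtain ⟨C, h1, h2, h3, h4⟩ := h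
  exact h2 h3

theorem Joined.right_mem (h : Joined S x y) : y ∈ S := h.symm.left_mem

theorem _root_.IsPreconnected.joined (h : IsPreconnected S) (hST : S ⊆ T) (hx : x ∈ S)
    (hy : y ∈ S) : Joined T x y := ⟨S, h, hST, hx, hy⟩

theorem Crosscut.isClosed (h : Crosscut E J U A) : IsClosed A := by
  obtain ⟨p, q, -, -, hA, -⟩ := h
  exact hA.2.isClosed

theorem Crosscut.cut (hE : Axioms E) (hU : Dom E J U) (h : Crosscut E J U A) :
    ∃ J₁ U₁ J₂ U₂, Dom E J₁ U₁ ∧ Dom E J₂ U₂ ∧ Disjoint U₁ U₂ ∧ U \ A = U₁ ∪ U₂ ∧ A ⊆ J₁ ∧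
      A ⊆ J₂ := by
  obtain ⟨p, q, hp, hq, hA, hint⟩ := h
  obtain ⟨J₁, J₂, hl, rfl⟩ := hU.1.exists_loop hp hq hA.2.ne
  obtain ⟨U₁, U₂, h1, h2, h3, h4⟩ := theta hE hl hU hA hint
  exact ⟨_, U₁, _, U₂, h1, h2, h3, h4, subset_union_right, subset_union_right⟩

theorem Dom.mem_boundary (hE : Axioms E) (hU : Dom E J U) (hx : x ∈ closure U) (hxU : x ∉ U) :
    x ∈ J := by
  rw [hU.closure_eq hE] at hx
  exact hx.resolve_left hxU

theorem isPreconnected_of_image {f : ℝ → X} (hc : Continuous f) (hi : InjOn f (Icc 0 1))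
    {T : Set ℝ} (hT : T ⊆ Icc 0 1) (h : IsPreconnected (f '' T)) : IsPreconnected T := by
  have hemb : IsEmbedding fun t : unitInterval => f t := by
    refine (Continuous.isClosedEmbedding (hc.comp continuous_subtype_val) ?_).isEmbedding
    intro a b hab
    exact Subtype.ext (hi a.2 b.2 hab)
  have e1 : (Subtype.val : unitInterval → ℝ) '' (Subtype.val ⁻¹' T) = T := by
    rw [Subtype.image_preimage_coe]
    exact inter_eq_right.2 hT
  have e2 : (fun t : unitInterval => f t) '' (Subtype.val ⁻¹' T) = f '' T := by
    rw [← image_image f, e1]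
  rw [← e1]
  refine IsPreconnected.image ?_ _ continuous_subtype_val.continuousOn
  rw [← hemb.isInducing.isPreconnected_image, e2]
  exact h

theorem exists_eq_Ioo {T : Set ℝ} (ho : IsOpen T) (hT : IsConnected T) (h1 : T ⊆ Ioo 0 1) :
    ∃ a b, a < b ∧ 0 ≤ a ∧ b ≤ 1 ∧ T = Ioo a b := by
  have hb : BddBelow T := bddBelow_Ioo.mono h1
  have ha : BddAbove T := bddAbove_Ioo.mono h1
  obtain ⟨t, ht⟩ := hT.nonempty
  have hsub : T ⊆ Ioo (sInf T) (sSup T) := by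
    intro s hs
    obtain ⟨ε, hε, hball⟩ := Metric.isOpen_iff.1 ho s hs
    have m1 : s - ε / 2 ∈ T := hball (by
      rw [Metric.mem_ball, Real.dist_eq, abs_lt]; constructor <;> linarith)
    have m2 : s + ε / 2 ∈ T := hball (by
      rw [Metric.mem_ball, Real.dist_eq, abs_lt]; constructor <;> linarith)
    constructor
    · linarith [csInf_le hb m1]
    · linarith [le_csSup ha m2]
  refine ⟨sInf T, sSup T, ?_, ?_, ?_, hsub.antisymm (hT.Ioo_csInf_csSup_subset hb ha)⟩
  · exact (hsub ht).1.trans (hsub ht).2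
  · exact le_csInf ⟨t, ht⟩ fun s hs => (h1 hs).1.le
  · exact csSup_le ⟨t, ht⟩ fun s hs => (h1 hs).2.le

/-- The trace of a cross-cut on a smaller domain, if connected, is a cross-cut. -/
theorem Crosscut.restrict (hE : Axioms E) (hU : Dom E J U) (h : Crosscut E J U L)
    (hU₁ : Dom E J₁ U₁) (hsub : U₁ ⊆ U) (hc : IsPreconnected (L ∩ U₁)) (hne : (L ∩ U₁).Nonempty) :
    Crosscut E J₁ U₁ (closure (L ∩ U₁)) := by
  obtain ⟨p, q, hp, hq, hL, hint⟩ := h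
  obtain ⟨f, fc, fi, f0, f1, hfL⟩ := hL.2.exists_real
  set T := Ioo (0 : ℝ) 1 ∩ f ⁻¹' U₁ with hT
  have hnot : ∀ t ∈ Icc (0 : ℝ) 1, f t ∈ U₁ → t ∈ T := by
    intro t ht htU
    refine ⟨⟨lt_of_le_of_ne ht.1 ?_, lt_of_le_of_ne ht.2 ?_⟩, htU⟩
    · rintro rfl
      exact hU.notMem (hsub htU) (f0 ▸ hp)
    · rintro rfl
      exact hU.notMem (hsub htU) (f1 ▸ hq)
  have hfT : f '' T = L ∩ U₁ := by
    ext z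
    constructor
    · rintro ⟨t, ht, rfl⟩
      exact ⟨hfL ▸ ⟨t, Ioo_subset_Icc_self ht.1, rfl⟩, ht.2⟩
    · rintro ⟨hz1, hz2⟩
      rw [← hfL] at hz1
      obtain ⟨t, ht, rfl⟩ := hz1
      exact ⟨t, hnot t ht hz2, rfl⟩
  have hTo : IsOpen T := isOpen_Ioo.inter ((hU₁.isOpen hE).preimage fc)
  have hTc : IsConnected T := by
    refine ⟨?_, isPreconnected_of_image fc fi (inter_subset_left.trans Ioo_subset_Icc_self)
      (hfT.symm ▸ hc)⟩
    rw [← hfT] at hne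
    exact hne.of_image
  obtain ⟨a, b, hab, ha, hb, hTab⟩ := exists_eq_Ioo hTo hTc inter_subset_left
  have hcl : closure (L ∩ U₁) = f '' Icc a b := by
    rw [← hfT, hTab, isClosed_closure_image hab fc.continuousOn]
  have fi' : InjOn f (Icc a b) := fi.mono (Icc_subset_Icc ha hb)
  have hclsub : closure (L ∩ U₁) ⊆ closure U₁ := closure_mono inter_subset_right
  -- The ends of the parameter interval map into the closure of `U₁` but not into `U₁`, because `T`
  -- consists of all parameters whose image is in `U₁`.
  have hend : ∀ t ∈ Icc a b, t ∉ Ioo a b → f t ∈ J₁ := by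
    intro t ht ht'
    refine hU₁.mem_boundary hE (hclsub (hcl ▸ mem_image_of_mem f ht)) fun htU => ht' ?_
    rw [← hTab]
    exact hnot t (Icc_subset_Icc ha hb ht) htU
  rw [hcl]
  refine ⟨f a, f b, hend a ⟨le_rfl, hab.le⟩ (by simp), hend b ⟨hab.le, le_rfl⟩ (by simp),
    EArc.of_subset hE.family hL (isArc_image hab fc.continuousOn fi') ?_, ?_⟩
  · rw [← hfL]
    exact image_mono (Icc_subset_Icc ha hb)
  · rw [image_Icc_diff hab fi', ← hTab, hfT]
    exact inter_subset_right

/-- Points of a smaller domain that are not separated by a cross-cut of the larger domain are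
not separated by its trace. -/
theorem Joined.restrict (hE : Axioms E) (hU : Dom E J U) (hL : Crosscut E J U L)
    (hU₁ : Dom E J₁ U₁) (hsub : U₁ ⊆ U) (hL₁ : Crosscut E J₁ U₁ L₁) (hLL : L ∩ U₁ = L₁ ∩ U₁)
    (hx : x ∈ U₁) (hy : y ∈ U₁) (h : Joined (U \ L) x y) : Joined (U₁ \ L₁) x y := by
  obtain ⟨JP, P, JR, R, hP, hR, hPR, hPRU, hP', hR'⟩ := hL₁.cut hE hU₁
  obtain ⟨JV, V, JW, W, hV, hW, hVW, hVWU, hV', hW'⟩ := hL.cut hE hU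
  have hxL : x ∉ L₁ := fun h' => h.left_mem.2 (by
    have : x ∈ L ∩ U₁ := hLL ▸ ⟨h', hx⟩
    exact this.1)
  have hyL : y ∉ L₁ := fun h' => h.right_mem.2 (by
    have : y ∈ L ∩ U₁ := hLL ▸ ⟨h', hy⟩
    exact this.1)
  have hPs : P ⊆ U₁ \ L₁ := hPRU ▸ subset_union_left
  have hRs : R ⊆ U₁ \ L₁ := hPRU ▸ subset_union_right
  have hdiff : U₁ \ L₁ ⊆ U \ L := by
    rintro z ⟨h1, h2⟩
    refine ⟨hsub h1, fun h3 => h2 ?_⟩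
    have : z ∈ L₁ ∩ U₁ := hLL ▸ ⟨h3, h1⟩
    exact this.1
  have hVo := hV.isOpen hE
  have hWo := hW.isOpen hE
  obtain ⟨C, hC1, hC2, hC3, hC4⟩ := h
  -- two sides of the trace cannot lie on the same side of the cross-cut
  have key : ∀ JV JW V W : Set X, Dom E JV V → Dom E JW W → Disjoint V W → U \ L = V ∪ W →
      L ⊆ JW → P ⊆ V → R ⊆ V → False := by
    intro JV JW V W hV hW hVW hVWU hW' hPV hRV
    obtain ⟨p, q, -, -, hA, hint⟩ := hL₁
    obtain ⟨z, hz, hzne⟩ := hA.2.nonempty_diff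
    have hzU := hint ⟨hz, hzne⟩
    have hzL : z ∈ L ∩ U₁ := hLL ▸ ⟨hz, hzU⟩
    -- The crosscut is in the closure of the far side `W` as well, so `W` enters the open set `U₁`
    -- near `z`; there it would have to lie in `P ∪ R`, hence in `V`.
    obtain ⟨w, hw1, hw2⟩ := mem_closure_iff.1 (hW.subset_closure hE (hW' hzL.1)) U₁
      (hU₁.isOpen hE) hzU
    have hwL : w ∉ L := by
      have : w ∈ U \ L := hVWU ▸ Or.inr hw2
      exact this.2
    have hwPR : w ∈ P ∪ R := by
      rw [← hPRU]
      refine ⟨hw1, fun h => hwL ?_⟩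
      have : w ∈ L ∩ U₁ := hLL ▸ ⟨h, hw1⟩
      exact this.1
    rcases hwPR with h | h
    · exact Set.disjoint_left.1 hVW (hPV h) hw2
    · exact Set.disjoint_left.1 hVW (hRV h) hw2
  have side : ∀ D : Set X, IsPreconnected D → D ⊆ U \ L → D ⊆ V ∨ D ⊆ W := fun D hD hDs =>
    IsPreconnected.subset_or_subset hVo hWo hVW (hVWU ▸ hDs) hD
  have nsep : ∀ a b, a ∈ P → b ∈ R → a ∈ C → b ∈ C → False := by
    intro a b ha hb haC hbC
    rcases side C hC1 hC2 with h | h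
    · refine key JV JW V W hV hW hVW hVWU hW' ?_ ?_
      · exact (side P hP.isPreconnected (hPs.trans hdiff)).resolve_right
          fun h' => Set.disjoint_left.1 hVW (h haC) (h' ha)
      · exact (side R hR.isPreconnected (hRs.trans hdiff)).resolve_right
          fun h' => Set.disjoint_left.1 hVW (h hbC) (h' hb)
    · refine key JW JV W V hW hV hVW.symm (by rw [hVWU, union_comm]) hV' ?_ ?_
      · exact (side P hP.isPreconnected (hPs.trans hdiff)).resolve_left
          fun h' => Set.disjoint_left.1 hVW (h' ha) (h haC)
      · exact (side R hR.isPreconnected (hRs.trans hdiff)).resolve_left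
          fun h' => Set.disjoint_left.1 hVW (h' hb) (h hbC)
  have hx' : x ∈ P ∪ R := hPRU ▸ ⟨hx, hxL⟩
  have hy' : y ∈ P ∪ R := hPRU ▸ ⟨hy, hyL⟩
  rcases hx' with hx' | hx' <;> rcases hy' with hy' | hy'
  · exact hP.isPreconnected.joined hPs hx' hy'
  · exact (nsep x y hx' hy' hC3 hC4).elim
  · exact (nsep y x hy' hx' hC4 hC3).elim
  · exact hR.isPreconnected.joined hRs hx' hy'

theorem closure_inter_inter (hL : IsClosed L) : closure (L ∩ U₁) ∩ U₁ = L ∩ U₁ := by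
  apply subset_antisymm
  · rintro z ⟨h1, h2⟩
    exact ⟨hL.closure_subset_iff.2 inter_subset_left h1, h2⟩
  · exact fun z hz => ⟨subset_closure hz, hz.2⟩

/-- Two points that are not separated by any single cross-cut of a finite family of nicely
positioned cross-cuts are not separated by their union. -/
theorem joined_diff_biUnion (hE : Axioms E) {ι : Type*} (s : Finset ι) :
    ∀ (J U : Set X) (L : ι → Set X), Dom E J U →
      (∀ i ∈ s, L i ∩ U = ∅ ∨ Crosscut E J U (L i)) →
      (∀ i ∈ s, ∀ j ∈ s, i ≠ j → Nice U (L i) (L j)) →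
      ∀ x ∈ U, ∀ y ∈ U, (∀ i ∈ s, Joined (U \ L i) x y) → Joined (U \ ⋃ i ∈ s, L i) x y := by
  classical
  induction s using Finset.induction_on with
  | empty =>
    intro J U L hU _ _ x hx y hy _
    exact hU.isPreconnected.joined (by simp) hx hy
  | insert i s his IH =>
    intro J U L hU hL hN x hx y hy hj
    have hL' : ∀ j ∈ s, L j ∩ U = ∅ ∨ Crosscut E J U (L j) := fun j hjs =>
      hL j (Finset.mem_insert_of_mem hjs)
    -- After a cut some of the curves leave no trace in the chosen half; the alternative `L i ∩ U =
    -- ∅` keeps them in the induction.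
    rcases hL i (Finset.mem_insert_self _ _) with hi | hi
    · refine (IH J U L hU hL' (fun j hjs k hks => hN j (Finset.mem_insert_of_mem hjs) k
        (Finset.mem_insert_of_mem hks)) x hx y hy
        (fun j hjs => hj j (Finset.mem_insert_of_mem hjs))).mono ?_
      rintro z ⟨hz1, hz2⟩
      refine ⟨hz1, fun hz3 => hz2 ?_⟩
      rw [Finset.set_biUnion_insert] at hz3
      exact hz3.resolve_left fun h => (hi.subset ⟨h, hz1⟩ : z ∈ (∅ : Set X))
    obtain ⟨J₁, U₁, J₂, U₂, h1, h2, h12, hun, hA1, hA2⟩ := hi.cut hE hU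
    have key : ∀ J₁ U₁ U₂ : Set X, Dom E J₁ U₁ → IsOpen U₂ → Disjoint U₁ U₂ →
        U \ L i = U₁ ∪ U₂ → x ∈ U₁ → Joined (U \ ⋃ j ∈ insert i s, L j) x y := by
      intro J₁ U₁ U₂ h1 ho2 h12 hun hx1
      have ho1 := h1.isOpen hE
      have hU1 : U₁ ⊆ U \ L i := hun ▸ subset_union_left
      have hU1' : U₁ ⊆ U := hU1.trans sdiff_subset
      have stay : ∀ D : Set X, IsPreconnected D → D ⊆ U \ L i → ∀ a ∈ D, a ∈ U₁ → D ⊆ U₁ := by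
        intro D hD hDs a haD ha
        exact (IsPreconnected.subset_or_subset ho1 ho2 h12 (hun ▸ hDs) hD).resolve_right
          fun h => Set.disjoint_left.1 h12 ha (h haD)
      have hy1 : y ∈ U₁ := by
        obtain ⟨D, d1, d2, d3, d4⟩ := hj i (Finset.mem_insert_self _ _)
        exact stay D d1 d2 x d3 hx1 d4
      set L' : ι → Set X := fun j => closure (L j ∩ U₁) with hL'def
      -- Niceness with respect to `L i` says that each curve has a connected trace on the half `U₁`,
      -- so a nonempty trace closes up to a crosscut of `U₁`.
      have hconn : ∀ j ∈ s, IsPreconnected (L j ∩ U₁) := by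
        intro j hjs
        refine isPreconnected_of_forall_pair fun a ha b hb => ?_
        have hij : i ≠ j := by rintro rfl; exact his hjs
        obtain ⟨D, d1, d2, d3, d4⟩ := hN i (Finset.mem_insert_self _ _) j
          (Finset.mem_insert_of_mem hjs) hij a ⟨⟨ha.1, hU1' ha.2⟩, (hU1 ha.2).2⟩ b
          ⟨⟨hb.1, hU1' hb.2⟩, (hU1 hb.2).2⟩ (h1.isPreconnected.joined hU1 ha.2 hb.2)
        have hD := stay D d1 (fun z hz => ⟨(d2 hz).1.2, (d2 hz).2⟩) a d3 ha.2
        exact ⟨D, fun z hz => ⟨(d2 hz).1.1, hD hz⟩, d3, d4, d1⟩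
      have hcl : ∀ j ∈ s, L' j ∩ U₁ = L j ∩ U₁ := by
        intro j hjs
        rcases hL' j hjs with h | h
        · have : L j ∩ U₁ = ∅ := subset_empty_iff.1 (h ▸ inter_subset_inter_right _ hU1')
          simp [hL'def, this]
        · exact closure_inter_inter h.isClosed
      have hcross : ∀ j ∈ s, (L j ∩ U₁).Nonempty → Crosscut E J U (L j) := by
        intro j hjs ⟨z, hz⟩
        refine (hL' j hjs).resolve_left fun h => ?_
        exact (h.subset ⟨hz.1, hU1' hz.2⟩ : z ∈ (∅ : Set X))
      have hsub' : ∀ j ∈ s, U₁ \ L' j ⊆ U \ L j := by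
        rintro j hjs z ⟨hz1, hz2⟩
        refine ⟨hU1' hz1, fun hz => hz2 ?_⟩
        have : z ∈ L' j ∩ U₁ := (hcl j hjs).symm ▸ ⟨hz, hz1⟩
        exact this.1
      have main := IH J₁ U₁ L' h1 ?_ ?_ x hx1 y hy1 ?_
      · refine main.mono ?_
        rintro z ⟨hz1, hz2⟩
        refine ⟨hU1' hz1, fun hz => hz2 ?_⟩
        rw [Finset.set_biUnion_insert] at hz
        rcases hz with hz | hz
        · exact absurd hz (hU1 hz1).2
        · simp only [mem_iUnion] at hz ⊢
          obtain ⟨j, hjs, hz⟩ := hz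
          exact ⟨j, hjs, subset_closure ⟨hz, hz1⟩⟩
      · intro j hjs
        rcases (L j ∩ U₁).eq_empty_or_nonempty with h | h
        · exact Or.inl (by simp [hL'def, h])
        · exact Or.inr ((hcross j hjs h).restrict hE hU h1 hU1' (hconn j hjs) h)
      · rintro j hjs k hks hjk a ⟨ha1, ha2⟩ b ⟨hb1, hb2⟩ hab
        rw [hcl k hks] at ha1 hb1
        obtain ⟨D, d1, d2, d3, d4⟩ := hN j (Finset.mem_insert_of_mem hjs) k
          (Finset.mem_insert_of_mem hks) hjk a
          ⟨⟨ha1.1, hU1' ha1.2⟩, (hsub' j hjs hab.left_mem).2⟩ b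
          ⟨⟨hb1.1, hU1' hb1.2⟩, (hsub' j hjs hab.right_mem).2⟩ (hab.mono (hsub' j hjs))
        obtain ⟨p, q, -, -, hA, -⟩ := hcross k hks ⟨a, ha1⟩
        -- The connecting set `D` may leave `U₁`, but two connected subsets of one arc have a
        -- connected intersection.
        refine ⟨D ∩ (L k ∩ U₁), hA.2.isPreconnected_inter d1 (hconn k hks)
          (fun z hz => (d2 hz).1.1) inter_subset_left, ?_, ⟨d3, ha1⟩, ⟨d4, hb1⟩⟩
        rintro z ⟨hz1, hz2⟩
        refine ⟨(hcl k hks).symm ▸ hz2, fun hz3 => (d2 hz1).2 ?_⟩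
        have : z ∈ L j ∩ U₁ := hcl j hjs ▸ ⟨hz3, hz2.2⟩
        exact this.1
      · intro j hjs
        rcases (L j ∩ U₁).eq_empty_or_nonempty with h | h
        · exact h1.isPreconnected.joined (by simp [hL'def, h]) hx1 hy1
        · exact (hj j (Finset.mem_insert_of_mem hjs)).restrict hE hU (hcross j hjs h) h1 hU1'
            ((hcross j hjs h).restrict hE hU h1 hU1' (hconn j hjs) h) (hcl j hjs).symm hx1 hy1
    have hxi : x ∈ U₁ ∪ U₂ := hun ▸ (hj i (Finset.mem_insert_self _ _)).left_mem
    rcases hxi with hxi | hxi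
    · exact key J₁ U₁ U₂ h1 (h2.isOpen hE) h12 hun hxi
    · exact key J₂ U₂ U₁ h2 (h1.isOpen hE) h12.symm (by rw [hun, union_comm]) hxi

/-- A finite family of nicely positioned cross-cuts. -/
structure Web {X : Type*} [TopologicalSpace X] (E : Set (Set X)) (J U : Set X)
    (𝓛 : Set (Set X)) : Prop where
  finite : 𝓛.Finite
  crosscut : ∀ A ∈ 𝓛, Crosscut E J U A
  nice : ∀ A ∈ 𝓛, ∀ B ∈ 𝓛, A ≠ B → Nice U A B

variable {𝓛 𝓛' : Set (Set X)}

theorem Web.mono (h : Web E J U 𝓛) (hsub : 𝓛' ⊆ 𝓛) : Web E J U 𝓛' :=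
  ⟨h.finite.subset hsub, fun A hA => h.crosscut A (hsub hA),
    fun A hA B hB => h.nice A (hsub hA) B (hsub hB)⟩

theorem Web.joined (hE : Axioms E) (hU : Dom E J U) (h : Web E J U 𝓛) (hx : x ∈ U) (hy : y ∈ U)
    (hj : ∀ A ∈ 𝓛, Joined (U \ A) x y) : Joined (U \ ⋃₀ 𝓛) x y := by
  have := joined_diff_biUnion hE h.finite.toFinset J U id hU
    (fun A hA => Or.inr (h.crosscut A (by simpa using hA)))
    (fun A hA B hB => h.nice A (by simpa using hA) B (by simpa using hB)) x hx y hy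
    (fun A hA => hj A (by simpa using hA))
  rw [sUnion_eq_biUnion]
  simpa using this

theorem Crosscut.dense_compl (hE : Axioms E) (hU : Dom E J U) (h : Crosscut E J U A) :
    Dense Aᶜ := by
  obtain ⟨J₁, U₁, J₂, U₂, h1, h2, h12, hun, hA1, hA2⟩ := h.cut hE hU
  intro z
  by_cases hz : z ∈ A
  · refine closure_mono (fun w hw => ?_) (h1.subset_closure hE (hA1 hz))
    have : w ∈ U \ A := hun ▸ Or.inl hw
    exact this.2
  · exact subset_closure hz

/-- Every crosscut is closed with dense complement, so finitely many of them cannot fill an open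
subset of the domain. -/
theorem Web.exists_mem [CompactSpace X] (hE : Axioms E) (hU : Dom E J U) (h : Web E J U 𝓛)
    (hx : x ∈ closure U) (hN : IsOpen N) (hxN : x ∈ N) : ∃ z ∈ N, z ∈ U \ ⋃₀ 𝓛 := by
  have hd : Dense (⋂₀ (compl '' 𝓛)) := by
    refine dense_sInter_of_isOpen ?_ (h.finite.image _).countable ?_
    · rintro _ ⟨A, hA, rfl⟩
      exact (h.crosscut A hA).isClosed.isOpen_compl
    · rintro _ ⟨A, hA, rfl⟩
      exact (h.crosscut A hA).dense_compl hE hU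
  obtain ⟨w, hw1, hw2⟩ := mem_closure_iff.1 hx N hN hxN
  obtain ⟨z, hz1, hz2⟩ := hd.inter_open_nonempty _ (hN.inter (hU.isOpen hE)) ⟨w, hw1, hw2⟩
  refine ⟨z, hz1.1, hz1.2, ?_⟩
  rintro ⟨A, hA, hzA⟩
  exact hz2 Aᶜ ⟨A, hA, rfl⟩ hzA

theorem Crosscut.exists_nhds (hE : Axioms E) (hU : Dom E J U) (h : Crosscut E J U A)
    (hx : x ∈ U) (hxA : x ∉ A) : ∃ N, IsOpen N ∧ x ∈ N ∧ ∀ z ∈ N, Joined (U \ A) x z := by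
  obtain ⟨J₁, U₁, J₂, U₂, h1, h2, h12, hun, hA1, hA2⟩ := h.cut hE hU
  have : x ∈ U₁ ∪ U₂ := hun ▸ ⟨hx, hxA⟩
  rcases this with h | h
  · exact ⟨U₁, h1.isOpen hE, h, fun z hz =>
      h1.isPreconnected.joined (hun ▸ subset_union_left) h hz⟩
  · exact ⟨U₂, h2.isOpen hE, h, fun z hz =>
      h2.isPreconnected.joined (hun ▸ subset_union_right) h hz⟩

theorem Web.exists_nhds (hE : Axioms E) (hU : Dom E J U) (h : Web E J U 𝓛)
    (hx : x ∈ U \ ⋃₀ 𝓛) : ∃ N, IsOpen N ∧ x ∈ N ∧ N ⊆ U ∧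
      ∀ z ∈ N, ∀ A ∈ 𝓛, Joined (U \ A) x z := by
  have : ∀ A : 𝓛, ∃ N, IsOpen N ∧ x ∈ N ∧ ∀ z ∈ N, Joined (U \ A) x z := fun A =>
    (h.crosscut A A.2).exists_nhds hE hU hx.1 fun hA => hx.2 ⟨A, A.2, hA⟩
  choose N hN1 hN2 hN3 using this
  have := h.finite.to_subtype
  refine ⟨U ∩ ⋂ A, N A, (hU.isOpen hE).inter (isOpen_iInter_of_finite hN1),
    ⟨hx.1, mem_iInter.2 hN2⟩, inter_subset_left, fun z hz A hA => ?_⟩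
  exact hN3 ⟨A, hA⟩ z (mem_iInter.1 hz.2 _)

end Web

/-! ### The mesh of a family of crosscuts -/

section Mesh

variable {X : Type*} [MetricSpace X] [CompactSpace X] {E : Set (Set X)} {x y z : X}
  {J U V N : Set X} {𝓛 𝓛' S : Set (Set X)} {ε : ℝ}

/-- Points that are not separated by any of the curves in `𝓛` are at distance at most `ε`. -/
def Mesh {X : Type*} [MetricSpace X] (U : Set X) (𝓛 : Set (Set X)) (ε : ℝ) : Prop :=
  ∀ x ∈ U \ ⋃₀ 𝓛, ∀ y ∈ U \ ⋃₀ 𝓛, (∀ A ∈ 𝓛, Joined (U \ A) x y) → dist x y ≤ ε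

theorem Mesh.mono (h : Mesh U 𝓛 ε) (hsub : 𝓛 ⊆ 𝓛') : Mesh U 𝓛' ε := fun x hx y hy hj =>
  h x ⟨hx.1, fun h' => hx.2 (sUnion_mono hsub h')⟩ y ⟨hy.1, fun h' => hy.2 (sUnion_mono hsub h')⟩
    fun A hA => hj A (hsub hA)

/-- Removing one cross-cut at most doubles the mesh. -/
theorem Mesh.diff (hE : Axioms E) (hU : Dom E J U) (hW : Web E J U 𝓛) (hε : 0 ≤ ε)
    (h : Mesh U 𝓛 ε) (hS : S.Subsingleton) : Mesh U (𝓛 \ S) (2 * ε) := by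
  by_cases hV : ∃ V ∈ 𝓛, V ∈ S
  swap
  · push Not at hV
    rw [sdiff_eq_left.2 (Set.disjoint_left.2 hV)]
    intro x hx y hy hj
    linarith [h x hx y hy hj]
  obtain ⟨V, hV, hVS⟩ := hV
  have hVS' : 𝓛 \ S = 𝓛 \ {V} := by
    rw [hS.eq_singleton_of_mem hVS]
  rw [hVS']
  clear hVS hVS' hS
  have hsub : 𝓛 \ {V} ⊆ 𝓛 := sdiff_subset
  have hW' := hW.mono hsub
  have hmem : ∀ z, z ∉ ⋃₀ (𝓛 \ {V}) → z ∉ V → z ∉ ⋃₀ 𝓛 := by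
    rintro z h1 h2 ⟨A, hA, hz⟩
    by_cases hAV : A = V
    · exact h2 (hAV ▸ hz)
    · exact h1 ⟨A, ⟨hA, hAV⟩, hz⟩
  obtain ⟨J₁, U₁, J₂, U₂, h1, h2, h12, hun, hA1, hA2⟩ := (hW.crosscut V hV).cut hE hU
  have hU1 : U₁ ⊆ U \ V := hun ▸ subset_union_left
  have hU2 : U₂ ⊆ U \ V := hun ▸ subset_union_right
  -- points on different sides of the removed cross-cut
  have opp : ∀ U₁ U₂ : Set X, IsPreconnected U₁ → IsPreconnected U₂ → U₁ ⊆ U \ V → U₂ ⊆ U \ V →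
      V ⊆ closure U₁ → V ⊆ closure U₂ → U \ V = U₁ ∪ U₂ →
      ∀ x ∈ U₁, ∀ y ∈ U₂, x ∈ U \ ⋃₀ 𝓛 → y ∈ U \ ⋃₀ 𝓛 →
      (∀ A ∈ 𝓛 \ {V}, Joined (U \ A) x y) → dist x y ≤ 2 * ε := by
    intro U₁ U₂ c1 c2 s1 s2 k1 k2 hun x hx1 y hy2 hx hy hj
    by_cases hjV : Joined (U \ V) x y
    · have : dist x y ≤ ε := h x hx y hy fun A hA => by
        by_cases hAV : A = V
        · exact hAV ▸ hjV
        · exact hj A ⟨hA, hAV⟩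
      linarith
    -- By the separation principle a connected set off the remaining curves joins the two points,
    -- and it must cross `V` at some `w`. Points near `w` on the two sides of `V` are close to each
    -- other, and each is within `ε` of `x` or of `y`, on whose side of `V` it lies.
    obtain ⟨C, hC1, hC2, hC3, hC4⟩ := hW'.joined hE hU hx.1 hy.1 hj
    obtain ⟨w, hwC, hwV⟩ : ∃ w ∈ C, w ∈ V := by
      by_contra hno
      push Not at hno
      exact hjV ⟨C, hC1, fun z hz => ⟨(hC2 hz).1, hno z hz⟩, hC3, hC4⟩
    obtain ⟨N, hN, hwN, hNU, hNj⟩ := hW'.exists_nhds hE hU (hC2 hwC)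
    refine le_of_forall_pos_le_add fun δ hδ => ?_
    have ho : IsOpen (N ∩ Metric.ball w (δ / 2)) := hN.inter Metric.isOpen_ball
    have hwo : w ∈ N ∩ Metric.ball w (δ / 2) := ⟨hwN, Metric.mem_ball_self (by linarith)⟩
    obtain ⟨x', ⟨hx'N, hx'b⟩, hx'1⟩ := mem_closure_iff.1 (k1 hwV) _ ho hwo
    obtain ⟨y', ⟨hy'N, hy'b⟩, hy'2⟩ := mem_closure_iff.1 (k2 hwV) _ ho hwo
    have jw : ∀ a ∈ C, ∀ z ∈ N, ∀ A ∈ 𝓛 \ {V}, Joined (U \ A) a z := by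
      intro a ha z hz A hA
      refine Joined.trans (hC1.joined (hC2.trans ?_) ha hwC) (hNj z hz A hA)
      exact sdiff_subset_sdiff_right (subset_sUnion_of_mem hA)
    have hnot : ∀ z ∈ N, z ∉ ⋃₀ (𝓛 \ {V}) := by
      rintro z hz ⟨A, hA, hzA⟩
      exact (hNj z hz A hA).right_mem.2 hzA
    have d1 : dist x x' ≤ ε := h x hx x' ⟨hNU hx'N, hmem _ (hnot _ hx'N) (s1 hx'1).2⟩
      fun A hA => by
        by_cases hAV : A = V
        · exact hAV ▸ c1.joined s1 hx1 hx'1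
        · exact jw x hC3 x' hx'N A ⟨hA, hAV⟩
    have d2 : dist y y' ≤ ε := h y hy y' ⟨hNU hy'N, hmem _ (hnot _ hy'N) (s2 hy'2).2⟩
      fun A hA => by
        by_cases hAV : A = V
        · exact hAV ▸ c2.joined s2 hy2 hy'2
        · exact jw y hC4 y' hy'N A ⟨hA, hAV⟩
    rw [Metric.mem_ball] at hx'b hy'b
    have t1 := dist_triangle x x' y
    have t2 := dist_triangle x' w y
    have t3 := dist_triangle w y' y
    rw [dist_comm y y'] at d2
    rw [dist_comm y' w] at hy'b
    linarith
  have off : ∀ x ∈ U \ ⋃₀ (𝓛 \ {V}), ∀ y ∈ U \ ⋃₀ (𝓛 \ {V}), x ∉ V → y ∉ V →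
      (∀ A ∈ 𝓛 \ {V}, Joined (U \ A) x y) → dist x y ≤ 2 * ε := by
    intro x hx y hy hxV hyV hj
    have hx' : x ∈ U \ ⋃₀ 𝓛 := ⟨hx.1, hmem x hx.2 hxV⟩
    have hy' : y ∈ U \ ⋃₀ 𝓛 := ⟨hy.1, hmem y hy.2 hyV⟩
    have same : Joined (U \ V) x y → dist x y ≤ 2 * ε := by
      intro hjV
      have : dist x y ≤ ε := h x hx' y hy' fun A hA => by
        by_cases hAV : A = V
        · exact hAV ▸ hjV
        · exact hj A ⟨hA, hAV⟩
      linarith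
    have k1 := hA1.trans (h1.subset_closure hE)
    have k2 := hA2.trans (h2.subset_closure hE)
    rcases (hun ▸ ⟨hx.1, hxV⟩ : x ∈ U₁ ∪ U₂) with a | a <;>
      rcases (hun ▸ ⟨hy.1, hyV⟩ : y ∈ U₁ ∪ U₂) with b | b
    · exact same (h1.isPreconnected.joined hU1 a b)
    · exact opp U₁ U₂ h1.isPreconnected h2.isPreconnected hU1 hU2 k1 k2 hun x a y b hx' hy' hj
    · exact opp U₂ U₁ h2.isPreconnected h1.isPreconnected hU2 hU1 k2 k1
        (by rw [hun, union_comm]) x a y b hx' hy' hj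
    · exact same (h2.isPreconnected.joined hU2 a b)
  intro x hx y hy hj
  refine le_of_forall_pos_le_add fun δ hδ => ?_
  -- The points may lie on `V` itself; they are replaced by nearby points off all curves that the
  -- remaining curves do not separate from them.
  have approx : ∀ a ∈ U \ ⋃₀ (𝓛 \ {V}), ∃ b ∈ U \ ⋃₀ (𝓛 \ {V}), b ∉ V ∧ dist a b < δ / 2 ∧
      ∀ A ∈ 𝓛 \ {V}, Joined (U \ A) a b := by
    intro a ha
    obtain ⟨N, hN, haN, hNU, hNj⟩ := hW'.exists_nhds hE hU ha
    obtain ⟨b, ⟨hbN, hbb⟩, hb⟩ := hW.exists_mem hE hU (subset_closure ha.1)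
      (hN.inter Metric.isOpen_ball) ⟨haN, Metric.mem_ball_self (by linarith : 0 < δ / 2)⟩
    refine ⟨b, ⟨hb.1, fun h' => hb.2 (sUnion_mono hsub h')⟩, fun h' => hb.2 ⟨V, hV, h'⟩, ?_,
      hNj b hbN⟩
    rwa [dist_comm]
  obtain ⟨x', hx', hx'V, dx, jx⟩ := approx x hx
  obtain ⟨y', hy', hy'V, dy, jy⟩ := approx y hy
  have := off x' hx' y' hy' hx'V hy'V fun A hA => ((jx A hA).symm.trans (hj A hA)).trans (jy A hA)
  have t1 := dist_triangle x x' y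
  have t2 := dist_triangle x' y' y
  rw [dist_comm y y'] at dy
  linarith

end Mesh


/-! ### Quadrilaterals given by four sides, and their symmetries -/

/-- An elementary quadrilateral presented by its four sides. -/
structure Quad {X : Type*} [TopologicalSpace X] (E : Set (Set X)) where
  a : X
  b : X
  c : X
  d : X
  bot : Set X
  right : Set X
  top : Set X
  left : Set X
  dom : Set X
  arc_bot : EArc E a b bot
  arc_right : EArc E b c right
  arc_top : EArc E d c top
  arc_left : EArc E a d left
  bot_right : bot ∩ right = {b}
  right_top : right ∩ top = {c}
  top_left : top ∩ left = {d}
  left_bot : left ∩ bot = {a}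
  bot_top : Disjoint bot top
  left_right : Disjoint left right
  isDom : Dom E (bot ∪ right ∪ top ∪ left) dom

namespace Quad

section Basic

variable {X : Type*} [TopologicalSpace X] {E : Set (Set X)}

/-- The boundary curve. -/
def curve (Q : Quad E) : Set X := Q.bot ∪ Q.right ∪ Q.top ∪ Q.left

/-- The closed quadrilateral. -/
def cl (Q : Quad E) : Set X := Q.dom ∪ Q.curve

variable [T2Space X]

/-- The quadrilateral with the roles of the horizontal and the vertical sides exchanged. -/
def transpose (Q : Quad E) : Quad E where
  a := Q.a
  b := Q.d
  c := Q.c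
  d := Q.b
  bot := Q.left
  right := Q.top
  top := Q.right
  left := Q.bot
  dom := Q.dom
  arc_bot := Q.arc_left
  arc_right := Q.arc_top
  arc_top := Q.arc_right
  arc_left := Q.arc_bot
  bot_right := by rw [inter_comm, Q.top_left]
  right_top := by rw [inter_comm, Q.right_top]
  top_left := by rw [inter_comm, Q.bot_right]
  left_bot := by rw [inter_comm, Q.left_bot]
  bot_top := Q.left_right
  left_right := Q.bot_top
  isDom := by
    have := Q.isDom
    rwa [show Q.left ∪ Q.top ∪ Q.right ∪ Q.bot = Q.bot ∪ Q.right ∪ Q.top ∪ Q.left by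
      ext z; simp only [mem_union]; tauto]

/-- The mirror image, with left and right exchanged. -/
def mirror (Q : Quad E) : Quad E where
  a := Q.b
  b := Q.a
  c := Q.d
  d := Q.c
  bot := Q.bot
  right := Q.left
  top := Q.top
  left := Q.right
  dom := Q.dom
  arc_bot := Q.arc_bot.symm
  arc_right := Q.arc_left
  arc_top := Q.arc_top.symm
  arc_left := Q.arc_right
  bot_right := by rw [inter_comm, Q.left_bot]
  right_top := by rw [inter_comm, Q.top_left]
  top_left := by rw [inter_comm, Q.right_top]
  left_bot := by rw [inter_comm, Q.bot_right]
  bot_top := Q.bot_top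
  left_right := Q.left_right.symm
  isDom := by
    have := Q.isDom
    rwa [show Q.bot ∪ Q.left ∪ Q.top ∪ Q.right = Q.bot ∪ Q.right ∪ Q.top ∪ Q.left by
      ext z; simp only [mem_union]; tauto]

theorem dom_curve (Q : Quad E) : Dom E Q.curve Q.dom := Q.isDom

theorem cl_eq (hE : Axioms E) (Q : Quad E) : Q.cl = closure Q.dom :=
  (Q.dom_curve.closure_eq hE).symm

theorem isClosed_cl (hE : Axioms E) (Q : Quad E) : IsClosed Q.cl := by
  rw [Q.cl_eq hE]; exact isClosed_closure

/-- `V` is an elementary curve through `Q` from a point of the bottom side to a point of the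
top side. -/
def Crossing (Q : Quad E) (V : Set X) : Prop :=
  ∃ x ∈ Q.bot, ∃ y ∈ Q.top, EArc E x y V ∧ V \ {x, y} ⊆ Q.dom

theorem Crossing.crosscut {Q : Quad E} {V : Set X} (h : Q.Crossing V) :
    Crosscut E Q.curve Q.dom V := by
  obtain ⟨x, hx, y, hy, hV, hint⟩ := h
  exact ⟨x, y, Or.inl (Or.inl (Or.inl hx)), Or.inl (Or.inr hy), hV, hint⟩

theorem curve_transpose (Q : Quad E) : Q.transpose.curve = Q.curve := by
  ext z
  simp only [curve, transpose, mem_union]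
  tauto

theorem Crossing.crosscut_transpose {Q : Quad E} {H : Set X} (h : Q.transpose.Crossing H) :
    Crosscut E Q.curve Q.dom H := Q.curve_transpose ▸ h.crosscut

end Basic

end Quad

/-! ### Grids in a quadrilateral as nicely positioned families -/

section Pieces

variable {X : Type*} [TopologicalSpace X] [T2Space X] {E : Set (Set X)} {p q r x y z u v : X}
  {A B C S T J J₁ J₂ L U U₁ V H N P : Set X}

theorem _root_.IsPreconnected.subset_left_of_inter (hP : IsPreconnected P) (hA : IsClosed A)
    (hB : IsClosed B) (hsub : P ⊆ A ∪ B) (hAB : ∀ z ∈ A, z ∈ B → z ∉ P) (hx : x ∈ P)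
    (hxA : x ∈ A) : P ⊆ A := by
  refine (isPreconnected_iff_subset_of_disjoint_closed.1 hP A B hA hB hsub ?_).resolve_right
    fun h => hAB x hxA (h hx) hx
  ext z
  simp only [mem_inter_iff, mem_empty_iff_false, iff_false]
  exact fun h => hAB z h.2.1 h.2.2 h.1

theorem Crosscut.inter_eq (hU : Dom E J U) (hp : p ∈ J) (hq : q ∈ J) (hint : A \ {p, q} ⊆ U) :
    A ∩ U = A \ {p, q} := by
  ext z
  constructor
  · rintro ⟨h1, h2⟩
    refine ⟨h1, ?_⟩
    rintro (rfl | rfl)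
    exacts [hU.notMem h2 hp, hU.notMem h2 hq]
  · exact fun h => ⟨h.1, hint h⟩

theorem nice_of_disjoint (hU : Dom E J U) (hB : Crosscut E J U B)
    (h : ∀ z ∈ U, z ∈ A → z ∉ B) : Nice U A B := by
  obtain ⟨p, q, hp, hq, hB', hint⟩ := hB
  intro u hu v hv _
  refine IsPreconnected.joined ?_ subset_rfl hu hv
  have : (B ∩ U) \ A = B \ {p, q} := by
    rw [← Crosscut.inter_eq hU hp hq hint]
    exact sdiff_eq_left.2 (Set.disjoint_left.2 fun z hz hzA => h z hz.2 hzA hz.1)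
  rw [this]
  exact hB'.2.isPreconnected_diff

theorem IsArc.isPreconnected_diff_pair (h : IsArc p q A) (hx : x ∈ A → x = p ∨ x = q)
    (hy : y ∈ A → y = p ∨ y = q) : IsPreconnected (A \ {x, y}) := by
  have hp := h.left_mem
  have hq := h.right_mem
  have e : ∀ T : Set X, (∀ z ∈ A, z ∈ T ↔ z = x ∨ z = y) → A \ {x, y} = A \ T := by
    intro T hT
    ext z
    simp only [mem_sdiff, mem_insert_iff, mem_singleton_iff]
    constructor
    · exact fun ⟨h1, h2⟩ => ⟨h1, fun h3 => h2 ((hT z h1).1 h3)⟩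
    · exact fun ⟨h1, h2⟩ => ⟨h1, fun h3 => h2 ((hT z h1).2 h3)⟩
  by_cases hpm : p = x ∨ p = y <;> by_cases hqm : q = x ∨ q = y
  · rw [e {p, q} (fun z hz => by simp only [mem_insert_iff, mem_singleton_iff]; grind)]
    exact h.isPreconnected_diff
  · rw [e {p} (fun z hz => by simp only [mem_singleton_iff]; grind)]
    exact h.isPreconnected_diff_left
  · rw [e {q} (fun z hz => by simp only [mem_singleton_iff]; grind)]
    exact h.isPreconnected_diff_right
  · rw [e ∅ (fun z hz => by simp only [mem_empty_iff_false]; grind)]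
    rw [sdiff_empty]
    exact h.isPreconnected

/-- The end points of a crossing separate the other two sides. -/
theorem Quad.exists_loop (Q : Quad E) (hx : x ∈ Q.bot) (hy : y ∈ Q.top) :
    ∃ J₁ J₂, Loop E x y J₁ J₂ ∧ J₁ ∪ J₂ = Q.curve ∧ Q.left \ {x, y} ⊆ J₁ ∧
      Q.right \ {x, y} ⊆ J₂ := by
  have hxy : x ≠ y := fun h => Set.disjoint_left.1 Q.bot_top hx (h ▸ hy)
  obtain ⟨J₁, J₂, hl, hun⟩ := Q.isDom.1.exists_loop (p := x) (q := y)
    (Or.inl (Or.inl (Or.inl hx))) (Or.inl (Or.inr hy)) hxy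
  have c1 := hl.left.2.isClosed
  have c2 := hl.right.2.isClosed
  have hsplit : ∀ D : Set X, IsPreconnected (D \ {x, y}) → D ⊆ Q.curve →
      D \ {x, y} ⊆ J₁ ∨ D \ {x, y} ⊆ J₂ := by
    intro D hD hDs
    refine isPreconnected_iff_subset_of_disjoint_closed.1 hD J₁ J₂ c1 c2 ?_ ?_
    · exact sdiff_subset.trans (hDs.trans hun.superset)
    · rw [hl.inter]
      exact sdiff_inter_self
  have hleft : IsPreconnected (Q.left \ {x, y}) := by
    refine Q.arc_left.2.isPreconnected_diff_pair (fun h => ?_) (fun h => ?_)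
    · exact Or.inl (Q.left_bot.subset ⟨h, hx⟩)
    · exact Or.inr (Q.top_left.subset ⟨hy, h⟩)
  have hright : IsPreconnected (Q.right \ {x, y}) := by
    refine Q.arc_right.2.isPreconnected_diff_pair (fun h => ?_) (fun h => ?_)
    · exact Or.inl (Q.bot_right.subset ⟨hx, h⟩)
    · exact Or.inr (Q.right_top.subset ⟨h, hy⟩)
  -- Were both lateral sides on `J₁`, the connected arc `J₂` would be covered by the disjoint closed
  -- sets `bot` and `top` while meeting both.
  have nosame : ∀ J₁ J₂ : Set X, Loop E x y J₁ J₂ → J₁ ∪ J₂ = Q.bot ∪ Q.right ∪ Q.top ∪ Q.left →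
      Q.left \ {x, y} ⊆ J₁ → Q.right \ {x, y} ⊆ J₁ → False := by
    intro J₁ J₂ hl hun h1 h2
    have hcov : J₂ ⊆ Q.bot ∪ Q.top := by
      intro z hz
      by_cases hzx : z = x
      · exact Or.inl (hzx ▸ hx)
      by_cases hzy : z = y
      · exact Or.inr (hzy ▸ hy)
      have hz1 : z ∉ J₁ := fun h => by
        rcases hl.inter.subset ⟨h, hz⟩ with h | h
        exacts [hzx h, hzy h]
      rcases hun.subset (Or.inr hz) with ((h | h) | h) | h
      · exact Or.inl h
      · exact absurd (h2 ⟨h, by simp [hzx, hzy]⟩) hz1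
      · exact Or.inr h
      · exact absurd (h1 ⟨h, by simp [hzx, hzy]⟩) hz1
    have := hl.right.2.isPreconnected.subset_left_of_inter Q.arc_bot.2.isClosed
      Q.arc_top.2.isClosed hcov (fun z h h' => absurd h' (Set.disjoint_left.1 Q.bot_top h))
      hl.right.2.left_mem hx
    exact Set.disjoint_left.1 Q.bot_top (this hl.right.2.right_mem) hy
  have sl : Q.left ⊆ Q.curve := subset_union_right
  have sr : Q.right ⊆ Q.curve := fun z hz => Or.inl (Or.inl (Or.inr hz))
  rcases hsplit _ hleft sl with h1 | h1 <;> rcases hsplit _ hright sr with h2 | h2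
  · exact (nosame J₁ J₂ hl hun h1 h2).elim
  · exact ⟨J₁, J₂, hl, hun, h1, h2⟩
  · exact ⟨J₂, J₁, hl.swap, by rw [union_comm]; exact hun, h1, h2⟩
  · exact (nosame J₂ J₁ hl.swap (by rw [union_comm]; exact hun) h1 h2).elim

/-- The curve `V` splits the quadrilateral into a part at the left side and a part at the right
side, and `z` splits `H` into two halves. Each open half misses `V`, hence stays in the part in
which it starts, so each part contains exactly one half. -/
theorem Quad.nice_of_crossing (hE : Axioms E) (Q : Quad E) (hV : Q.Crossing V)
    (hH : Q.transpose.Crossing H) (hz : V ∩ H = {z}) : Nice Q.dom V H := by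
  -- Lines of a grid may end at a vertex, so the common point can lie on the boundary; inside the
  -- domain the curves are then disjoint.
  by_cases hzU : z ∈ Q.dom
  swap
  · refine nice_of_disjoint Q.dom_curve hH.crosscut_transpose fun w hw h1 h2 => ?_
    have : w = z := hz.subset ⟨h1, h2⟩
    exact hzU (this ▸ hw)
  obtain ⟨x, hx, y, hy, hVarc, hVint⟩ := hV
  obtain ⟨h, hh, h', hh', hHarc, hHint⟩ := hH
  change h ∈ Q.left at hh
  change h' ∈ Q.right at hh'
  change H \ {h, h'} ⊆ Q.dom at hHint
  have hJ : ∀ w ∈ Q.dom, w ∉ Q.curve := fun w hw => Q.dom_curve.notMem hw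
  have hhJ : h ∈ Q.curve := Or.inr hh
  have hhJ' : h' ∈ Q.curve := Or.inl (Or.inl (Or.inr hh'))
  have hzV : z ∈ V := (hz.superset rfl).1
  have hzH : z ∈ H := (hz.superset rfl).2
  have hint : ∀ w ∈ V, w ∈ H → w = z := fun w h1 h2 => hz.subset ⟨h1, h2⟩
  have hzh : z ≠ h := by rintro rfl; exact hJ _ hzU hhJ
  have hzh' : z ≠ h' := by rintro rfl; exact hJ _ hzU hhJ'
  have hhV : h ∉ V := fun hV => hzh (hint h hV hHarc.2.left_mem).symm
  have hhV' : h' ∉ V := fun hV => hzh' (hint h' hV hHarc.2.right_mem).symm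
  have hne : ∀ w, w ∉ V → w ∉ ({x, y} : Set X) := by
    rintro w hw (rfl | rfl)
    exacts [hw hVarc.2.left_mem, hw hVarc.2.right_mem]
  obtain ⟨J₁, J₂, hl, hun, hJ1, hJ2⟩ := Q.exists_loop hx hy
  obtain ⟨U₁, U₂, k1, k2, k12, kun⟩ := theta hE hl (U := Q.dom) (by rw [hun]; exact Q.dom_curve)
    hVarc hVint
  have ko1 := k1.isOpen hE
  have ko2 := k2.isOpen hE
  obtain ⟨Ha, Hb, ha, hb, hab, habi⟩ := hHarc.split hE.family hzH hzh hzh'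
  have memH : ∀ w, w ∈ H ↔ w ∈ Ha ∨ w ∈ Hb := fun w => by rw [← hab]; rfl
  have hh'a : h' ∉ Ha := fun h1 => hzh' (habi.subset ⟨h1, hb.2.right_mem⟩).symm
  have hhb : h ∉ Hb := fun h1 => hzh (habi.subset ⟨ha.2.left_mem, h1⟩).symm
  have sa : Ha \ {h, z} ⊆ U₁ ∪ U₂ := by
    rintro w ⟨hw1, hw2⟩
    simp only [mem_insert_iff, mem_singleton_iff, not_or] at hw2
    have hwH : w ∈ H := (memH w).2 (Or.inl hw1)
    rw [← kun]
    refine ⟨hHint ⟨hwH, ?_⟩, fun hwV => hw2.2 (hint w hwV hwH)⟩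
    rintro (rfl | rfl)
    exacts [hw2.1 rfl, hh'a hw1]
  have sb : Hb \ {z, h'} ⊆ U₁ ∪ U₂ := by
    rintro w ⟨hw1, hw2⟩
    simp only [mem_insert_iff, mem_singleton_iff, not_or] at hw2
    have hwH : w ∈ H := (memH w).2 (Or.inr hw1)
    rw [← kun]
    refine ⟨hHint ⟨hwH, ?_⟩, fun hwV => hw2.1 (hint w hwV hwH)⟩
    rintro (rfl | rfl)
    exacts [hhb hw1, hw2.2 rfl]
  have inJ : ∀ w, w ∈ J₁ → w ∈ J₂ → w ∈ ({x, y} : Set X) := fun w h1 h2 => hl.inter.subset ⟨h1, h2⟩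
  -- The end `h` lies on the left side and off `V`, so it is not in the closure of `U₂`.
  have a1 : Ha \ {h, z} ⊆ U₁ := by
    refine (IsPreconnected.subset_or_subset ko1 ko2 k12 sa
      ha.2.isPreconnected_diff).resolve_right fun hc => ?_
    have := closure_mono hc (ha.2.subset_closure ha.2.left_mem)
    rw [k2.closure_eq hE] at this
    rcases this with h1 | h1 | h1
    · exact hJ h (by
        have : h ∈ Q.dom \ V := kun ▸ Or.inr h1
        exact this.1) hhJ
    · exact hne h hhV (inJ h (hJ1 ⟨hh, hne h hhV⟩) h1)
    · exact hhV h1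
  have b2 : Hb \ {z, h'} ⊆ U₂ := by
    refine (IsPreconnected.subset_or_subset ko1 ko2 k12 sb
      hb.2.isPreconnected_diff).resolve_left fun hc => ?_
    have := closure_mono hc (hb.2.subset_closure hb.2.right_mem)
    rw [k1.closure_eq hE] at this
    rcases this with h1 | h1 | h1
    · exact hJ h' (by
        have : h' ∈ Q.dom \ V := kun ▸ Or.inl h1
        exact this.1) hhJ'
    · exact hne h' hhV' (inJ h' h1 (hJ2 ⟨hh', hne h' hhV'⟩))
    · exact hhV' h1
  have half : ∀ w ∈ (H ∩ Q.dom) \ V, w ∈ Ha \ {h, z} ∨ w ∈ Hb \ {z, h'} := by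
    rintro w ⟨⟨hw1, hw2⟩, hw3⟩
    have e1 : w ≠ h := by rintro rfl; exact hJ _ hw2 hhJ
    have e2 : w ≠ h' := by rintro rfl; exact hJ _ hw2 hhJ'
    have e3 : w ≠ z := by rintro rfl; exact hw3 hzV
    rcases (memH w).1 hw1 with h | h
    · exact Or.inl ⟨h, by simp [e1, e3]⟩
    · exact Or.inr ⟨h, by simp [e2, e3]⟩
  have ta : Ha \ {h, z} ⊆ (H ∩ Q.dom) \ V := fun w hw => by
    have : w ∈ Q.dom \ V := kun ▸ Or.inl (a1 hw)
    exact ⟨⟨(memH w).2 (Or.inl hw.1), this.1⟩, this.2⟩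
  have tb : Hb \ {z, h'} ⊆ (H ∩ Q.dom) \ V := fun w hw => by
    have : w ∈ Q.dom \ V := kun ▸ Or.inr (b2 hw)
    exact ⟨⟨(memH w).2 (Or.inr hw.1), this.1⟩, this.2⟩
  have nsep : ∀ u ∈ U₁, ∀ v ∈ U₂, ¬ Joined (Q.dom \ V) u v := by
    rintro u hu v hv ⟨C, c1, c2, c3, c4⟩
    rcases IsPreconnected.subset_or_subset ko1 ko2 k12 (kun ▸ c2) c1 with h | h
    · exact Set.disjoint_left.1 k12 (h c4) hv
    · exact Set.disjoint_left.1 k12 hu (h c3)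
  intro u hu v hv huv
  rcases half u hu with h1 | h1 <;> rcases half v hv with h2 | h2
  · exact ha.2.isPreconnected_diff.joined ta h1 h2
  · exact (nsep u (a1 h1) v (b2 h2) huv).elim
  · exact (nsep v (a1 h2) u (b2 h1) huv.symm).elim
  · exact hb.2.isPreconnected_diff.joined tb h1 h2

theorem Quad.web (hE : Axioms E) (Q : Quad E) {𝒱 ℋ : Set (Set X)} (h1 : 𝒱.Finite)
    (h2 : ℋ.Finite) (hV : ∀ V ∈ 𝒱, Q.Crossing V) (hH : ∀ H ∈ ℋ, Q.transpose.Crossing H)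
    (dV : ∀ V ∈ 𝒱, ∀ V' ∈ 𝒱, V ≠ V' → Disjoint V V')
    (dH : ∀ H ∈ ℋ, ∀ H' ∈ ℋ, H ≠ H' → Disjoint H H')
    (hm : ∀ V ∈ 𝒱, ∀ H ∈ ℋ, ∃ z, V ∩ H = {z}) : Web E Q.curve Q.dom (𝒱 ∪ ℋ) := by
  refine ⟨h1.union h2, ?_, ?_⟩
  · rintro A (hA | hA)
    · exact (hV A hA).crosscut
    · exact (hH A hA).crosscut_transpose
  · rintro A (hA | hA) B (hB | hB) hAB
    · exact nice_of_disjoint Q.dom_curve (hV B hB).crosscut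
        fun z _ h => Set.disjoint_left.1 (dV A hA B hB hAB) h
    · obtain ⟨z, hz⟩ := hm A hA B hB
      exact Q.nice_of_crossing hE (hV A hA) (hH B hB) hz
    · obtain ⟨z, hz⟩ := hm B hB A hA
      exact Q.transpose.nice_of_crossing hE (hH A hA) (hV B hB) (by rw [inter_comm, hz])
    · exact nice_of_disjoint Q.dom_curve (hH B hB).crosscut_transpose
        fun z _ h => Set.disjoint_left.1 (dH A hA B hB hAB) h

/-- This is the bridge to the axioms. Only inclusions of sides are recorded, which is enough to turn
the grid lines given by the covering axiom into crossings of `Q`. The vertices `a` and `c` sit at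
angles 0 and π. -/
theorem Quad.exists_quadrilateral (hE : Axioms E) (Q : Quad E) : ∃ R : Quadrilateral X,
    R.IsElementary E ∧ R.interior = Q.dom ∧ R.sideAB ⊆ Q.bot ∧ R.sideBC ⊆ Q.right ∧
    R.sideCD ⊆ Q.top ∧ R.sideDA ⊆ Q.left := by
  have e1 := Q.arc_bot.concat hE.family Q.arc_right Q.bot_right
  have e2 := Q.arc_left.concat hE.family Q.arc_top (by rw [inter_comm, Q.top_left])
  have mbr : ∀ z, z ∈ Q.bot → z ∈ Q.right → z = Q.b := fun z h h' => Q.bot_right.subset ⟨h, h'⟩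
  have mrt : ∀ z, z ∈ Q.right → z ∈ Q.top → z = Q.c := fun z h h' => Q.right_top.subset ⟨h, h'⟩
  have mtl : ∀ z, z ∈ Q.top → z ∈ Q.left → z = Q.d := fun z h h' => Q.top_left.subset ⟨h, h'⟩
  have mlb : ∀ z, z ∈ Q.left → z ∈ Q.bot → z = Q.a := fun z h h' => Q.left_bot.subset ⟨h, h'⟩
  have mbt : ∀ z, z ∈ Q.bot → z ∈ Q.top → False := fun z h h' => Set.disjoint_left.1 Q.bot_top h h'
  have mlr : ∀ z, z ∈ Q.left → z ∈ Q.right → False :=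
    fun z h h' => Set.disjoint_left.1 Q.left_right h h'
  have hl : Loop E Q.a Q.c (Q.bot ∪ Q.right) (Q.left ∪ Q.top) := by
    refine ⟨e1, e2, ?_⟩
    have := Q.arc_bot.2.left_mem
    have := Q.arc_left.2.left_mem
    have := Q.arc_right.2.right_mem
    have := Q.arc_top.2.right_mem
    ext z
    simp only [mem_inter_iff, mem_union, mem_insert_iff, mem_singleton_iff]
    grind
  obtain ⟨γ, hγ, hr, g0, gpi, gA, gB⟩ := hl.exists_path
  have pi_pos := Real.pi_pos
  have g2pi : γ (Circle.exp (2 * Real.pi)) = Q.a := by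
    rw [Circle.exp_two_pi, ← Circle.exp_zero, g0]
  obtain ⟨tb, htb, hb⟩ := gA.superset (Or.inl Q.arc_bot.2.right_mem)
  obtain ⟨td, htd, hd⟩ := gB.superset (Or.inl Q.arc_left.2.right_mem)
  have tb0 : 0 < tb := lt_of_le_of_ne htb.1 (by
    rintro rfl; exact Q.arc_bot.2.ne (g0.symm.trans hb))
  have tb1 : tb < Real.pi := lt_of_le_of_ne htb.2 (by
    rintro rfl; exact Q.arc_right.2.ne (hb.symm.trans gpi))
  have td0 : Real.pi < td := lt_of_le_of_ne htd.1 (by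
    rintro rfl; exact Q.arc_top.2.ne (hd.symm.trans gpi))
  have td1 : td < 2 * Real.pi := lt_of_le_of_ne htd.2 (by
    rintro rfl; exact Q.arc_left.2.ne (g2pi.symm.trans hd))
  have hcont : Continuous fun t : ℝ => γ (Circle.exp t) :=
    hγ.continuous.comp Circle.exp.continuous
  have hcurve : range γ = Q.curve := by
    rw [hr]
    ext z
    simp only [Quad.curve, mem_union]
    tauto
  -- An arc covered by two closed sides that meet only at one of its ends stays connected without
  -- that end, and so lies in a single side.
  have side : ∀ (A B : Set X) (k s t : ℝ), IsClosed A → IsClosed B → s < t →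
      t < s + 2 * Real.pi →
      (arcImage γ s t ⊆ A ∪ B) → (k = s ∨ k = t) → (∀ z ∈ A, z ∈ B → z = γ (Circle.exp k)) →
      γ (Circle.exp s) ∈ A → γ (Circle.exp t) ∈ A → arcImage γ s t ⊆ A := by
    intro A B k s t hA hB hst hts hsub hk hAB hs ht
    have harc := isArc_arcImage hγ hst hts
    set b := γ (Circle.exp k) with hb
    have hbm : b = γ (Circle.exp s) ∨ b = γ (Circle.exp t) := by
      rcases hk with h | h <;> simp [hb, h]
    have hbA : b ∈ A := by
      rcases hbm with h | h <;> rw [h] <;> assumption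
    have hpre : IsPreconnected (arcImage γ s t \ {b}) := by
      rcases hbm with h | h <;> rw [h]
      exacts [harc.isPreconnected_diff_left, harc.isPreconnected_diff_right]
    obtain ⟨w, hw, hwA⟩ : ∃ w ∈ arcImage γ s t \ {b}, w ∈ A := by
      by_cases h : b = γ (Circle.exp s)
      · exact ⟨_, ⟨harc.right_mem, fun h' => harc.ne (h'.trans h).symm⟩, ht⟩
      · exact ⟨_, ⟨harc.left_mem, fun h' => h h'.symm⟩, hs⟩
    have key := hpre.subset_left_of_inter hA hB (sdiff_subset.trans hsub)
      (fun z h1 h2 h3 => h3.2 (hAB z h1 h2)) hw hwA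
    intro z hz
    by_cases hzb : z = b
    · exact hzb ▸ hbA
    · exact key ⟨hz, hzb⟩
  have sub0 : arcImage γ 0 tb ⊆ Q.bot ∪ Q.right := gA ▸ image_mono (Icc_subset_Icc_right htb.2)
  have sub1 : arcImage γ tb Real.pi ⊆ Q.bot ∪ Q.right :=
    gA ▸ image_mono (Icc_subset_Icc_left htb.1)
  have sub2 : arcImage γ Real.pi td ⊆ Q.left ∪ Q.top :=
    gB ▸ image_mono (Icc_subset_Icc_right htd.2)
  have sub3 : arcImage γ td (2 * Real.pi) ⊆ Q.left ∪ Q.top :=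
    gB ▸ image_mono (Icc_subset_Icc_left htd.1)
  have hb' : γ (Circle.exp tb) = Q.b := hb
  have hd' : γ (Circle.exp td) = Q.d := hd
  refine ⟨⟨γ, hγ, 0, tb, Real.pi, td, tb0, tb1, td0, by linarith, Q.dom, ?_⟩, ?_, rfl, ?_, ?_,
    ?_, ?_⟩
  · rw [hcurve]; exact Q.dom_curve.2
  · change IsElementaryClosedCurve E (range γ)
    rw [hcurve]; exact Q.dom_curve.1
  · refine side _ _ tb _ _ Q.arc_bot.2.isClosed Q.arc_right.2.isClosed tb0 (by linarith) sub0
      (Or.inr rfl) (fun z h h' => (mbr z h h').trans hb'.symm) ?_ ?_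
    · rw [g0]; exact Q.arc_bot.2.left_mem
    · rw [hb']; exact Q.arc_bot.2.right_mem
  · refine side _ _ tb _ _ Q.arc_right.2.isClosed Q.arc_bot.2.isClosed tb1 (by linarith)
      (by rwa [union_comm]) (Or.inl rfl) (fun z h h' => (mbr z h' h).trans hb'.symm) ?_ ?_
    · rw [hb']; exact Q.arc_right.2.left_mem
    · rw [gpi]; exact Q.arc_right.2.right_mem
  · refine side _ _ td _ _ Q.arc_top.2.isClosed Q.arc_left.2.isClosed td0 (by linarith)
      (by rwa [union_comm]) (Or.inr rfl) (fun z h h' => (mtl z h h').trans hd'.symm) ?_ ?_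
    · rw [gpi]; exact Q.arc_top.2.right_mem
    · rw [hd']; exact Q.arc_top.2.left_mem
  · change arcImage γ td (0 + 2 * Real.pi) ⊆ _
    rw [zero_add]
    refine side _ _ td _ _ Q.arc_left.2.isClosed Q.arc_top.2.isClosed td1 (by linarith) sub3
      (Or.inl rfl) (fun z h h' => (mtl z h' h).trans hd'.symm) ?_ ?_
    · rw [hd']; exact Q.arc_left.2.right_mem
    · rw [g2pi]; exact Q.arc_left.2.left_mem

end Pieces


/-! ### Cutting a quadrilateral along a vertical line -/

namespace Quad

section Cut

variable {X : Type*} [TopologicalSpace X] [T2Space X] {E : Set (Set X)} {Q Q₁ Q₂ : Quad E}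
  {p q x y z : X} {A B V W H H₁ H₂ : Set X}

/-- `V` is an elementary curve through `Q` that joins inner points of the bottom and of the top
side. -/
def Vert (Q : Quad E) (V : Set X) : Prop :=
  ∃ x y, x ∈ Q.bot ∧ x ≠ Q.a ∧ x ≠ Q.b ∧ y ∈ Q.top ∧ y ≠ Q.c ∧ y ≠ Q.d ∧ EArc E x y V ∧
    V \ {x, y} ⊆ Q.dom

/-- `H` is an elementary curve through `Q` that joins inner points of the left and of the right
side. -/
def Horiz (Q : Quad E) (H : Set X) : Prop :=
  ∃ x y, x ∈ Q.left ∧ x ≠ Q.a ∧ x ≠ Q.d ∧ y ∈ Q.right ∧ y ≠ Q.c ∧ y ≠ Q.b ∧ EArc E x y H ∧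
    H \ {x, y} ⊆ Q.dom

theorem Vert.mirror (h : Q.Vert V) : Q.mirror.Vert V := by
  obtain ⟨x, y, h1, h2, h3, h4, h5, h6, h7, h8⟩ := h
  exact ⟨x, y, h1, h3, h2, h4, h6, h5, h7, h8⟩

theorem Horiz.mirror (h : Q.Horiz V) : Q.mirror.Horiz V := by
  obtain ⟨x, y, h1, h2, h3, h4, h5, h6, h7, h8⟩ := h
  exact ⟨y, x, h4, h6, h5, h1, h3, h2, h7.symm, by rwa [pair_comm]⟩

theorem Vert.crossing (h : Q.Vert V) : Q.Crossing V := by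
  obtain ⟨x, y, h1, h2, h3, h4, h5, h6, h7, h8⟩ := h
  exact ⟨x, h1, y, h4, h7, h8⟩

theorem Horiz.crossing (h : Q.Horiz V) : Q.transpose.Crossing V :=
  Vert.crossing (Q := Q.transpose) h

theorem bot_subset_curve : Q.bot ⊆ Q.curve := fun _ h => Or.inl (Or.inl (Or.inl h))

theorem right_subset_curve : Q.right ⊆ Q.curve := fun _ h => Or.inl (Or.inl (Or.inr h))

theorem top_subset_curve : Q.top ⊆ Q.curve := fun _ h => Or.inl (Or.inr h)

theorem left_subset_curve : Q.left ⊆ Q.curve := fun _ h => Or.inr h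

theorem dom_subset_cl : Q.dom ⊆ Q.cl := subset_union_left

theorem curve_subset_cl : Q.curve ⊆ Q.cl := subset_union_right

theorem cl_transpose : Q.transpose.cl = Q.cl := by
  simp only [cl, curve_transpose]; rfl

theorem curve_mirror : Q.mirror.curve = Q.curve := by
  ext z
  simp only [curve, Quad.mirror, mem_union]
  tauto

theorem cl_mirror : Q.mirror.cl = Q.cl := by
  simp only [cl, curve_mirror]; rfl

theorem a_mem_bot : Q.a ∈ Q.bot := Q.arc_bot.2.left_mem
theorem b_mem_bot : Q.b ∈ Q.bot := Q.arc_bot.2.right_mem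
theorem b_mem_right : Q.b ∈ Q.right := Q.arc_right.2.left_mem
theorem c_mem_right : Q.c ∈ Q.right := Q.arc_right.2.right_mem
theorem d_mem_top : Q.d ∈ Q.top := Q.arc_top.2.left_mem
theorem c_mem_top : Q.c ∈ Q.top := Q.arc_top.2.right_mem
theorem a_mem_left : Q.a ∈ Q.left := Q.arc_left.2.left_mem
theorem d_mem_left : Q.d ∈ Q.left := Q.arc_left.2.right_mem

/-- The points of a vertical line. -/
theorem Vert.mem_cases (h : Q.Vert V) (hz : z ∈ V) : z ∈ Q.dom ∨
    (z ∈ Q.bot ∧ z ≠ Q.a ∧ z ≠ Q.b) ∨ (z ∈ Q.top ∧ z ≠ Q.c ∧ z ≠ Q.d) := by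
  obtain ⟨x, y, h1, h2, h3, h4, h5, h6, h7, h8⟩ := h
  by_cases hx : z = x
  · exact Or.inr (Or.inl (hx ▸ ⟨h1, h2, h3⟩))
  by_cases hy : z = y
  · exact Or.inr (Or.inr (hy ▸ ⟨h4, h5, h6⟩))
  · exact Or.inl (h8 ⟨hz, by simp [hx, hy]⟩)

theorem Vert.notMem_left (h : Q.Vert V) (hz : z ∈ V) : z ∉ Q.left := by
  intro hl
  rcases h.mem_cases hz with h1 | ⟨h1, h2, h3⟩ | ⟨h1, h2, h3⟩
  · exact Q.dom_curve.notMem h1 (left_subset_curve hl)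
  · exact h2 (Q.left_bot.subset ⟨hl, h1⟩)
  · exact h3 (Q.top_left.subset ⟨h1, hl⟩)

theorem Vert.notMem_right (h : Q.Vert V) (hz : z ∈ V) : z ∉ Q.right := h.mirror.notMem_left hz

theorem Horiz.notMem_bot (h : Q.Horiz H) (hz : z ∈ H) : z ∉ Q.bot :=
  Vert.notMem_left (Q := Q.transpose) h hz

theorem Horiz.notMem_top (h : Q.Horiz H) (hz : z ∈ H) : z ∉ Q.top :=
  Vert.notMem_right (Q := Q.transpose) h hz

theorem Vert.subset_cl (h : Q.Vert V) : V ⊆ Q.cl := by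
  intro z hz
  rcases h.mem_cases hz with h1 | ⟨h1, h2, h3⟩ | ⟨h1, h2, h3⟩
  exacts [Or.inl h1, Or.inr (bot_subset_curve h1), Or.inr (top_subset_curve h1)]

theorem Horiz.subset_cl (h : Q.Horiz V) : V ⊆ Q.cl :=
  cl_transpose (Q := Q) ▸ Vert.subset_cl (Q := Q.transpose) h

/-- `V` cuts `Q` into the quadrilaterals `Q₁` on the left and `Q₂` on the right. -/
structure IsCut (Q : Quad E) (V : Set X) (Q₁ Q₂ : Quad E) : Prop where
  vert : Q.Vert V
  left_left : Q₁.left = Q.left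
  left_right : Q₁.right = V
  right_left : Q₂.left = V
  right_right : Q₂.right = Q.right
  bot : Q₁.bot ∪ Q₂.bot = Q.bot
  top : Q₁.top ∪ Q₂.top = Q.top
  bot_inter : Q₁.bot ∩ Q₂.bot = {Q₁.b}
  top_inter : Q₁.top ∩ Q₂.top = {Q₁.c}
  left_a : Q₁.a = Q.a
  left_d : Q₁.d = Q.d
  right_b : Q₂.b = Q.b
  right_c : Q₂.c = Q.c
  b_eq : Q₁.b = Q₂.a
  c_eq : Q₁.c = Q₂.d
  disjoint : Disjoint Q₁.dom Q₂.dom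
  dom : Q.dom \ V = Q₁.dom ∪ Q₂.dom

theorem IsCut.mirror (h : IsCut Q V Q₁ Q₂) : IsCut Q.mirror V Q₂.mirror Q₁.mirror where
  vert := h.vert.mirror
  left_left := h.right_right
  left_right := h.right_left
  right_left := h.left_right
  right_right := h.left_left
  bot := (union_comm _ _).trans h.bot
  top := (union_comm _ _).trans h.top
  bot_inter := by
    have := h.bot_inter
    rw [inter_comm, h.b_eq] at this
    exact this
  top_inter := by
    have := h.top_inter
    rw [inter_comm, h.c_eq] at this
    exact this
  left_a := h.right_b
  left_d := h.right_c
  right_b := h.left_a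
  right_c := h.left_d
  b_eq := h.b_eq.symm
  c_eq := h.c_eq.symm
  disjoint := h.disjoint.symm
  dom := h.dom.trans (union_comm _ _)

/-- The ends of `V` divide the boundary into an arc through the left side and an arc through the
right side; `theta` then provides the two domains. -/
theorem Vert.exists_isCut (hE : Axioms E) (h : Q.Vert V) : ∃ Q₁ Q₂, IsCut Q V Q₁ Q₂ := by
  obtain ⟨x, y, h1, h2, h3, h4, h5, h6, h7, h8⟩ := id h
  obtain ⟨A₁, A₂, a1, a2, aun, ain⟩ := Q.arc_bot.split hE.family h1 h2 h3
  obtain ⟨D₁, D₂, d1, d2, dun, din⟩ := Q.arc_top.split hE.family h4 h6 h5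
  have sA1 : A₁ ⊆ Q.bot := aun ▸ subset_union_left
  have sA2 : A₂ ⊆ Q.bot := aun ▸ subset_union_right
  have sD1 : D₁ ⊆ Q.top := dun ▸ subset_union_left
  have sD2 : D₂ ⊆ Q.top := dun ▸ subset_union_right
  have bt : ∀ z ∈ Q.bot, z ∉ Q.top := fun z h h' => Set.disjoint_left.1 Q.bot_top h h'
  have lr : ∀ z ∈ Q.left, z ∉ Q.right := fun z h h' => Set.disjoint_left.1 Q.left_right h h'
  have lb : ∀ z ∈ Q.left, z ∈ Q.bot → z = Q.a := fun z h h' => Q.left_bot.subset ⟨h, h'⟩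
  have br : ∀ z ∈ Q.bot, z ∈ Q.right → z = Q.b := fun z h h' => Q.bot_right.subset ⟨h, h'⟩
  have rt : ∀ z ∈ Q.right, z ∈ Q.top → z = Q.c := fun z h h' => Q.right_top.subset ⟨h, h'⟩
  have tl : ∀ z ∈ Q.top, z ∈ Q.left → z = Q.d := fun z h h' => Q.top_left.subset ⟨h, h'⟩
  have iA : ∀ z ∈ A₁, z ∈ A₂ → z = x := fun z h h' => ain.subset ⟨h, h'⟩
  have iD : ∀ z ∈ D₁, z ∈ D₂ → z = y := fun z h h' => din.subset ⟨h, h'⟩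
  have aA2 : Q.a ∉ A₂ := fun h => h2 (iA _ a1.2.left_mem h).symm
  have bA1 : Q.b ∉ A₁ := fun h => h3 (iA _ h a2.2.right_mem).symm
  have dD2 : Q.d ∉ D₂ := fun h => h6 (iD _ d1.2.left_mem h).symm
  have cD1 : Q.c ∉ D₁ := fun h => h5 (iD _ h d2.2.right_mem).symm
  have sing : ∀ {S T : Set X} {w : X}, w ∈ S → w ∈ T → (∀ z ∈ S, z ∈ T → z = w) →
      S ∩ T = {w} := by
    intro S T w h1 h2 h3
    exact Subset.antisymm (fun z hz => h3 z hz.1 hz.2) (singleton_subset_iff.2 ⟨h1, h2⟩)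
  have e1 : A₁ ∩ Q.left = {Q.a} := sing a1.2.left_mem a_mem_left fun z h h' => lb z h' (sA1 h)
  have e2 : (A₁ ∪ Q.left) ∩ D₁ = {Q.d} := sing (Or.inr d_mem_left) d1.2.left_mem
    fun z h h' => h.elim (fun h => absurd (sD1 h') (bt z (sA1 h))) fun h => tl z (sD1 h') h
  have e3 : A₂ ∩ Q.right = {Q.b} := sing a2.2.right_mem b_mem_right fun z h h' => br z (sA2 h) h'
  have e4 : (A₂ ∪ Q.right) ∩ D₂ = {Q.c} := sing (Or.inr c_mem_right) d2.2.right_mem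
    fun z h h' => h.elim (fun h => absurd (sD2 h') (bt z (sA2 h))) fun h => rt z h (sD2 h')
  have hl : Loop E x y (A₁ ∪ Q.left ∪ D₁) (A₂ ∪ Q.right ∪ D₂) := by
    refine ⟨(a1.symm.concat hE.family Q.arc_left e1).concat hE.family d1 e2,
      (a2.concat hE.family Q.arc_right e3).concat hE.family d2.symm e4, ?_⟩
    apply Subset.antisymm
    · rintro z ⟨(h | h) | h, (h' | h') | h'⟩
      · exact Or.inl (iA z h h')
      · exact absurd (br z (sA1 h) h' ▸ h) bA1
      · exact absurd (sD2 h') (bt z (sA1 h))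
      · exact absurd (lb z h (sA2 h') ▸ h') aA2
      · exact absurd h' (lr z h)
      · exact absurd (tl z (sD2 h') h ▸ h') dD2
      · exact absurd (sD1 h) (bt z (sA2 h'))
      · exact absurd (rt z h' (sD1 h) ▸ h) cD1
      · exact Or.inr (iD z h h')
    · rintro z (rfl | rfl)
      · exact ⟨Or.inl (Or.inl a1.2.right_mem), Or.inl (Or.inl a2.2.left_mem)⟩
      · exact ⟨Or.inr d1.2.right_mem, Or.inr d2.2.left_mem⟩
  have hcurve : (A₁ ∪ Q.left ∪ D₁) ∪ (A₂ ∪ Q.right ∪ D₂) = Q.curve := by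
    rw [curve, ← aun, ← dun]
    ext z
    simp only [mem_union]
    tauto
  obtain ⟨U₁, U₂, k1, k2, k12, kun⟩ := theta hE hl (hcurve ▸ Q.dom_curve) h7 h8
  have vl : ∀ z ∈ V, z ∉ Q.left := fun z => h.notMem_left
  have vr : ∀ z ∈ V, z ∉ Q.right := fun z => h.notMem_right
  have ends : ∀ z ∈ V, z ∈ Q.curve → z = x ∨ z = y := by
    intro z hz hzc
    by_contra hc
    exact Q.dom_curve.notMem (h8 ⟨hz, hc⟩) hzc
  have vA : ∀ z ∈ V, z ∈ Q.bot → z = x := fun z hz hb =>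
    (ends z hz (bot_subset_curve hb)).resolve_right fun h => bt z hb (h ▸ h4)
  have vD : ∀ z ∈ V, z ∈ Q.top → z = y := fun z hz hb =>
    (ends z hz (top_subset_curve hb)).resolve_left fun h => bt z (h ▸ h1) hb
  refine ⟨⟨Q.a, x, y, Q.d, A₁, V, D₁, Q.left, U₁, a1, h7, d1, Q.arc_left,
      ?_, ?_, ?_, ?_, ?_, ?_, ?_⟩,
    ⟨x, Q.b, Q.c, y, A₂, Q.right, D₂, V, U₂, a2, Q.arc_right, d2, h7, ?_, ?_, ?_, ?_, ?_, ?_, ?_⟩,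
    h, rfl, rfl, rfl, rfl, aun, dun, ain, din, rfl, rfl, rfl, rfl, rfl, rfl, k12, kun⟩
  · exact sing a1.2.right_mem h7.2.left_mem fun z h h' => vA z h' (sA1 h)
  · exact sing h7.2.right_mem d1.2.right_mem fun z h h' => vD z h (sD1 h')
  · exact sing d1.2.left_mem d_mem_left fun z h h' => tl z (sD1 h) h'
  · exact sing a_mem_left a1.2.left_mem fun z h h' => lb z h (sA1 h')
  · exact Q.bot_top.mono sA1 sD1
  · exact Set.disjoint_left.2 fun z hz hz' => vl z hz' hz
  · rwa [show A₁ ∪ V ∪ D₁ ∪ Q.left = A₁ ∪ Q.left ∪ D₁ ∪ V by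
      ext z; simp only [mem_union]; tauto]
  · exact e3
  · exact sing c_mem_right d2.2.right_mem fun z h h' => rt z h (sD2 h')
  · exact sing d2.2.left_mem h7.2.right_mem fun z h h' => vD z h' (sD2 h)
  · exact sing h7.2.left_mem a2.2.left_mem fun z h h' => vA z h (sA2 h')
  · exact Q.bot_top.mono sA2 sD2
  · exact Set.disjoint_left.2 fun z hz hz' => vr z hz hz'
  · exact k2

theorem IsCut.dom_left (h : IsCut Q V Q₁ Q₂) : Q₁.dom ⊆ Q.dom :=
  fun _ hz => (h.dom.superset (Or.inl hz)).1

theorem IsCut.dom_right (h : IsCut Q V Q₁ Q₂) : Q₂.dom ⊆ Q.dom := h.mirror.dom_left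

theorem IsCut.curve_inter (h : IsCut Q V Q₁ Q₂) (hz₁ : z ∈ Q₁.curve) (hz₂ : z ∈ Q₂.curve) :
    z ∈ V := by
  have bt : ∀ z ∈ Q.bot, z ∉ Q.top := fun z h h' => Set.disjoint_left.1 Q.bot_top h h'
  have lr : ∀ z ∈ Q.left, z ∉ Q.right := fun z h h' => Set.disjoint_left.1 Q.left_right h h'
  have bV : Q₁.b ∈ V := h.left_right ▸ b_mem_right
  have cV : Q₁.c ∈ V := h.left_right ▸ c_mem_right
  have bb : ∀ z ∈ Q₁.bot, z ∈ Q₂.bot → z ∈ V := fun z h1 h2 => by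
    have : z = Q₁.b := h.bot_inter.subset ⟨h1, h2⟩
    exact this ▸ bV
  have tt : ∀ z ∈ Q₁.top, z ∈ Q₂.top → z ∈ V := fun z h1 h2 => by
    have : z = Q₁.c := h.top_inter.subset ⟨h1, h2⟩
    exact this ▸ cV
  have b1 : Q₁.bot ⊆ Q.bot := h.bot ▸ subset_union_left
  have b2 : Q₂.bot ⊆ Q.bot := h.bot ▸ subset_union_right
  have t1 : Q₁.top ⊆ Q.top := h.top ▸ subset_union_left
  have t2 : Q₂.top ⊆ Q.top := h.top ▸ subset_union_right
  rw [curve, h.left_left, h.left_right] at hz₁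
  rw [curve, h.right_left, h.right_right] at hz₂
  rcases hz₁ with ((h1 | h1) | h1) | h1
  · rcases hz₂ with ((h2 | h2) | h2) | h2
    · exact bb z h1 h2
    · have : z = Q.b := Q.bot_right.subset ⟨b1 h1, h2⟩
      exact bb z h1 (by rw [this, ← h.right_b]; exact b_mem_bot)
    · exact absurd (t2 h2) (bt z (b1 h1))
    · exact h2
  · exact h1
  · rcases hz₂ with ((h2 | h2) | h2) | h2
    · exact absurd (t1 h1) (bt z (b2 h2))
    · have : z = Q.c := Q.right_top.subset ⟨h2, t1 h1⟩
      exact tt z h1 (by rw [this, ← h.right_c]; exact c_mem_top)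
    · exact tt z h1 h2
    · exact h2
  · rcases hz₂ with ((h2 | h2) | h2) | h2
    · have : z = Q.a := Q.left_bot.subset ⟨h1, b2 h2⟩
      exact bb z (by rw [this, ← h.left_a]; exact a_mem_bot) h2
    · exact absurd h2 (lr z h1)
    · have : z = Q.d := Q.top_left.subset ⟨t2 h2, h1⟩
      exact tt z (by rw [this, ← h.left_d]; exact d_mem_top) h2
    · exact h2

theorem IsCut.dom_notMem_cl (h : IsCut Q V Q₁ Q₂) (hE : Axioms E) (hz : z ∈ Q₁.dom) :
    z ∉ Q₂.cl := by
  rw [cl_eq hE]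
  exact (Q₁.dom_curve.isOpen hE).notMem_closure_of_disjoint h.disjoint hz

/-- An interior point of one half has a neighbourhood disjoint from the other half, so common points
lie on both boundary curves. -/
theorem IsCut.cl_inter (h : IsCut Q V Q₁ Q₂) (hE : Axioms E) (hz₁ : z ∈ Q₁.cl)
    (hz₂ : z ∈ Q₂.cl) : z ∈ V := by
  rcases id hz₁ with h1 | h1
  · exact absurd hz₂ (h.dom_notMem_cl hE h1)
  rcases id hz₂ with h2 | h2
  · exact absurd (cl_mirror (Q := Q₁) ▸ hz₁) (h.mirror.dom_notMem_cl hE h2)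
  · exact h.curve_inter h1 h2

theorem IsCut.subset_left (h : IsCut Q V Q₁ Q₂) : V ⊆ Q₁.cl :=
  h.left_right ▸ right_subset_curve.trans curve_subset_cl

theorem IsCut.subset_right (h : IsCut Q V Q₁ Q₂) : V ⊆ Q₂.cl :=
  h.right_left ▸ left_subset_curve.trans curve_subset_cl

theorem IsCut.cl (h : IsCut Q V Q₁ Q₂) : Q.cl = Q₁.cl ∪ Q₂.cl := by
  have hV := h.vert.subset_cl
  have hd : ∀ z, z ∈ Q.dom → z ∉ V → z ∈ Q₁.dom ∨ z ∈ Q₂.dom :=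
    fun z h1 h2 => h.dom.subset ⟨h1, h2⟩
  apply Subset.antisymm
  · intro z hz
    by_cases hzV : z ∈ V
    · exact Or.inl (h.subset_left hzV)
    rcases hz with hz | ((hz | hz) | hz) | hz
    · exact (hd z hz hzV).imp Or.inl Or.inl
    · exact (h.bot.superset hz).imp (fun h => Or.inr (bot_subset_curve h))
        (fun h => Or.inr (bot_subset_curve h))
    · exact Or.inr (Or.inr (right_subset_curve (h.right_right ▸ hz)))
    · exact (h.top.superset hz).imp (fun h => Or.inr (top_subset_curve h))
        (fun h => Or.inr (top_subset_curve h))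
    · exact Or.inl (Or.inr (left_subset_curve (h.left_left ▸ hz)))
  · have key : ∀ {Q Q₁ Q₂ : Quad E} {V : Set X}, IsCut Q V Q₁ Q₂ → Q₁.cl ⊆ Q.cl := by
      intro Q Q₁ Q₂ V h
      rintro z (hz | ((hz | hz) | hz) | hz)
      · exact Or.inl (h.dom_left hz)
      · exact Or.inr (bot_subset_curve (h.bot ▸ Or.inl hz))
      · exact h.vert.subset_cl (h.left_right ▸ hz)
      · exact Or.inr (top_subset_curve (h.top ▸ Or.inl hz))
      · exact Or.inr (left_subset_curve (h.left_left ▸ hz))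
    refine union_subset (key h) ?_
    have := key h.mirror
    rwa [cl_mirror, cl_mirror] at this

theorem IsCut.vert_of_left (h : IsCut Q V Q₁ Q₂) (hW : Q₁.Vert W) : Q.Vert W ∧ Disjoint V W := by
  have hdis : Disjoint V W :=
    Set.disjoint_left.2 fun z hz hz' => hW.notMem_right hz' (h.left_right ▸ hz)
  refine ⟨?_, hdis⟩
  obtain ⟨x, y, h1, h2, h3, h4, h5, h6, h7, h8⟩ := hW
  refine ⟨x, y, h.bot ▸ Or.inl h1, h.left_a ▸ h2, ?_, h.top ▸ Or.inl h4, ?_, h.left_d ▸ h6, h7,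
    h8.trans h.dom_left⟩
  · rintro rfl
    exact h3 (h.bot_inter.subset ⟨h1, h.right_b ▸ b_mem_bot⟩)
  · rintro rfl
    exact h5 (h.top_inter.subset ⟨h4, h.right_c ▸ c_mem_top⟩)

theorem IsCut.vert_of_subset (h : IsCut Q V Q₁ Q₂) (hE : Axioms E) (hW : Q.Vert W)
    (hVW : Disjoint V W) (hsub : W ⊆ Q₁.cl) : Q₁.Vert W := by
  have hd : ∀ z ∈ W, z ∉ V := fun z h1 h2 => Set.disjoint_left.1 hVW h2 h1
  have out : ∀ z ∈ W, z ∉ Q₂.cl := fun z hz h2 => hd z hz (h.cl_inter hE (hsub hz) h2)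
  obtain ⟨x, y, h1, h2, h3, h4, h5, h6, h7, h8⟩ := hW
  refine ⟨x, y, ?_, h.left_a ▸ h2, ?_, ?_, ?_, h.left_d ▸ h6, h7, ?_⟩
  · exact (h.bot.superset h1).resolve_right fun h' =>
      out x h7.2.left_mem (curve_subset_cl (bot_subset_curve h'))
  · rintro rfl
    exact hd _ h7.2.left_mem (h.left_right ▸ b_mem_right)
  · exact (h.top.superset h4).resolve_right fun h' =>
      out y h7.2.right_mem (curve_subset_cl (top_subset_curve h'))
  · rintro rfl
    exact hd _ h7.2.right_mem (h.left_right ▸ c_mem_right)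
  · intro z hz
    exact (h.dom.subset ⟨h8 hz, hd z hz.1⟩).resolve_right fun h' => out z hz.1 (Or.inl h')

theorem IsCut.vert_cases (h : IsCut Q V Q₁ Q₂) (hE : Axioms E) (hW : Q.Vert W)
    (hVW : Disjoint V W) :
    Q₁.Vert W ∨ Q₂.Vert W := by
  obtain ⟨x, y, h1, h2, h3, h4, h5, h6, h7, h8⟩ := id hW
  have hs : W \ {x, y} ⊆ Q₁.dom ∪ Q₂.dom := fun z hz =>
    h.dom.subset ⟨h8 hz, fun h2 => Set.disjoint_left.1 hVW h2 hz.1⟩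
  rcases IsPreconnected.subset_or_subset (Q₁.dom_curve.isOpen hE) (Q₂.dom_curve.isOpen hE)
    h.disjoint hs h7.2.isPreconnected_diff with h' | h'
  · refine Or.inl (h.vert_of_subset hE hW hVW ?_)
    rw [cl_eq hE]
    exact h7.2.subset_closure.trans (closure_mono h')
  · refine Or.inr (h.mirror.vert_of_subset hE hW.mirror hVW ?_).mirror
    rw [cl_mirror, cl_eq hE]
    exact h7.2.subset_closure.trans (closure_mono h')

/-- The part of an arc that starts on the left side and ends on the cut. -/
theorem IsCut.horiz_left (h : IsCut Q V Q₁ Q₂) (hE : Axioms E) (hx : x ∈ Q.left)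
    (hxa : x ≠ Q.a) (hxd : x ≠ Q.d)
    (hz : z ∈ V) (hzc : z ∉ Q.curve) (hA : EArc E x z A) (hAint : A \ {x, z} ⊆ Q.dom \ V) :
    Q₁.Horiz A := by
  have hxV : x ∉ V := fun h' => h.vert.notMem_left h' hx
  have hs := hAint.trans h.dom.subset
  have hx1 : x ∈ Q₁.cl := curve_subset_cl (left_subset_curve (h.left_left ▸ hx))
  refine ⟨x, z, h.left_left ▸ hx, h.left_a ▸ hxa, h.left_d ▸ hxd, h.left_right ▸ hz, ?_, ?_, hA, ?_⟩
  · rintro rfl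
    exact hzc (top_subset_curve (h.top ▸ Or.inl c_mem_top))
  · rintro rfl
    exact hzc (bot_subset_curve (h.bot ▸ Or.inl b_mem_bot))
  · refine (IsPreconnected.subset_or_subset (Q₁.dom_curve.isOpen hE) (Q₂.dom_curve.isOpen hE)
      h.disjoint hs hA.2.isPreconnected_diff).resolve_right fun h' => ?_
    have := closure_mono h' (hA.2.subset_closure hA.2.left_mem)
    rw [← cl_eq hE] at this
    exact hxV (h.cl_inter hE hx1 this)

/-- The crossing point divides `H` into an arc from the left side to `V` and an arc from `V` to the
right side; apart from that point these lie in different halves, hence they are the two traces. -/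
theorem IsCut.horiz_split (h : IsCut Q V Q₁ Q₂) (hE : Axioms E) (hH : Q.Horiz H)
    (hz : V ∩ H = {z}) :
    Q₁.Horiz (H ∩ Q₁.cl) ∧ Q₂.Horiz (H ∩ Q₂.cl) := by
  obtain ⟨x, y, h1, h2, h3, h4, h5, h6, h7, h8⟩ := id hH
  have hzV : z ∈ V := (hz.superset rfl).1
  have hzH : z ∈ H := (hz.superset rfl).2
  have hint : ∀ w ∈ V, w ∈ H → w = z := fun w h1 h2 => hz.subset ⟨h1, h2⟩
  have hzx : z ≠ x := by rintro rfl; exact h.vert.notMem_left hzV h1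
  have hzy : z ≠ y := by rintro rfl; exact h.vert.notMem_right hzV h4
  have hzc : z ∉ Q.curve := Q.dom_curve.notMem (h8 ⟨hzH, by simp [hzx, hzy]⟩)
  obtain ⟨A, B, hA, hB, hun, hin⟩ := h7.split hE.family hzH hzx hzy
  have sA : A ⊆ H := hun ▸ subset_union_left
  have sB : B ⊆ H := hun ▸ subset_union_right
  have yA : y ∉ A := fun h => hzy (hin.subset ⟨h, hB.2.right_mem⟩).symm
  have xB : x ∉ B := fun h => hzx (hin.subset ⟨hA.2.left_mem, h⟩).symm
  have hA1 : Q₁.Horiz A := by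
    refine h.horiz_left hE h1 h2 h3 hzV hzc hA fun w hw => ⟨h8 ⟨sA hw.1, ?_⟩, fun hwV => ?_⟩
    · rintro (rfl | rfl)
      exacts [hw.2 (Or.inl rfl), yA hw.1]
    · exact hw.2 (Or.inr (hint w hwV (sA hw.1)))
  have hB2 : Q₂.Horiz B := by
    refine (h.mirror.horiz_left hE h4 h6 h5 hzV (by rwa [curve_mirror]) hB.symm
      fun w hw => ⟨h8 ⟨sB hw.1, ?_⟩, fun hwV => ?_⟩).mirror
    · rintro (rfl | rfl)
      exacts [xB hw.1, hw.2 (Or.inl rfl)]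
    · exact hw.2 (Or.inr (hint w hwV (sB hw.1)))
  have eA : H ∩ Q₁.cl = A := by
    refine Subset.antisymm ?_ fun w hw => ⟨sA hw, hA1.subset_cl hw⟩
    rintro w ⟨hw, hw1⟩
    rcases hun.superset hw with h' | h'
    · exact h'
    · rw [hint w (h.cl_inter hE hw1 (hB2.subset_cl h')) hw]; exact hA.2.right_mem
  have eB : H ∩ Q₂.cl = B := by
    refine Subset.antisymm ?_ fun w hw => ⟨sB hw, hB2.subset_cl hw⟩
    rintro w ⟨hw, hw1⟩
    rcases hun.superset hw with h' | h'
    · rw [hint w (h.cl_inter hE (hA1.subset_cl h') hw1) hw]; exact hB.2.left_mem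
    · exact h'
  rw [eA, eB]
  exact ⟨hA1, hB2⟩

/-- Each of the two lines meets `V` only at its end on `V`, and a common point of them lies on `V`;
so a nonempty intersection means that these ends coincide. This point is on neither the bottom nor
the top, hence inside `Q`. -/
theorem IsCut.horiz_union (h : IsCut Q V Q₁ Q₂) (hE : Axioms E) (h₁ : Q₁.Horiz H₁)
    (h₂ : Q₂.Horiz H₂) (hne : (H₁ ∩ H₂).Nonempty) : Q.Horiz (H₁ ∪ H₂) ∧ ∃ z ∈ Q.dom, H₁ ∩ V = {z} ∧ H₂ ∩ V = {z} ∧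
      H₁ ∩ H₂ = {z} ∧ (H₁ ∪ H₂) ∩ Q₁.cl = H₁ ∧ (H₁ ∪ H₂) ∩ Q₂.cl = H₂ := by
  have c1 := h₁.subset_cl
  have c2 := h₂.subset_cl
  obtain ⟨x, z, h1, h2, h3, h4, h5, h6, h7, h8⟩ := id h₁
  obtain ⟨z', y, k1, k2, k3, k4, k5, k6, k7, k8⟩ := id h₂
  have x1 : x ∉ V := fun hx => Set.disjoint_left.1 Q₁.left_right h1 (h.left_right ▸ hx)
  have y1 : y ∉ V := fun hx => Set.disjoint_left.1 Q₂.left_right (h.right_left ▸ hx) k4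
  have hV1 : ∀ w ∈ H₁, w ∈ V → w = z := by
    intro w hw hwV
    by_contra hc
    refine Q₁.dom_curve.notMem (h8 ⟨hw, ?_⟩) (right_subset_curve (h.left_right ▸ hwV))
    rintro (rfl | rfl)
    exacts [x1 hwV, hc rfl]
  have hV2 : ∀ w ∈ H₂, w ∈ V → w = z' := by
    intro w hw hwV
    by_contra hc
    refine Q₂.dom_curve.notMem (k8 ⟨hw, ?_⟩) (left_subset_curve (h.right_left ▸ hwV))
    rintro (rfl | rfl)
    exacts [hc rfl, y1 hwV]
  obtain ⟨w, w1, w2⟩ := hne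
  have hw := h.cl_inter hE (c1 w1) (c2 w2)
  obtain rfl : z = z' := (hV1 w w1 hw).symm.trans (hV2 w w2 hw)
  have hzV : z ∈ V := h.left_right ▸ h4
  have z1 : z ∈ H₁ := h7.2.right_mem
  have z2 : z ∈ H₂ := k7.2.left_mem
  have hin : H₁ ∩ H₂ = {z} := Subset.antisymm
    (fun w hw => hV1 w hw.1 (h.cl_inter hE (c1 hw.1) (c2 hw.2)))
    (singleton_subset_iff.2 ⟨z1, z2⟩)
  have hzd : z ∈ Q.dom := by
    rcases h.vert.mem_cases hzV with h' | ⟨h', -⟩ | ⟨h', -⟩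
    · exact h'
    · rcases h.bot.superset h' with h' | h'
      exacts [absurd h' (h₁.notMem_bot z1), absurd h' (h₂.notMem_bot z2)]
    · rcases h.top.superset h' with h' | h'
      exacts [absurd h' (h₁.notMem_top z1), absurd h' (h₂.notMem_top z2)]
  refine ⟨⟨x, y, h.left_left ▸ h1, h.left_a ▸ h2, h.left_d ▸ h3, h.right_right ▸ k4, h.right_c ▸ k5,
    h.right_b ▸ k6, h7.concat hE.family k7 hin, ?_⟩, z, hzd, ?_, ?_, hin, ?_, ?_⟩
  · rintro w ⟨hw, hwn⟩
    by_cases hwz : w = z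
    · exact hwz ▸ hzd
    rcases hw with hw | hw
    · refine h.dom_left (h8 ⟨hw, ?_⟩)
      rintro (rfl | rfl)
      exacts [hwn (Or.inl rfl), hwz rfl]
    · refine h.dom_right (k8 ⟨hw, ?_⟩)
      rintro (rfl | rfl)
      exacts [hwz rfl, hwn (Or.inr rfl)]
  · exact Subset.antisymm (fun w hw => hV1 w hw.1 hw.2) (singleton_subset_iff.2 ⟨z1, hzV⟩)
  · exact Subset.antisymm (fun w hw => hV2 w hw.1 hw.2) (singleton_subset_iff.2 ⟨z2, hzV⟩)
  · refine Subset.antisymm ?_ fun w hw => ⟨Or.inl hw, c1 hw⟩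
    rintro w ⟨hw | hw, hw'⟩
    · exact hw
    · rw [hV2 w hw (h.cl_inter hE hw' (c2 hw))]; exact z1
  · refine Subset.antisymm ?_ fun w hw => ⟨Or.inr hw, c2 hw⟩
    rintro w ⟨hw | hw, hw'⟩
    · rw [hV1 w hw (h.cl_inter hE (c1 hw) hw')]; exact z2
    · exact hw

end Cut

end Quad


/-! ### Nets, and adding lines to them -/

namespace Quad

section Net

variable {X : Type*} [TopologicalSpace X] [T2Space X] {E : Set (Set X)} {Q Q₁ Q₂ : Quad E}
  {p q x y z : X} {A B V W H H₁ H₂ : Set X} {𝒱 ℋ 𝒱' ℋ' 𝒱₁ 𝒱₂ ℋ₁ ℋ₂ : Set (Set X)}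

theorem vert_mirror : Q.mirror.Vert V ↔ Q.Vert V := ⟨fun h => h.mirror, fun h => h.mirror⟩

/-- A grid none of whose lines ends at a vertex. -/
structure Net (Q : Quad E) (𝒱 ℋ : Set (Set X)) : Prop where
  finite_vert : 𝒱.Finite
  finite_horiz : ℋ.Finite
  vert : ∀ V ∈ 𝒱, Q.Vert V
  horiz : ∀ H ∈ ℋ, Q.Horiz H
  disjoint_vert : ∀ V ∈ 𝒱, ∀ W ∈ 𝒱, V ≠ W → Disjoint V W
  disjoint_horiz : ∀ V ∈ ℋ, ∀ W ∈ ℋ, V ≠ W → Disjoint V W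
  meet : ∀ V ∈ 𝒱, ∀ H ∈ ℋ, ∃ z, V ∩ H = {z}

theorem Net.transpose (h : Net Q 𝒱 ℋ) : Net Q.transpose ℋ 𝒱 where
  finite_vert := h.finite_horiz
  finite_horiz := h.finite_vert
  vert := h.horiz
  horiz := h.vert
  disjoint_vert := h.disjoint_horiz
  disjoint_horiz := h.disjoint_vert
  meet V hV H hH := by rw [inter_comm]; exact h.meet H hH V hV

theorem Net.mirror (h : Net Q 𝒱 ℋ) : Net Q.mirror 𝒱 ℋ where
  finite_vert := h.finite_vert
  finite_horiz := h.finite_horiz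
  vert V hV := (h.vert V hV).mirror
  horiz V hV := (h.horiz V hV).mirror
  disjoint_vert := h.disjoint_vert
  disjoint_horiz := h.disjoint_horiz
  meet := h.meet

theorem Net.web (hE : Axioms E) (h : Net Q 𝒱 ℋ) : Web E Q.curve Q.dom (𝒱 ∪ ℋ) :=
  Q.web hE h.finite_vert h.finite_horiz (fun V hV => (h.vert V hV).crossing)
    (fun V hV => (h.horiz V hV).crossing) h.disjoint_vert h.disjoint_horiz h.meet

theorem Net.insert_horiz (h : Net Q 𝒱 ℋ) (hH : Q.Horiz H) (hd : ∀ H' ∈ ℋ, Disjoint H H')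
    (hm : ∀ V ∈ 𝒱, ∃ z, V ∩ H = {z}) : Net Q 𝒱 (insert H ℋ) where
  finite_vert := h.finite_vert
  finite_horiz := h.finite_horiz.insert H
  vert := h.vert
  horiz := by rintro V (rfl | hV); exacts [hH, h.horiz V hV]
  disjoint_vert := h.disjoint_vert
  disjoint_horiz := by
    rintro V (rfl | hV) W (rfl | hW) hVW
    exacts [absurd rfl hVW, hd W hW, (hd V hV).symm, h.disjoint_horiz V hV W hW hVW]
  meet := by rintro V hV H (rfl | hH); exacts [hm V hV, h.meet V hV H hH]

theorem IsCut.not_vert (h : IsCut Q V Q₁ Q₂) : ¬ Q₁.Vert V := by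
  intro hV
  have := (h.vert_of_left hV).2
  obtain ⟨x, y, -, -, -, -, -, -, h7, -⟩ := hV
  exact Set.disjoint_left.1 this h7.2.left_mem h7.2.left_mem

theorem IsCut.net_left (hE : Axioms E) (h : IsCut Q V Q₁ Q₂) (hN : Net Q 𝒱 ℋ) (hV : V ∈ 𝒱) :
    Net Q₁ {W ∈ 𝒱 | Q₁.Vert W} ((· ∩ Q₁.cl) '' ℋ) where
  finite_vert := hN.finite_vert.subset (sep_subset _ _)
  finite_horiz := hN.finite_horiz.image _
  vert W hW := hW.2
  horiz := by
    rintro _ ⟨H, hH, rfl⟩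
    obtain ⟨z, hz⟩ := hN.meet V hV H hH
    exact (h.horiz_split hE (hN.horiz H hH) hz).1
  disjoint_vert W hW W' hW' := hN.disjoint_vert W hW.1 W' hW'.1
  disjoint_horiz := by
    rintro _ ⟨H, hH, rfl⟩ _ ⟨H', hH', rfl⟩ hne
    exact (hN.disjoint_horiz H hH H' hH' fun h => hne (by rw [h])).mono inter_subset_left
      inter_subset_left
  meet := by
    rintro W hW _ ⟨H, hH, rfl⟩
    obtain ⟨z, hz⟩ := hN.meet W hW.1 H hH
    refine ⟨z, ?_⟩
    rw [← hz]
    exact Subset.antisymm (fun w hw => ⟨hw.1, hw.2.1⟩)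
      fun w hw => ⟨hw.1, hw.2, hW.2.subset_cl hw.1⟩

theorem IsCut.net_right (hE : Axioms E) (h : IsCut Q V Q₁ Q₂) (hN : Net Q 𝒱 ℋ) (hV : V ∈ 𝒱) :
    Net Q₂ {W ∈ 𝒱 | Q₂.Vert W} ((· ∩ Q₂.cl) '' ℋ) := by
  have := (h.mirror.net_left hE hN.mirror hV).mirror
  simp only [vert_mirror, cl_mirror] at this
  exact this

/-- The number of lines is the measure for the inductions: cutting along `V` removes `V` itself, and
taking traces creates no new horizontal lines. -/
theorem IsCut.ncard_lt (h : IsCut Q V Q₁ Q₂) (hN : Net Q 𝒱 ℋ) (hV : V ∈ 𝒱) (S : Set X) :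
    {W ∈ 𝒱 | Q₁.Vert W}.ncard + ((· ∩ S) '' ℋ).ncard < 𝒱.ncard + ℋ.ncard := by
  refine add_lt_add_of_lt_of_le (ncard_lt_ncard ⟨sep_subset _ _, fun hc => ?_⟩ hN.finite_vert)
    (ncard_image_le hN.finite_horiz)
  exact h.not_vert (hc hV).2

theorem IsCut.vert_inter_eq (hE : Axioms E) (h : IsCut Q V Q₁ Q₂) (hW : Q₁.Vert W)
    (h₂ : H₂ ⊆ Q₂.cl) : W ∩ (H₁ ∪ H₂) = W ∩ H₁ := by
  refine Subset.antisymm ?_ (inter_subset_inter_right _ subset_union_left)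
  rintro w ⟨hw, hw' | hw'⟩
  · exact ⟨hw, hw'⟩
  · exact absurd (h.cl_inter hE (hW.subset_cl hw) (h₂ hw'))
      fun hV => Set.disjoint_left.1 (h.vert_of_left hW).2 hV hw

theorem IsCut.vert_inter_eq' (hE : Axioms E) (h : IsCut Q V Q₁ Q₂) (hW : Q₂.Vert W)
    (h₁ : H₁ ⊆ Q₁.cl) : W ∩ (H₁ ∪ H₂) = W ∩ H₂ := by
  rw [union_comm]
  exact h.mirror.vert_inter_eq hE hW.mirror (cl_mirror (Q := Q₁) ▸ h₁)

theorem IsCut.vert_of_right (h : IsCut Q V Q₁ Q₂) (hW : Q₂.Vert W) : Q.Vert W ∧ Disjoint V W := by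
  have := h.mirror.vert_of_left hW.mirror
  rwa [vert_mirror] at this

/-- Glueing nets of the two parts whose lines fit together along the cut. -/
theorem IsCut.merge (hE : Axioms E) (h : IsCut Q V Q₁ Q₂) (h₁ : Net Q₁ 𝒱₁ ℋ₁) (h₂ : Net Q₂ 𝒱₂ ℋ₂) :
    Net Q (insert V (𝒱₁ ∪ 𝒱₂))
      {H | ∃ H₁ ∈ ℋ₁, ∃ H₂ ∈ ℋ₂, (H₁ ∩ H₂).Nonempty ∧ H = H₁ ∪ H₂} where
  finite_vert := (h₁.finite_vert.union h₂.finite_vert).insert V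
  finite_horiz := by
    refine (h₁.finite_horiz.image2 (· ∪ ·) h₂.finite_horiz).subset ?_
    rintro _ ⟨H₁, k1, H₂, k2, -, rfl⟩
    exact ⟨H₁, k1, H₂, k2, rfl⟩
  vert := by
    rintro W (rfl | hW | hW)
    exacts [h.vert, (h.vert_of_left (h₁.vert W hW)).1, (h.vert_of_right (h₂.vert W hW)).1]
  horiz := by
    rintro _ ⟨H₁, k1, H₂, k2, hne, rfl⟩
    exact (h.horiz_union hE (h₁.horiz _ k1) (h₂.horiz _ k2) hne).1
  disjoint_vert := by
    have cross : ∀ W ∈ 𝒱₁, ∀ W' ∈ 𝒱₂, Disjoint W W' := fun W hW W' hW' =>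
      Set.disjoint_left.2 fun w hw hw' => Set.disjoint_left.1 (h.vert_of_left (h₁.vert W hW)).2
        (h.cl_inter hE ((h₁.vert W hW).subset_cl hw) ((h₂.vert W' hW').subset_cl hw')) hw
    rintro W (rfl | hW | hW) W' (rfl | hW' | hW') hne
    · exact absurd rfl hne
    · exact (h.vert_of_left (h₁.vert _ hW')).2
    · exact (h.vert_of_right (h₂.vert _ hW')).2
    · exact (h.vert_of_left (h₁.vert _ hW)).2.symm
    · exact h₁.disjoint_vert W hW W' hW' hne
    · exact cross W hW W' hW'
    · exact (h.vert_of_right (h₂.vert _ hW)).2.symm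
    · exact (cross W' hW' W hW).symm
    · exact h₂.disjoint_vert W hW W' hW' hne
  disjoint_horiz := by
    rintro _ ⟨H₁, k1, H₂, k2, hne, rfl⟩ _ ⟨H₁', k1', H₂', k2', hne', rfl⟩ hH
    obtain ⟨-, z, -, z1, z2, z12, e1, e2⟩ := h.horiz_union hE (h₁.horiz _ k1) (h₂.horiz _ k2) hne
    obtain ⟨-, z', -, z1', z2', z12', e1', e2'⟩ :=
      h.horiz_union hE (h₁.horiz _ k1') (h₂.horiz _ k2') hne'
    have p1 : z ∈ H₁ := (z12.superset rfl).1
    have p2 : z ∈ H₂ := (z12.superset rfl).2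
    have p1' : z' ∈ H₁' := (z12'.superset rfl).1
    have p2' : z' ∈ H₂' := (z12'.superset rfl).2
    have pV : z ∈ V := (z1.superset rfl).2
    have pV' : z' ∈ V := (z1'.superset rfl).2
    -- A glued line is determined by the point at which it crosses the cut, since lines of one net
    -- through a common point coincide.
    have same : z ≠ z' := by
      rintro rfl
      have q1 : H₁ = H₁' := by
        by_contra hc
        exact Set.disjoint_left.1 (h₁.disjoint_horiz _ k1 _ k1' hc) p1 p1'
      have q2 : H₂ = H₂' := by
        by_contra hc
        exact Set.disjoint_left.1 (h₂.disjoint_horiz _ k2 _ k2' hc) p2 p2'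
      exact hH (by rw [q1, q2])
    have q1 : H₁ ≠ H₁' := by
      rintro rfl
      exact same (z1'.subset ⟨p1, pV⟩)
    have q2 : H₂ ≠ H₂' := by
      rintro rfl
      exact same (z2'.subset ⟨p2, pV⟩)
    have c1 := (h₁.horiz _ k1).subset_cl
    have c2 := (h₂.horiz _ k2).subset_cl
    have c1' := (h₁.horiz _ k1').subset_cl
    have c2' := (h₂.horiz _ k2').subset_cl
    refine Set.disjoint_left.2 ?_
    rintro w (hw | hw) (hw' | hw')
    · exact Set.disjoint_left.1 (h₁.disjoint_horiz _ k1 _ k1' q1) hw hw'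
    · have hV := h.cl_inter hE (c1 hw) (c2' hw')
      exact same ((z1.subset ⟨hw, hV⟩ : w = z).symm.trans (z2'.subset ⟨hw', hV⟩))
    · have hV := h.cl_inter hE (c1' hw') (c2 hw)
      exact same ((z2.subset ⟨hw, hV⟩ : w = z).symm.trans (z1'.subset ⟨hw', hV⟩))
    · exact Set.disjoint_left.1 (h₂.disjoint_horiz _ k2 _ k2' q2) hw hw'
  meet := by
    rintro W hW _ ⟨H₁, k1, H₂, k2, hne, rfl⟩
    obtain ⟨-, z, -, z1, z2, z12, e1, e2⟩ := h.horiz_union hE (h₁.horiz _ k1) (h₂.horiz _ k2) hne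
    rcases hW with rfl | hW | hW
    · exact ⟨z, by rw [inter_comm, union_inter_distrib_right, z1, z2, union_self]⟩
    · rw [h.vert_inter_eq hE (h₁.vert W hW) (h₂.horiz _ k2).subset_cl]
      exact h₁.meet W hW _ k1
    · rw [h.vert_inter_eq' hE (h₂.vert W hW) (h₁.horiz _ k1).subset_cl]
      exact h₂.meet W hW _ k2

/-- Through every inner point of the left side passes a horizontal line that fits into a given
net. -/
theorem exists_horiz (hE : Axioms E) (n : ℕ) : ∀ (Q : Quad E) (𝒱 ℋ : Set (Set X)) (x : X),
    Net Q 𝒱 ℋ → 𝒱.ncard + ℋ.ncard = n → x ∈ Q.left → x ≠ Q.a → x ≠ Q.d → x ∉ ⋃₀ ℋ →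
    ∃ H, x ∈ H ∧ Q.Horiz H ∧ (∀ H' ∈ ℋ, Disjoint H H') ∧ ∀ V ∈ 𝒱, ∃ z, V ∩ H = {z} := by
  induction n using Nat.strong_induction_on with
  | _ n ih =>
  intro Q 𝒱 ℋ x hN hn hx hxa hxd hxH
  have hxH' : ∀ H ∈ ℋ, x ∉ H := fun H h1 h2 => hxH ⟨H, h1, h2⟩
  rcases 𝒱.eq_empty_or_nonempty with rfl | ⟨V, hV⟩
  · rcases ℋ.eq_empty_or_nonempty with rfl | ⟨H₀, hH₀⟩
    -- With no lines present a crosscut from `x` suffices. Aiming at an inner point of the right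
    -- side and avoiding bottom and top makes it end inside the right side.
    · have hl : Loop E Q.a Q.d Q.left (Q.bot ∪ Q.right ∪ Q.top) := by
        refine ⟨Q.arc_left, (Q.arc_bot.concat hE.family Q.arc_right Q.bot_right).concat hE.family
          Q.arc_top.symm ?_, ?_⟩
        · rw [union_inter_distrib_right, Q.bot_top.inter_eq, empty_union, Q.right_top]
        · rw [inter_union_distrib_left, inter_union_distrib_left, Q.left_bot, Q.left_right.inter_eq,
            union_empty, inter_comm, Q.top_left]; rfl
      obtain ⟨r, hr, hrn⟩ := Q.arc_right.2.nonempty_diff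
      simp only [mem_insert_iff, mem_singleton_iff, not_or] at hrn
      have hrb : r ∉ Q.bot := fun h => hrn.1 (Q.bot_right.subset ⟨h, hr⟩)
      have hrt : r ∉ Q.top := fun h => hrn.2 (Q.right_top.subset ⟨hr, h⟩)
      obtain ⟨y, C, hy, hyN, -, -, hC, hCi⟩ := hl.exists_crosscut hE (U := Q.dom) (r := r) (x := x)
        (N := (Q.bot ∪ Q.top)ᶜ) (by
          rw [union_comm]; exact Q.isDom) hx hxa hxd (Or.inl (Or.inr hr))
        (fun h => hrb (h ▸ a_mem_bot)) (fun h => hrt (h ▸ d_mem_top))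
        (Q.arc_bot.2.isClosed.union Q.arc_top.2.isClosed).isOpen_compl
        (fun h => h.elim hrb hrt)
      have hyb : y ∉ Q.bot := fun h => hyN (Or.inl h)
      have hyt : y ∉ Q.top := fun h => hyN (Or.inr h)
      refine ⟨C, hC.2.left_mem, ⟨x, y, hx, hxa, hxd, ?_, fun h => hyt (h ▸ c_mem_top),
        fun h => hyb (h ▸ b_mem_bot), hC, hCi⟩, by simp, by simp⟩
      rcases hy with (hy | hy) | hy
      exacts [absurd hy hyb, hy, absurd hy hyt]
    -- With only horizontal lines, the cut is made along one of them and the induction takes place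
    -- in the part containing `x`. The claim is stated for a transposed quadrilateral `R`, so that
    -- its mirror image handles the other part.
    · have key : ∀ R T₁ T₂ : Quad E, IsCut R H₀ T₁ T₂ → Net R ℋ ∅ → x ∈ T₁.bot → x ≠ R.a →
          ∃ H, x ∈ H ∧ R.Vert H ∧ (∀ H' ∈ ℋ, Disjoint H H') := by
        intro R T₁ T₂ hc hR hx1 hxR
        obtain ⟨H, k1, k2, k3, -⟩ := ih _ (by
          have := hc.ncard_lt hR hH₀ T₁.cl
          rwa [add_comm _ (ncard ∅), add_comm, hn] at this) T₁.transpose _ _ x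
          (hc.net_left hE hR hH₀).transpose rfl hx1 (hc.left_a ▸ hxR) (by
            rintro rfl
            exact hxH' _ hH₀ (hc.left_right ▸ b_mem_right)) (by
            rintro ⟨H, k1, k2⟩
            exact hxH' H k1.1 k2)
        have k4 := hc.vert_of_left k2
        refine ⟨H, k1, k4.1, fun H' hH' => ?_⟩
        by_cases hne : H₀ = H'
        · exact hne ▸ k4.2.symm
        rcases hc.vert_cases hE (hR.vert _ hH') (hR.disjoint_vert _ hH₀ _ hH' hne) with h | h
        · exact k3 H' ⟨hH', h⟩
        · refine Set.disjoint_left.2 fun w hw hw' => Set.disjoint_left.1 k4.2 ?_ hw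
          exact hc.cl_inter hE (Vert.subset_cl (Q := T₁) k2 hw) (h.subset_cl hw')
      obtain ⟨T₁, T₂, hc⟩ := Vert.exists_isCut (Q := Q.transpose) hE (hN.horiz _ hH₀)
      rcases hc.bot.superset hx with h | h
      · obtain ⟨H, k1, k2, k3⟩ := key _ _ _ hc hN.transpose h hxa
        exact ⟨H, k1, k2, k3, by simp⟩
      · obtain ⟨H, k1, k2, k3⟩ := key _ _ _ hc.mirror hN.transpose.mirror h hxd
        exact ⟨H, k1, k2.mirror, k3, by simp⟩
  -- In the presence of a vertical line, a line through the left half is continued in the right half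
  -- from its end on `V`.
  · obtain ⟨Q₁, Q₂, hc⟩ := (hN.vert V hV).exists_isCut hE
    obtain ⟨H₁, k1, k2, k3, k4⟩ := ih _ (hn ▸ hc.ncard_lt hN hV Q₁.cl) Q₁ _ _ x
      (hc.net_left hE hN hV) rfl (hc.left_left ▸ hx) (hc.left_a ▸ hxa) (hc.left_d ▸ hxd) (by
        rintro ⟨_, ⟨H, k1, rfl⟩, k2⟩
        exact hxH' H k1 k2.1)
    obtain ⟨_, y, -, -, -, y1, y2, y3, y4, -⟩ := id k2
    have yH := y4.2.right_mem
    obtain ⟨H₂, l1, l2, l3, l4⟩ := ih _ (by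
        have := hc.mirror.ncard_lt hN.mirror hV Q₂.cl
        simp only [vert_mirror] at this
        exact hn ▸ this) Q₂ _ _ y
      (hc.net_right hE hN hV) rfl (by rw [hc.right_left, ← hc.left_right]; exact y1) (hc.b_eq ▸ y3)
      (hc.c_eq ▸ y2) (by
        rintro ⟨_, ⟨H, k1, rfl⟩, k2⟩
        exact Set.disjoint_left.1 (k3 _ ⟨H, k1, rfl⟩) yH
          ⟨k2.1, curve_subset_cl (right_subset_curve y1)⟩)
    obtain ⟨hH, z, -, z1, z2, -, -⟩ := hc.horiz_union hE k2 l2 ⟨y, yH, l1⟩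
    refine ⟨H₁ ∪ H₂, Or.inl k1, hH, fun H' hH' => Set.disjoint_left.2 ?_, fun W hW => ?_⟩
    · rintro w (hw | hw) hw'
      · exact Set.disjoint_left.1 (k3 _ ⟨H', hH', rfl⟩) hw ⟨hw', k2.subset_cl hw⟩
      · exact Set.disjoint_left.1 (l3 _ ⟨H', hH', rfl⟩) hw ⟨hw', l2.subset_cl hw⟩
    · by_cases hne : V = W
      · exact ⟨z, by rw [← hne, inter_comm, union_inter_distrib_right, z1, z2, union_self]⟩
      rcases hc.vert_cases hE (hN.vert _ hW) (hN.disjoint_vert _ hV _ hW hne) with h | h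
      · rw [hc.vert_inter_eq hE h l2.subset_cl]
        exact k4 W ⟨hW, h⟩
      · rw [hc.vert_inter_eq' hE h k2.subset_cl]
        exact l4 W ⟨hW, h⟩

theorem Horiz.eq_of_mem_left (h : Q.Horiz H) (hx : x ∈ H) (hy : y ∈ H) (hxl : x ∈ Q.left)
    (hyl : y ∈ Q.left) : x = y := by
  obtain ⟨u, v, h1, h2, h3, h4, h5, h6, h7, h8⟩ := id h
  have key : ∀ w ∈ H, w ∈ Q.left → w = u := by
    intro w hw hwl
    by_contra hc
    refine Q.dom_curve.notMem (h8 ⟨hw, ?_⟩) (left_subset_curve hwl)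
    rintro (rfl | rfl)
    exacts [hc rfl, Set.disjoint_left.1 Q.left_right hwl h4]
  rw [key x hx hxl, key y hy hyl]

/-- The exact control over which points of the left side become covered is what later lets the lines
of two halves match along a common side. -/
theorem Net.exists_horiz (hE : Axioms E) (hN : Net Q 𝒱 ℋ) {Z : Set X} (hZ : Z.Finite) :
    (∀ z ∈ Z, z ∈ Q.left ∧ z ≠ Q.a ∧ z ≠ Q.d) → ∃ ℋ', ℋ ⊆ ℋ' ∧ Net Q 𝒱 ℋ' ∧
      ∀ z ∈ Q.left, z ∈ ⋃₀ ℋ' ↔ z ∈ ⋃₀ ℋ ∨ z ∈ Z := by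
  induction Z, hZ using Set.Finite.induction_on with
  | empty => exact fun _ => ⟨ℋ, subset_rfl, hN, by simp⟩
  | @insert z Z _ hZ ih =>
    intro hz
    obtain ⟨ℋ', h1, h2, h3⟩ := ih fun w hw => hz w (Or.inr hw)
    obtain ⟨zl, za, zd⟩ := hz z (Or.inl rfl)
    by_cases hzH : z ∈ ⋃₀ ℋ'
    · refine ⟨ℋ', h1, h2, fun w hw => ?_⟩
      have := (h3 z zl).1 hzH
      rw [h3 w hw, mem_insert_iff]
      constructor
      · exact fun h => h.imp_right Or.inr
      · rintro (h | rfl | h)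
        exacts [Or.inl h, this, Or.inr h]
    · obtain ⟨H, k1, k2, k3, k4⟩ := Quad.exists_horiz hE _ Q 𝒱 ℋ' z h2 rfl zl za zd hzH
      refine ⟨insert H ℋ', h1.trans (subset_insert _ _), h2.insert_horiz k2 k3 k4, fun w hw => ?_⟩
      rw [sUnion_insert, mem_union, h3 w hw, mem_insert_iff]
      constructor
      · rintro (h | h | h)
        exacts [Or.inr (Or.inl (k2.eq_of_mem_left h k1 hw zl)), Or.inl h, Or.inr (Or.inr h)]
      · rintro (h | rfl | h)
        exacts [Or.inr (Or.inl h), Or.inl k1, Or.inr (Or.inr h)]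

end Net

end Quad


/-! ### Mesh under restriction and under removal of several lines -/

section Restrict

variable {X : Type*} [MetricSpace X] [CompactSpace X] {E : Set (Set X)} {x y : X}
  {J J₁ U U₁ : Set X} {𝓛 𝓛₁ : Set (Set X)} {ε : ℝ}

/-- By `Joined.restrict`, points of `U₁` not separated by a large curve are not separated by its
trace, so the mesh estimate of the smaller domain applies. -/
theorem Mesh.dist_le_of_restrict (hE : Axioms E) (hU : Dom E J U) (hU₁ : Dom E J₁ U₁)
    (hsub : U₁ ⊆ U) (h𝓛 : ∀ A ∈ 𝓛₁, Crosscut E J₁ U₁ A ∧ ∃ L ∈ 𝓛, Crosscut E J U L ∧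
      L ∩ U₁ = A ∩ U₁) (hm : Mesh U₁ 𝓛₁ ε) (hx : x ∈ U₁) (hy : y ∈ U₁) (hx' : x ∉ ⋃₀ 𝓛)
    (hy' : y ∉ ⋃₀ 𝓛) (hj : ∀ A ∈ 𝓛, Joined (U \ A) x y) : dist x y ≤ ε := by
  have out : ∀ z ∈ U₁, z ∉ ⋃₀ 𝓛 → z ∉ ⋃₀ 𝓛₁ := by
    rintro z hz hz' ⟨A, hA, hzA⟩
    obtain ⟨-, L, hL, -, he⟩ := h𝓛 A hA
    exact hz' ⟨L, hL, (he.superset ⟨hzA, hz⟩).1⟩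
  refine hm x ⟨hx, out x hx hx'⟩ y ⟨hy, out y hy hy'⟩ fun A hA => ?_
  obtain ⟨hAc, L, hL, hLc, he⟩ := h𝓛 A hA
  exact Joined.restrict hE hU hLc hU₁ hsub hAc he hx hy (hj L hL)

/-- Each set of the list accounts for at most one removed curve, hence for one doubling. -/
theorem Mesh.diff_list (hE : Axioms E) (hU : Dom E J U) (hε : 0 ≤ ε) (l : List (Set (Set X))) :
    ∀ 𝓛 : Set (Set X), Web E J U 𝓛 → Mesh U 𝓛 ε → (∀ S ∈ l, S.Subsingleton) →
      Mesh U {A ∈ 𝓛 | ∀ S ∈ l, A ∉ S} (2 ^ l.length * ε) := by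
  induction l with
  | nil =>
    intro 𝓛 hW h _
    simpa using h
  | cons S l ih =>
    intro 𝓛 hW h hl
    have := (ih 𝓛 hW h fun T hT => hl T (List.mem_cons_of_mem _ hT)).diff hE hU
      (hW.mono (sep_subset _ _)) (by positivity) (hl S List.mem_cons_self)
    rw [List.length_cons, pow_succ', mul_assoc]
    refine this.mono ?_
    rintro A ⟨⟨h1, h2⟩, h3⟩
    refine ⟨h1, fun T hT => ?_⟩
    rcases List.mem_cons.1 hT with rfl | hT
    exacts [h3, h2 T hT]

end Restrict

/-! ### Refining nets to arbitrarily small mesh -/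

namespace Quad

section Refine

variable {X : Type*} [MetricSpace X] [CompactSpace X] {E : Set (Set X)} {Q Q₁ Q₂ : Quad E}
  {x y z : X} {V W H H₁ H₂ : Set X} {𝒱 ℋ 𝒱₁ 𝒱₂ ℋ₁ ℋ₂ : Set (Set X)} {ε : ℝ}

/-- For the covering by balls of radius `ε / 2`, points of one cell are at distance at most `ε`. By
`Web.joined`, points not separated by any single line do lie in one cell. -/
theorem exists_grid (hE : Axioms E) (Q : Quad E) (hε : 0 < ε) : ∃ 𝒱 ℋ : Set (Set X), 𝒱.Finite ∧
    ℋ.Finite ∧ (∀ V ∈ 𝒱, Q.Crossing V) ∧ (∀ H ∈ ℋ, Q.transpose.Crossing H) ∧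
    (∀ V ∈ 𝒱, ∀ V' ∈ 𝒱, V ≠ V' → Disjoint V V') ∧ (∀ H ∈ ℋ, ∀ H' ∈ ℋ, H ≠ H' → Disjoint H H') ∧
    (∀ V ∈ 𝒱, ∀ H ∈ ℋ, ∃ z, V ∩ H = {z}) ∧ Mesh Q.dom (𝒱 ∪ ℋ) ε := by
  obtain ⟨R, hR, hint, sAB, sBC, sCD, sDA⟩ := Q.exists_quadrilateral hE
  obtain ⟨G, hG⟩ := hE.covering R hR (range fun x : X => Metric.ball x (ε / 2))
    (by rintro _ ⟨x, rfl⟩; exact Metric.isOpen_ball)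
    (fun x _ => ⟨_, ⟨x, rfl⟩, Metric.mem_ball_self (half_pos hε)⟩)
  have hv : ∀ V ∈ G.vertical, Q.Crossing V := by
    intro V hV
    obtain ⟨hVE, hVR⟩ := G.vertical_mem V hV
    obtain ⟨p, hp, q, hq, h1, h2⟩ := hVR.exists_arc
    exact ⟨p, sAB hp, q, sCD hq, ⟨hVE, h1⟩, hint ▸ h2⟩
  have hh : ∀ V ∈ G.horizontal, Q.transpose.Crossing V := by
    intro V hV
    obtain ⟨hVE, hVR⟩ := G.horizontal_mem V hV
    obtain ⟨p, hp, q, hq, h1, h2⟩ := hVR.exists_arc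
    refine ⟨q, sDA hq, p, sBC hp, ⟨hVE, h1.symm⟩, ?_⟩
    rw [pair_comm]
    exact hint ▸ h2
  have hm : ∀ V ∈ G.vertical, ∀ H ∈ G.horizontal, ∃ z, V ∩ H = {z} := by
    intro V hV H hH
    rw [inter_comm]
    exact G.meet H hH V hV
  refine ⟨G.vertical, G.horizontal, G.finite_vertical, G.finite_horizontal, hv, hh,
    G.disjoint_vertical, G.disjoint_horizontal, hm, ?_⟩
  have hW := Q.web hE G.finite_vertical G.finite_horizontal hv hh G.disjoint_vertical
    G.disjoint_horizontal hm
  intro x hx y hy hj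
  obtain ⟨C, c1, c2, c3, c4⟩ := hW.joined hE Q.dom_curve hx.1 hy.1 hj
  have e : Q.dom \ ⋃₀ (G.vertical ∪ G.horizontal) =
      R.interior \ (⋃₀ G.horizontal ∪ ⋃₀ G.vertical) := by
    rw [hint, sUnion_union, union_comm]
  rw [e] at c2
  obtain ⟨_, ⟨c, rfl⟩, hK⟩ := hG _ ⟨x, c2 c3, rfl⟩
  have key : ∀ w ∈ C, dist w c < ε / 2 := fun w hw =>
    hK (subset_closure (c1.subset_connectedComponentIn c3 c2 hw))
  have h1 := key x c3
  have h2 := key y c4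
  have h3 := dist_triangle_right x y c
  linarith

/-- At most one vertical and one horizontal line pass through each vertex. Discarding these at most
eight lines multiplies the mesh by at most `2 ^ 8`, so the grid is chosen finer by this factor. -/
theorem exists_net (hE : Axioms E) (Q : Quad E) (hε : 0 < ε) :
    ∃ 𝒱 ℋ, Net Q 𝒱 ℋ ∧ Mesh Q.dom (𝒱 ∪ ℋ) ε := by
  obtain ⟨𝒱, ℋ, f1, f2, hv, hh, dv, dh, hm, hM⟩ := Q.exists_grid hE (ε := ε / 2 ^ 8) (by positivity)
  set K : List X := [Q.a, Q.b, Q.c, Q.d] with hK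
  set l : List (Set (Set X)) := K.map (fun k => {V ∈ 𝒱 | k ∈ V}) ++ K.map fun k => {V ∈ ℋ | k ∈ V}
    with hl
  have hls : ∀ S ∈ l, S.Subsingleton := by
    intro S hS
    rcases List.mem_append.1 hS with hS | hS <;> obtain ⟨k, -, rfl⟩ := List.mem_map.1 hS
    · intro V hV W hW
      by_contra hne
      exact Set.disjoint_left.1 (dv V hV.1 W hW.1 hne) hV.2 hW.2
    · intro V hV W hW
      by_contra hne
      exact Set.disjoint_left.1 (dh V hV.1 W hW.1 hne) hV.2 hW.2
  have key := hM.diff_list hE Q.dom_curve (by positivity) l _ (Q.web hE f1 f2 hv hh dv dh hm) hls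
  have hlen : l.length = 8 := by simp [hl, hK]
  rw [hlen, mul_div_cancel₀ _ (by positivity)] at key
  refine ⟨{V ∈ 𝒱 | ∀ k ∈ K, k ∉ V}, {V ∈ ℋ | ∀ k ∈ K, k ∉ V}, ⟨f1.subset (sep_subset _ _),
    f2.subset (sep_subset _ _), ?_, ?_, fun V h1 W h2 => dv V h1.1 W h2.1,
    fun V h1 W h2 => dh V h1.1 W h2.1, fun V h1 H h2 => hm V h1.1 H h2.1⟩, key.mono ?_⟩
  · rintro V ⟨hV, hk⟩
    obtain ⟨x, hx, y, hy, hA, hAi⟩ := hv V hV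
    have hne : ∀ k ∈ K, ∀ w ∈ V, w ≠ k := by rintro k hk' w hw rfl; exact hk _ hk' hw
    exact ⟨x, y, hx, hne _ (by simp [hK]) _ hA.2.left_mem, hne _ (by simp [hK]) _ hA.2.left_mem, hy,
      hne _ (by simp [hK]) _ hA.2.right_mem, hne _ (by simp [hK]) _ hA.2.right_mem, hA, hAi⟩
  · rintro V ⟨hV, hk⟩
    obtain ⟨x, hx, y, hy, hA, hAi⟩ := hh V hV
    have hne : ∀ k ∈ K, ∀ w ∈ V, w ≠ k := by rintro k hk' w hw rfl; exact hk _ hk' hw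
    exact ⟨x, y, hx, hne _ (by simp [hK]) _ hA.2.left_mem, hne _ (by simp [hK]) _ hA.2.left_mem, hy,
      hne _ (by simp [hK]) _ hA.2.right_mem, hne _ (by simp [hK]) _ hA.2.right_mem, hA, hAi⟩
  · rintro A ⟨hA | hA, hAl⟩
    · exact Or.inl ⟨hA, fun k hk hkA =>
        hAl _ (List.mem_append_left _ (List.mem_map_of_mem hk)) ⟨hA, hkA⟩⟩
    · exact Or.inr ⟨hA, fun k hk hkA =>
        hAl _ (List.mem_append_right _ (List.mem_map_of_mem hk)) ⟨hA, hkA⟩⟩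

/-- Points not separated by `V` lie in the same half. As the lines of the two nets end at the same
points of `V`, every line of a half is the trace of a line of the merged net, and the mesh of the
half applies. -/
theorem IsCut.mesh (hE : Axioms E) (h : IsCut Q V Q₁ Q₂) (h₁ : Net Q₁ 𝒱₁ ℋ₁) (h₂ : Net Q₂ 𝒱₂ ℋ₂)
    (hends : ∀ z ∈ V, z ∈ ⋃₀ ℋ₁ ↔ z ∈ ⋃₀ ℋ₂) (m₁ : Mesh Q₁.dom (𝒱₁ ∪ ℋ₁) ε)
    (m₂ : Mesh Q₂.dom (𝒱₂ ∪ ℋ₂) ε) :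
    Mesh Q.dom (insert V (𝒱₁ ∪ 𝒱₂) ∪
      {H | ∃ H₁ ∈ ℋ₁, ∃ H₂ ∈ ℋ₂, (H₁ ∩ H₂).Nonempty ∧ H = H₁ ∪ H₂}) ε := by
  have hN := h.merge hE h₁ h₂
  have hW := hN.web hE
  have c1 : ∀ A ∈ 𝒱₁ ∪ ℋ₁, Crosscut E Q₁.curve Q₁.dom A := (h₁.web hE).crosscut
  have c2 : ∀ A ∈ 𝒱₂ ∪ ℋ₂, Crosscut E Q₂.curve Q₂.dom A := (h₂.web hE).crosscut
  have dom_inter : ∀ {S : Set X} {Q : Quad E}, S ∩ Q.dom = S ∩ Q.cl ∩ Q.dom := by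
    intro S Q
    rw [inter_assoc, inter_eq_right.2 dom_subset_cl]
  have p1 : ∀ A ∈ 𝒱₁ ∪ ℋ₁, ∃ L ∈ insert V (𝒱₁ ∪ 𝒱₂) ∪
      {H | ∃ H₁ ∈ ℋ₁, ∃ H₂ ∈ ℋ₂, (H₁ ∩ H₂).Nonempty ∧ H = H₁ ∪ H₂}, L ∩ Q₁.dom = A ∩ Q₁.dom := by
    rintro A (hA | hA)
    · exact ⟨A, Or.inl (Or.inr (Or.inl hA)), rfl⟩
    · obtain ⟨_, y, -, -, -, y1, y2, y3, y4, -⟩ := h₁.horiz A hA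
      obtain ⟨B, hB, hyB⟩ := (hends y (h.left_right ▸ y1)).1 ⟨A, hA, y4.2.right_mem⟩
      have hne : (A ∩ B).Nonempty := ⟨y, y4.2.right_mem, hyB⟩
      obtain ⟨-, z, -, -, -, -, e1, -⟩ := h.horiz_union hE (h₁.horiz A hA) (h₂.horiz B hB) hne
      exact ⟨A ∪ B, Or.inr ⟨A, hA, B, hB, hne, rfl⟩, by rw [dom_inter, e1]⟩
  have p2 : ∀ A ∈ 𝒱₂ ∪ ℋ₂, ∃ L ∈ insert V (𝒱₁ ∪ 𝒱₂) ∪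
      {H | ∃ H₁ ∈ ℋ₁, ∃ H₂ ∈ ℋ₂, (H₁ ∩ H₂).Nonempty ∧ H = H₁ ∪ H₂}, L ∩ Q₂.dom = A ∩ Q₂.dom := by
    rintro A (hA | hA)
    · exact ⟨A, Or.inl (Or.inr (Or.inr hA)), rfl⟩
    · obtain ⟨y, _, y1, y2, y3, -, -, -, y4, -⟩ := h₂.horiz A hA
      obtain ⟨B, hB, hyB⟩ := (hends y (h.right_left ▸ y1)).2 ⟨A, hA, y4.2.left_mem⟩
      have hne : (B ∩ A).Nonempty := ⟨y, hyB, y4.2.left_mem⟩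
      obtain ⟨-, z, -, -, -, -, -, e2⟩ := h.horiz_union hE (h₁.horiz B hB) (h₂.horiz A hA) hne
      exact ⟨B ∪ A, Or.inr ⟨B, hB, A, hA, hne, rfl⟩, by rw [dom_inter, e2]⟩
  intro x hx y hy hj
  obtain ⟨C, k1, k2, k3, k4⟩ := hj V (Or.inl (Or.inl rfl))
  rw [h.dom] at k2
  rcases IsPreconnected.subset_or_subset (Q₁.dom_curve.isOpen hE) (Q₂.dom_curve.isOpen hE)
    h.disjoint k2 k1 with hC | hC
  · refine m₁.dist_le_of_restrict hE Q.dom_curve Q₁.dom_curve h.dom_left (fun A hA => ⟨c1 A hA, ?_⟩)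
      (hC k3) (hC k4) hx.2 hy.2 hj
    obtain ⟨L, hL, he⟩ := p1 A hA
    exact ⟨L, hL, hW.crosscut L hL, he⟩
  · refine m₂.dist_le_of_restrict hE Q.dom_curve Q₂.dom_curve h.dom_right
      (fun A hA => ⟨c2 A hA, ?_⟩) (hC k3) (hC k4) hx.2 hy.2 hj
    obtain ⟨L, hL, he⟩ := p2 A hA
    exact ⟨L, hL, hW.crosscut L hL, he⟩

theorem Net.finite_left (h : Net Q 𝒱 ℋ) : {z ∈ Q.left | z ∈ ⋃₀ ℋ}.Finite := by
  refine (h.finite_horiz.biUnion (t := fun H => H ∩ Q.left) fun H hH => ?_).subset ?_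
  · refine Set.Subsingleton.finite ?_
    exact fun u hu v hv => (h.horiz H hH).eq_of_mem_left hu.1 hv.1 hu.2 hv.2
  · rintro z ⟨hz, H, hH, hzH⟩
    exact mem_biUnion hH ⟨hzH, hz⟩

/-- Refinements of the halves need not fit together, so each is enlarged by lines starting at the
points of `V` where lines of the other one end. Extra lines do not spoil the mesh, and the enlarged
nets can be merged. -/
theorem exists_refine_cut (hE : Axioms E) (h : IsCut Q V Q₁ Q₂) (hN : Net Q 𝒱 ℋ) (hV : V ∈ 𝒱)
    (r₁ : ∃ 𝒱' ℋ', {W ∈ 𝒱 | Q₁.Vert W} ⊆ 𝒱' ∧ (· ∩ Q₁.cl) '' ℋ ⊆ ℋ' ∧ Net Q₁ 𝒱' ℋ' ∧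
      Mesh Q₁.dom (𝒱' ∪ ℋ') ε)
    (r₂ : ∃ 𝒱' ℋ', {W ∈ 𝒱 | Q₂.Vert W} ⊆ 𝒱' ∧ (· ∩ Q₂.cl) '' ℋ ⊆ ℋ' ∧ Net Q₂ 𝒱' ℋ' ∧
      Mesh Q₂.dom (𝒱' ∪ ℋ') ε) :
    ∃ 𝒱' ℋ', 𝒱 ⊆ 𝒱' ∧ ℋ ⊆ ℋ' ∧ Net Q 𝒱' ℋ' ∧ Mesh Q.dom (𝒱' ∪ ℋ') ε := by
  obtain ⟨𝒱₁, ℋ₁, v1, l1, n1, m1⟩ := r₁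
  obtain ⟨𝒱₂, ℋ₂, v2, l2, n2, m2⟩ := r₂
  have fin1 : {z ∈ V | z ∈ ⋃₀ ℋ₁}.Finite := h.left_right ▸ n1.mirror.finite_left
  have fin2 : {z ∈ V | z ∈ ⋃₀ ℋ₂}.Finite := h.right_left ▸ n2.finite_left
  obtain ⟨ℋ₁', i1, n1', e1⟩ := n1.mirror.exists_horiz hE fin2 (by
    rintro z ⟨hz, H, hH, hzH⟩
    refine ⟨show z ∈ Q₁.right from h.left_right ▸ hz, ?_, ?_⟩
    · rintro rfl
      exact (n2.horiz H hH).notMem_bot hzH (show Q₁.b ∈ Q₂.bot from h.b_eq ▸ a_mem_bot)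
    · rintro rfl
      exact (n2.horiz H hH).notMem_top hzH (show Q₁.c ∈ Q₂.top from h.c_eq ▸ d_mem_top))
  obtain ⟨ℋ₂', i2, n2', e2⟩ := n2.exists_horiz hE fin1 (by
    rintro z ⟨hz, H, hH, hzH⟩
    refine ⟨h.right_left ▸ hz, ?_, ?_⟩
    · rintro rfl
      exact (n1.horiz H hH).notMem_bot hzH (h.b_eq ▸ b_mem_bot)
    · rintro rfl
      exact (n1.horiz H hH).notMem_top hzH (h.c_eq ▸ c_mem_top))
  replace n1' : Net Q₁ 𝒱₁ ℋ₁' := n1'.mirror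
  have hends : ∀ z ∈ V, z ∈ ⋃₀ ℋ₁' ↔ z ∈ ⋃₀ ℋ₂' := by
    intro z hz
    rw [e1 z (show z ∈ Q₁.right from h.left_right ▸ hz), e2 z (h.right_left ▸ hz)]
    simp only [mem_ofPred_eq, hz, true_and]
    exact or_comm
  refine ⟨_, _, ?_, ?_, h.merge hE n1' n2', h.mesh hE n1' n2' hends
    (m1.mono (union_subset_union_right _ i1)) (m2.mono (union_subset_union_right _ i2))⟩
  · intro W hW
    by_cases hne : V = W
    · exact Or.inl hne.symm
    rcases h.vert_cases hE (hN.vert _ hW) (hN.disjoint_vert _ hV _ hW hne) with h' | h'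
    · exact Or.inr (Or.inl (v1 ⟨hW, h'⟩))
    · exact Or.inr (Or.inr (v2 ⟨hW, h'⟩))
  · intro H hH
    obtain ⟨z, hz⟩ := hN.meet V hV H hH
    have hz' : z ∈ V ∩ H := hz.superset rfl
    refine ⟨_, i1 (l1 ⟨H, hH, rfl⟩), _, i2 (l2 ⟨H, hH, rfl⟩),
      ⟨z, ⟨hz'.2, h.subset_left hz'.1⟩, ⟨hz'.2, h.subset_right hz'.1⟩⟩, ?_⟩
    rw [← inter_union_distrib_left, ← h.cl, inter_eq_left.2 (hN.horiz H hH).subset_cl]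

/-- Cutting along the lines of the net one after another reduces the problem to quadrilaterals
without lines, where `exists_net` applies; horizontal lines are treated by transposition. -/
theorem exists_refine (hE : Axioms E) (hε : 0 < ε) (n : ℕ) : ∀ (Q : Quad E) (𝒱 ℋ : Set (Set X)),
    Net Q 𝒱 ℋ → 𝒱.ncard + ℋ.ncard = n →
    ∃ 𝒱' ℋ', 𝒱 ⊆ 𝒱' ∧ ℋ ⊆ ℋ' ∧ Net Q 𝒱' ℋ' ∧ Mesh Q.dom (𝒱' ∪ ℋ') ε := by
  induction n using Nat.strong_induction_on with
  | _ n ih =>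
  have step : ∀ (Q : Quad E) (𝒱 ℋ : Set (Set X)), Net Q 𝒱 ℋ → 𝒱.ncard + ℋ.ncard = n →
      𝒱.Nonempty → ∃ 𝒱' ℋ', 𝒱 ⊆ 𝒱' ∧ ℋ ⊆ ℋ' ∧ Net Q 𝒱' ℋ' ∧ Mesh Q.dom (𝒱' ∪ ℋ') ε := by
    rintro Q 𝒱 ℋ hN hn ⟨V, hV⟩
    obtain ⟨Q₁, Q₂, hc⟩ := (hN.vert V hV).exists_isCut hE
    refine exists_refine_cut hE hc hN hV
      (ih _ (hn ▸ hc.ncard_lt hN hV Q₁.cl) Q₁ _ _ (hc.net_left hE hN hV) rfl)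
      (ih _ ?_ Q₂ _ _ (hc.net_right hE hN hV) rfl)
    have := hc.mirror.ncard_lt hN.mirror hV Q₂.cl
    simp only [vert_mirror] at this
    exact hn ▸ this
  intro Q 𝒱 ℋ hN hn
  rcases 𝒱.eq_empty_or_nonempty with rfl | hV
  · rcases ℋ.eq_empty_or_nonempty with rfl | hH
    · obtain ⟨𝒱, ℋ, h1, h2⟩ := Q.exists_net hE hε
      exact ⟨𝒱, ℋ, empty_subset _, empty_subset _, h1, h2⟩
    · obtain ⟨𝒱', ℋ', h1, h2, h3, h4⟩ := step Q.transpose ℋ ∅ hN.transpose (by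
        rw [add_comm]; exact hn) hH
      exact ⟨ℋ', 𝒱', h2, h1, h3.transpose, by rw [union_comm]; exact h4⟩
  · exact step Q 𝒱 ℋ hN hn hV

/-- An increasing sequence of nets whose meshes tend to zero. -/
theorem exists_seq (hE : Axioms E) (Q : Quad E) : ∃ 𝒱 ℋ : ℕ → Set (Set X), Monotone 𝒱 ∧
    Monotone ℋ ∧ (∀ n, Net Q (𝒱 n) (ℋ n)) ∧ ∀ n, Mesh Q.dom (𝒱 n ∪ ℋ n) (1 / (n + 1)) := by
  have step : ∀ (n : ℕ) (P : {P : Set (Set X) × Set (Set X) // Net Q P.1 P.2}),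
      ∃ P' : {P : Set (Set X) × Set (Set X) // Net Q P.1 P.2}, P.1.1 ⊆ P'.1.1 ∧ P.1.2 ⊆ P'.1.2 ∧
        Mesh Q.dom (P'.1.1 ∪ P'.1.2) (1 / (n + 1)) := by
    rintro n ⟨⟨𝒱, ℋ⟩, hN⟩
    obtain ⟨𝒱', ℋ', h1, h2, h3, h4⟩ := exists_refine hE (ε := 1 / (n + 1)) (by positivity) _ Q 𝒱 ℋ
      hN rfl
    exact ⟨⟨⟨𝒱', ℋ'⟩, h3⟩, h1, h2, h4⟩
  choose F f1 f2 f3 using step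
  obtain ⟨𝒱₀, ℋ₀, h0, -⟩ := Q.exists_net hE one_pos
  set P : ℕ → {P : Set (Set X) × Set (Set X) // Net Q P.1 P.2} :=
    fun n => Nat.rec ⟨(𝒱₀, ℋ₀), h0⟩ F n with hP
  -- The index is shifted because the mesh bound `1 / (n + 1)` is produced by the step from `P n` to
  -- `P (n + 1)`.
  refine ⟨fun n => (P (n + 1)).1.1, fun n => (P (n + 1)).1.2,
    monotone_nat_of_le_succ fun n => f1 (n + 1) (P (n + 1)),
    monotone_nat_of_le_succ fun n => f2 (n + 1) (P (n + 1)), fun n => (P (n + 1)).2,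
    fun n => f3 n (P n)⟩

end Refine

end Quad


/-! ### Distance estimates up to the boundary -/

section WebDist

variable {X : Type*} [MetricSpace X] [CompactSpace X] {E : Set (Set X)} {x y : X} {J U : Set X}
  {𝓛 : Set (Set X)} {ε : ℝ}

/-- Points of the closed domain that no line of a web separates are close. -/
theorem Web.dist_le (hE : Axioms E) (hU : Dom E J U) (hW : Web E J U 𝓛) (hM : Mesh U 𝓛 ε)
    (hx : x ∈ closure U) (hy : y ∈ closure U) (h : ∀ A ∈ 𝓛, ∃ D K : Set X, IsClosed K ∧
      IsPreconnected D ∧ D ⊆ U \ A ∧ U \ A ⊆ D ∪ K ∧ x ∉ K ∧ y ∉ K) : dist x y ≤ ε := by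
  choose! D K h1 h2 h3 h4 h5 h6 using h
  -- Points off all the curves and close enough to `x` or `y` avoid every `K A`, hence lie in every
  -- `D A`; the mesh estimate for them passes to the limit.
  have hopen : IsOpen (⋂ A ∈ 𝓛, (K A)ᶜ) :=
    hW.finite.isOpen_biInter fun A hA => (h1 A hA).isOpen_compl
  refine le_of_forall_pos_le_add fun η hη => ?_
  have hη' := half_pos hη
  obtain ⟨z, ⟨z1, z2⟩, z3⟩ := hW.exists_mem hE hU hx (Metric.isOpen_ball.inter hopen)
    ⟨Metric.mem_ball_self hη', mem_iInter₂.2 h5⟩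
  obtain ⟨w, ⟨w1, w2⟩, w3⟩ := hW.exists_mem hE hU hy (Metric.isOpen_ball.inter hopen)
    ⟨Metric.mem_ball_self hη', mem_iInter₂.2 h6⟩
  have key : ∀ v ∈ ⋂ A ∈ 𝓛, (K A)ᶜ, v ∈ U \ ⋃₀ 𝓛 → ∀ A ∈ 𝓛, v ∈ D A := by
    intro v hv hv' A hA
    exact (h4 A hA ⟨hv'.1, fun h => hv'.2 ⟨A, hA, h⟩⟩).resolve_right (mem_iInter₂.1 hv A hA)
  have hzw := hM z z3 w w3 fun A hA =>
    (h2 A hA).joined (h3 A hA) (key z z2 z3 A hA) (key w w2 w3 A hA)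
  rw [Metric.mem_ball] at z1 w1
  have t1 := dist_triangle4_right x y z w
  rw [dist_comm] at z1 w1
  linarith

end WebDist

/-! ### Feet of vertical lines and their order -/

namespace Quad

section Foot

variable {X : Type*} [TopologicalSpace X] [T2Space X] {E : Set (Set X)} {Q Q₁ Q₂ Q₁' Q₂' : Quad E}
  {x y z : X} {V W H S : Set X} {s t : ℝ}

/-- A parametrization of the bottom side by the unit interval. -/
noncomputable def botPath (Q : Quad E) : ℝ → X := Q.arc_bot.2.exists_real.choose

theorem continuous_botPath (Q : Quad E) : Continuous Q.botPath :=
  Q.arc_bot.2.exists_real.choose_spec.1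

theorem injOn_botPath (Q : Quad E) : InjOn Q.botPath (Icc 0 1) :=
  Q.arc_bot.2.exists_real.choose_spec.2.1

theorem botPath_zero (Q : Quad E) : Q.botPath 0 = Q.a := Q.arc_bot.2.exists_real.choose_spec.2.2.1

theorem botPath_one (Q : Quad E) : Q.botPath 1 = Q.b := Q.arc_bot.2.exists_real.choose_spec.2.2.2.1

theorem image_botPath (Q : Quad E) : Q.botPath '' Icc 0 1 = Q.bot :=
  Q.arc_bot.2.exists_real.choose_spec.2.2.2.2

theorem botPath_mem (ht : t ∈ Icc (0 : ℝ) 1) : Q.botPath t ∈ Q.bot :=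
  Q.image_botPath ▸ mem_image_of_mem _ ht

/-- The parameter of the lower end point of a vertical line. -/
noncomputable def foot (Q : Quad E) (V : Set X) : ℝ :=
  Classical.epsilon fun t => t ∈ Icc (0 : ℝ) 1 ∧ Q.botPath t ∈ V

theorem Vert.foot_spec (h : Q.Vert V) : Q.foot V ∈ Icc (0 : ℝ) 1 ∧ Q.botPath (Q.foot V) ∈ V := by
  refine Classical.epsilon_spec (p := fun t => t ∈ Icc (0 : ℝ) 1 ∧ Q.botPath t ∈ V) ?_
  obtain ⟨x, y, h1, -, -, -, -, -, h7, -⟩ := h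
  rw [← image_botPath] at h1
  obtain ⟨t, ht, rfl⟩ := h1
  exact ⟨t, ht, h7.2.left_mem⟩

theorem Vert.eq_foot (h : Q.Vert V) (ht : t ∈ Icc (0 : ℝ) 1) (htV : Q.botPath t ∈ V) :
    t = Q.foot V :=
  Q.injOn_botPath ht h.foot_spec.1 (Horiz.eq_of_mem_left (Q := Q.transpose) h htV h.foot_spec.2
    (botPath_mem ht) (botPath_mem h.foot_spec.1))

theorem botPath_mem_of_isPreconnected (hS : IsPreconnected S) (hSb : S ⊆ Q.bot) {r : ℝ}
    (hr : 0 ≤ r) (hrs : r ≤ s) (hst : s ≤ t) (ht : t ≤ 1) (h1 : Q.botPath r ∈ S)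
    (h2 : Q.botPath t ∈ S) : Q.botPath s ∈ S := by
  have himg : Q.botPath '' {t ∈ Icc (0 : ℝ) 1 | Q.botPath t ∈ S} = S := by
    apply Subset.antisymm
    · rintro _ ⟨t, ht, rfl⟩
      exact ht.2
    · intro z hz
      obtain ⟨t, ht, rfl⟩ := Q.image_botPath.superset (hSb hz)
      exact ⟨t, ⟨ht, hz⟩, rfl⟩
  have := isPreconnected_of_image Q.continuous_botPath Q.injOn_botPath (sep_subset _ _)
    (himg.symm ▸ hS)
  exact (this.ordConnected.out ⟨⟨hr, by linarith⟩, h1⟩ ⟨⟨by linarith, ht⟩, h2⟩ ⟨hrs, hst⟩).2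

theorem IsCut.botPath_foot (h : IsCut Q V Q₁ Q₂) : Q.botPath (Q.foot V) = Q₁.b :=
  Horiz.eq_of_mem_left (Q := Q.transpose) h.vert h.vert.foot_spec.2 (h.left_right ▸ b_mem_right)
    (botPath_mem h.vert.foot_spec.1) (h.bot.subset (Or.inl b_mem_bot))

theorem IsCut.botPath_mem_left (h : IsCut Q V Q₁ Q₂) (ht : t ∈ Icc (0 : ℝ) 1)
    (htV : t ≤ Q.foot V) : Q.botPath t ∈ Q₁.cl := by
  refine curve_subset_cl (bot_subset_curve (botPath_mem_of_isPreconnected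
    Q₁.arc_bot.2.isPreconnected (h.bot ▸ subset_union_left) le_rfl ht.1 htV
      h.vert.foot_spec.1.2 ?_ ?_))
  · rw [botPath_zero, ← h.left_a]; exact a_mem_bot
  · rw [h.botPath_foot]; exact b_mem_bot

theorem IsCut.botPath_mem_right (h : IsCut Q V Q₁ Q₂) (ht : t ∈ Icc (0 : ℝ) 1)
    (htV : Q.foot V ≤ t) : Q.botPath t ∈ Q₂.cl := by
  refine curve_subset_cl (bot_subset_curve (botPath_mem_of_isPreconnected
    Q₂.arc_bot.2.isPreconnected (h.bot ▸ subset_union_right) h.vert.foot_spec.1.1 htV ht.2 le_rfl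
      ?_ ?_))
  · rw [h.botPath_foot, h.b_eq]; exact a_mem_bot
  · rw [botPath_one, ← h.right_b]; exact b_mem_bot

theorem IsCut.botPath_notMem_right (hE : Axioms E) (h : IsCut Q V Q₁ Q₂) (ht : t ∈ Icc (0 : ℝ) 1)
    (htV : t < Q.foot V) : Q.botPath t ∉ Q₂.cl := fun h2 =>
  htV.ne (h.vert.eq_foot ht (h.cl_inter hE (h.botPath_mem_left ht htV.le) h2))

theorem IsCut.botPath_notMem_left (hE : Axioms E) (h : IsCut Q V Q₁ Q₂) (ht : t ∈ Icc (0 : ℝ) 1)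
    (htV : Q.foot V < t) : Q.botPath t ∉ Q₁.cl := fun h1 =>
  htV.ne' (h.vert.eq_foot ht (h.cl_inter hE h1 (h.botPath_mem_right ht htV.le)))

theorem IsCut.left_notMem (hE : Axioms E) (h : IsCut Q V Q₁ Q₂) (hz : z ∈ Q.left) : z ∉ Q₂.cl :=
  fun h2 => h.vert.notMem_left
    (h.cl_inter hE (curve_subset_cl (left_subset_curve (h.left_left ▸ hz))) h2) hz

theorem IsCut.right_notMem (hE : Axioms E) (h : IsCut Q V Q₁ Q₂) (hz : z ∈ Q.right) :
    z ∉ Q₁.cl := by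
  have := h.mirror.left_notMem hE hz
  rwa [cl_mirror] at this

/-- Disjoint lines are ordered as their feet: `W` lies in the right part of `V` and `V` in the left
part of `W`. So the closed left part of `V` is contained in the left part of `W`, and a point also
in the right part of `W` would be on both lines. -/
theorem IsCut.foot_lt (hE : Axioms E) (h : IsCut Q V Q₁ Q₂) (h' : IsCut Q W Q₁' Q₂')
    (hd : Disjoint V W) (hlt : Q.foot V < Q.foot W) (hz : z ∈ Q₁.cl) : z ∉ Q₂'.cl := by
  have hdis : ∀ z ∈ V, z ∉ W := fun z h1 h2 => Set.disjoint_left.1 hd h1 h2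
  have fV := h.vert.foot_spec
  have fW := h'.vert.foot_spec
  have hW : W ⊆ Q₂.cl := by
    rcases h.vert_cases hE h'.vert hd with hc | hc
    · exact absurd (hc.subset_cl fW.2) (h.botPath_notMem_left hE fW.1 hlt)
    · exact hc.subset_cl
  have hV : V ⊆ Q₁'.cl := by
    rcases h'.vert_cases hE h.vert hd.symm with hc | hc
    · exact hc.subset_cl
    · exact absurd (hc.subset_cl fV.2) (h'.botPath_notMem_right hE fV.1 hlt)
  have hs : Q₁.dom ⊆ Q₁'.dom ∪ Q₂'.dom := fun z hz =>
    h'.dom.subset ⟨h.dom_left hz, fun hzW => h.dom_notMem_cl hE hz (hW hzW)⟩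
  have hsub : Q₁.cl ⊆ Q₁'.cl := by
    rw [cl_eq hE, cl_eq hE]
    refine closure_mono ((IsPreconnected.subset_or_subset (Q₁'.dom_curve.isOpen hE)
      (Q₂'.dom_curve.isOpen hE) h'.disjoint hs Q₁.dom_curve.isPreconnected).resolve_right
        fun hc => ?_)
    have := closure_mono hc
    rw [← cl_eq hE, ← cl_eq hE] at this
    exact hdis _ fV.2 (h'.cl_inter hE (hV fV.2) (this (h.subset_left fV.2)))
  intro hz'
  have hzW := h'.cl_inter hE (hsub hz) hz'
  exact hdis _ (h.cl_inter hE hz (hW hzW)) hzW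

/-- The two parts into which a vertical line cuts a quadrilateral. -/
noncomputable def sides (Q : Quad E) (V : Set X) : Quad E × Quad E :=
  @Classical.epsilon _ ⟨(Q, Q)⟩ fun P => IsCut Q V P.1 P.2

theorem Vert.isCut (hE : Axioms E) (h : Q.Vert V) : IsCut Q V (Q.sides V).1 (Q.sides V).2 := by
  obtain ⟨Q₁, Q₂, hc⟩ := h.exists_isCut hE
  exact @Classical.epsilon_spec _ (fun P : Quad E × Quad E => IsCut Q V P.1 P.2) ⟨(Q₁, Q₂), hc⟩

end Foot

/-! ### Coordinates from a dense system of lines -/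

section System

variable {X : Type*} [MetricSpace X] [CompactSpace X] {E : Set (Set X)} {Q Q₁ Q₂ : Quad E}
  {x y z : X} {V W H : Set X} {𝒱 ℋ : Set (Set X)} {ε s t : ℝ}

/-- A possibly infinite family of lines that contains finite nets of arbitrarily small mesh. -/
structure System (Q : Quad E) (𝒱 ℋ : Set (Set X)) : Prop where
  vert : ∀ V ∈ 𝒱, Q.Vert V
  horiz : ∀ H ∈ ℋ, Q.Horiz H
  disjoint_vert : ∀ V ∈ 𝒱, ∀ W ∈ 𝒱, V ≠ W → Disjoint V W
  disjoint_horiz : ∀ V ∈ ℋ, ∀ W ∈ ℋ, V ≠ W → Disjoint V W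
  meet : ∀ V ∈ 𝒱, ∀ H ∈ ℋ, ∃ z, V ∩ H = {z}
  mesh : ∀ ε > 0, ∃ 𝒱' ⊆ 𝒱, ∃ ℋ' ⊆ ℋ, 𝒱'.Finite ∧ ℋ'.Finite ∧ Mesh Q.dom (𝒱' ∪ ℋ') ε

theorem exists_system (hE : Axioms E) (Q : Quad E) : ∃ 𝒱 ℋ, System Q 𝒱 ℋ := by
  obtain ⟨𝒱, ℋ, m1, m2, hN, hM⟩ := Q.exists_seq hE
  refine ⟨⋃ n, 𝒱 n, ⋃ n, ℋ n, ?_, ?_, ?_, ?_, ?_, ?_⟩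
  · intro V hV
    obtain ⟨n, hn⟩ := mem_iUnion.1 hV
    exact (hN n).vert V hn
  · intro V hV
    obtain ⟨n, hn⟩ := mem_iUnion.1 hV
    exact (hN n).horiz V hn
  · intro V hV W hW
    obtain ⟨n, hn⟩ := mem_iUnion.1 hV
    obtain ⟨k, hk⟩ := mem_iUnion.1 hW
    exact (hN (max n k)).disjoint_vert V (m1 (le_max_left _ _) hn) W (m1 (le_max_right _ _) hk)
  · intro V hV W hW
    obtain ⟨n, hn⟩ := mem_iUnion.1 hV
    obtain ⟨k, hk⟩ := mem_iUnion.1 hW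
    exact (hN (max n k)).disjoint_horiz V (m2 (le_max_left _ _) hn) W (m2 (le_max_right _ _) hk)
  · intro V hV W hW
    obtain ⟨n, hn⟩ := mem_iUnion.1 hV
    obtain ⟨k, hk⟩ := mem_iUnion.1 hW
    exact (hN (max n k)).meet V (m1 (le_max_left _ _) hn) W (m2 (le_max_right _ _) hk)
  · intro ε hε
    obtain ⟨n, hn⟩ := exists_nat_one_div_lt hε
    exact ⟨𝒱 n, subset_iUnion _ n, ℋ n, subset_iUnion _ n, (hN n).finite_vert,
      (hN n).finite_horiz, fun x hx y hy h => (hM n x hx y hy h).trans hn.le⟩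

theorem System.transpose (h : System Q 𝒱 ℋ) : System Q.transpose ℋ 𝒱 where
  vert := h.horiz
  horiz := h.vert
  disjoint_vert := h.disjoint_horiz
  disjoint_horiz := h.disjoint_vert
  meet V hV H hH := by rw [inter_comm]; exact h.meet H hH V hV
  mesh ε hε := by
    obtain ⟨𝒱', h1, ℋ', h2, h3, h4, h5⟩ := h.mesh ε hε
    exact ⟨ℋ', h2, 𝒱', h1, h4, h3, by rw [union_comm]; exact h5⟩

theorem System.net (h : System Q 𝒱 ℋ) {𝒱' ℋ' : Set (Set X)} (h1 : 𝒱' ⊆ 𝒱) (h2 : ℋ' ⊆ ℋ)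
    (h3 : 𝒱'.Finite) (h4 : ℋ'.Finite) : Net Q 𝒱' ℋ' :=
  ⟨h3, h4, fun V hV => h.vert V (h1 hV), fun V hV => h.horiz V (h2 hV),
    fun V hV W hW => h.disjoint_vert V (h1 hV) W (h1 hW),
    fun V hV W hW => h.disjoint_horiz V (h2 hV) W (h2 hW),
    fun V hV W hW => h.meet V (h1 hV) W (h2 hW)⟩

/-- `x` and `y` lie on the same side of `V`, and not on `V`. -/
def SameSide (Q : Quad E) (V : Set X) (x y : X) : Prop :=
  (x ∉ (Q.sides V).1.cl ∧ y ∉ (Q.sides V).1.cl) ∨ (x ∉ (Q.sides V).2.cl ∧ y ∉ (Q.sides V).2.cl)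

theorem SameSide.exists_sets (hE : Axioms E) (hV : Q.Vert V) (h : Q.SameSide V x y) :
    ∃ D K : Set X, IsClosed K ∧ IsPreconnected D ∧ D ⊆ Q.dom \ V ∧ Q.dom \ V ⊆ D ∪ K ∧ x ∉ K ∧
      y ∉ K := by
  have hc := hV.isCut hE
  rw [hc.dom]
  rcases h with h | h
  · exact ⟨_, _, isClosed_cl hE _, (Q.sides V).2.dom_curve.isPreconnected, subset_union_right,
      union_subset (dom_subset_cl.trans subset_union_right) subset_union_left, h⟩
  · exact ⟨_, _, isClosed_cl hE _, (Q.sides V).1.dom_curve.isPreconnected, subset_union_left,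
      union_subset subset_union_left (dom_subset_cl.trans subset_union_right), h⟩

theorem Net.dist_le (hE : Axioms E) (hN : Net Q 𝒱 ℋ) (hM : Mesh Q.dom (𝒱 ∪ ℋ) ε) (hx : x ∈ Q.cl)
    (hy : y ∈ Q.cl) (hV : ∀ V ∈ 𝒱, Q.SameSide V x y)
    (hH : ∀ H ∈ ℋ, Q.transpose.SameSide H x y) : dist x y ≤ ε := by
  rw [cl_eq hE] at hx hy
  refine (hN.web hE).dist_le hE Q.dom_curve hM hx hy ?_
  rintro A (hA | hA)
  · exact (hV A hA).exists_sets hE (hN.vert A hA)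
  · exact SameSide.exists_sets (Q := Q.transpose) hE (hN.horiz A hA) (hH A hA)

/-- With no foot between `s` and `t`, two different bottom points with parameters in between would
lie on the same side of every vertical line. Horizontal lines do not touch the bottom, so the mesh
would bound their distance by half of itself. -/
theorem System.exists_foot (hE : Axioms E) (h : System Q 𝒱 ℋ) (hs : 0 ≤ s) (hst : s < t)
    (ht : t ≤ 1) : ∃ V ∈ 𝒱, s < Q.foot V ∧ Q.foot V < t := by
  by_contra! hc
  obtain ⟨s', h1, h2⟩ := exists_between hst
  obtain ⟨t', h3, h4⟩ := exists_between h2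
  have ms : s' ∈ Icc (0 : ℝ) 1 := ⟨by linarith, by linarith⟩
  have mt : t' ∈ Icc (0 : ℝ) 1 := ⟨by linarith, by linarith⟩
  have hne : Q.botPath s' ≠ Q.botPath t' := fun he => h3.ne (Q.injOn_botPath ms mt he)
  have hpos := dist_pos.2 hne
  obtain ⟨𝒱', k1, ℋ', k2, k3, k4, k5⟩ := h.mesh _ (half_pos hpos)
  have := (h.net k1 k2 k3 k4).dist_le hE k5
    (curve_subset_cl (bot_subset_curve (botPath_mem ms)))
    (curve_subset_cl (bot_subset_curve (botPath_mem mt))) (fun V hV => ?_) fun H hH => ?_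
  · linarith
  · have hcut := (h.vert V (k1 hV)).isCut hE
    by_cases hV' : s < Q.foot V
    · have := hc V (k1 hV) hV'
      exact Or.inr ⟨hcut.botPath_notMem_right hE ms (by linarith),
        hcut.botPath_notMem_right hE mt (by linarith)⟩
    · push Not at hV'
      exact Or.inl ⟨hcut.botPath_notMem_left hE ms (by linarith),
        hcut.botPath_notMem_left hE mt (by linarith)⟩
  · have hcut := Vert.isCut (Q := Q.transpose) hE (h.horiz H (k2 hH))
    exact Or.inr ⟨hcut.left_notMem hE (botPath_mem ms), hcut.left_notMem hE (botPath_mem mt)⟩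

/-- The horizontal coordinate determined by a family of vertical lines. -/
noncomputable def coord (Q : Quad E) (𝒱 : Set (Set X)) (x : X) : ℝ :=
  -- The inserted 0 keeps the set nonempty also for points that have no line on their left.
  sSup (insert 0 (Q.foot '' {V ∈ 𝒱 | x ∈ (Q.sides V).2.cl}))

theorem System.coord_bound (h : System Q 𝒱 ℋ) :
    ∀ r ∈ insert 0 (Q.foot '' {V ∈ 𝒱 | x ∈ (Q.sides V).2.cl}), r ≤ 1 := by
  rintro _ (rfl | ⟨V, hV, rfl⟩)
  exacts [zero_le_one, (h.vert V hV.1).foot_spec.1.2]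

theorem System.coord_mem (h : System Q 𝒱 ℋ) : Q.coord 𝒱 x ∈ Icc (0 : ℝ) 1 :=
  ⟨le_csSup ⟨1, h.coord_bound⟩ (mem_insert _ _), csSup_le (insert_nonempty _ _) h.coord_bound⟩

theorem System.foot_le_coord (h : System Q 𝒱 ℋ) (hV : V ∈ 𝒱) (hx : x ∈ (Q.sides V).2.cl) :
    Q.foot V ≤ Q.coord 𝒱 x :=
  le_csSup ⟨1, h.coord_bound⟩ (Or.inr ⟨V, ⟨hV, hx⟩, rfl⟩)

theorem System.coord_le_foot (hE : Axioms E) (h : System Q 𝒱 ℋ) (hV : V ∈ 𝒱)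
    (hx : x ∈ (Q.sides V).1.cl) : Q.coord 𝒱 x ≤ Q.foot V := by
  refine csSup_le (insert_nonempty _ _) ?_
  rintro _ (rfl | ⟨W, ⟨hW, hxW⟩, rfl⟩)
  · exact (h.vert V hV).foot_spec.1.1
  · by_contra! hlt
    have hne : V ≠ W := by rintro rfl; exact hlt.false
    exact ((h.vert V hV).isCut hE).foot_lt hE ((h.vert W hW).isCut hE)
      (h.disjoint_vert V hV W hW hne) hlt hx hxW

theorem System.coord_eq_foot (hE : Axioms E) (h : System Q 𝒱 ℋ) (hV : V ∈ 𝒱) (hx : x ∈ V) :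
    Q.coord 𝒱 x = Q.foot V :=
  have hc := (h.vert V hV).isCut hE
  le_antisymm (h.coord_le_foot hE hV (hc.subset_left hx)) (h.foot_le_coord hV (hc.subset_right hx))

theorem System.mem_cases (hE : Axioms E) (h : System Q 𝒱 ℋ) (hV : V ∈ 𝒱) (hx : x ∈ Q.cl) :
    x ∈ (Q.sides V).1.cl ∨ x ∈ (Q.sides V).2.cl := ((h.vert V hV).isCut hE).cl.subset hx

/-- Between a bound and the coordinate of `x` there is a line with foot strictly in between. The
point `x` is off one closed side of that line, hence so are nearby points, and they satisfy the same
bound. -/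
theorem System.continuousOn_coord (hE : Axioms E) (h : System Q 𝒱 ℋ) :
    ContinuousOn (Q.coord 𝒱) Q.cl := by
  intro x hx
  refine tendsto_order.2 ⟨fun s hs => ?_, fun t ht => ?_⟩
  · by_cases hs0 : s < 0
    · exact Filter.Eventually.of_forall fun y => hs0.trans_le h.coord_mem.1
    push Not at hs0
    obtain ⟨V, hV, h1, h2⟩ := h.exists_foot hE hs0 hs h.coord_mem.2
    have hxV : x ∉ (Q.sides V).1.cl := fun hxV => h2.not_ge (h.coord_le_foot hE hV hxV)
    filter_upwards [mem_nhdsWithin_of_mem_nhds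
      ((isClosed_cl hE (Q.sides V).1).isOpen_compl.mem_nhds hxV), self_mem_nhdsWithin] with y hy hyQ
    exact h1.trans_le (h.foot_le_coord hV ((h.mem_cases hE hV hyQ).resolve_left hy))
  · by_cases ht1 : 1 < t
    · exact Filter.Eventually.of_forall fun y => h.coord_mem.2.trans_lt ht1
    push Not at ht1
    obtain ⟨V, hV, h1, h2⟩ := h.exists_foot hE h.coord_mem.1 ht ht1
    have hxV : x ∉ (Q.sides V).2.cl := fun hxV => h1.not_ge (h.foot_le_coord hV hxV)
    filter_upwards [mem_nhdsWithin_of_mem_nhds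
      ((isClosed_cl hE (Q.sides V).2).isOpen_compl.mem_nhds hxV), self_mem_nhdsWithin] with y hy hyQ
    exact (h.coord_le_foot hE hV ((h.mem_cases hE hV hyQ).resolve_right hy)).trans_lt h2

theorem System.coord_left (hE : Axioms E) (h : System Q 𝒱 ℋ) (hx : x ∈ Q.left) :
    Q.coord 𝒱 x = 0 := by
  refine le_antisymm (csSup_le (insert_nonempty _ _) ?_) h.coord_mem.1
  rintro _ (rfl | ⟨V, ⟨hV, hxV⟩, rfl⟩)
  · exact le_rfl
  · exact absurd hxV (((h.vert V hV).isCut hE).left_notMem hE hx)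

theorem System.coord_right (hE : Axioms E) (h : System Q 𝒱 ℋ) (hx : x ∈ Q.right) :
    Q.coord 𝒱 x = 1 := by
  by_contra hne
  obtain ⟨V, hV, h1, h2⟩ := h.exists_foot hE h.coord_mem.1 (lt_of_le_of_ne h.coord_mem.2 hne) le_rfl
  refine h1.not_ge (h.foot_le_coord hV ((h.mem_cases hE hV
    (curve_subset_cl (right_subset_curve hx))).resolve_left ?_))
  exact ((h.vert V hV).isCut hE).right_notMem hE hx

theorem System.sameSide (hE : Axioms E) (h : System Q 𝒱 ℋ) (hV : V ∈ 𝒱)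
    (hxy : Q.coord 𝒱 x = Q.coord 𝒱 y) (hne : Q.foot V ≠ Q.coord 𝒱 x) : Q.SameSide V x y := by
  rcases hne.lt_or_gt with hlt | hlt
  · exact Or.inl ⟨fun hx => hlt.not_ge (h.coord_le_foot hE hV hx),
      fun hx => (hxy ▸ hlt).not_ge (h.coord_le_foot hE hV hx)⟩
  · exact Or.inr ⟨fun hx => hlt.not_ge (h.foot_le_coord hV hx),
      fun hx => (hxy ▸ hlt).not_ge (h.foot_le_coord hV hx)⟩

theorem System.subsingleton_foot (h : System Q 𝒱 ℋ) (r : ℝ) :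
    {V ∈ 𝒱 | Q.foot V = r}.Subsingleton := by
  intro V hV W hW
  by_contra hne
  refine Set.disjoint_left.1 (h.disjoint_vert V hV.1 W hW.1 hne) (h.vert V hV.1).foot_spec.2 ?_
  rw [hV.2, ← hW.2]
  exact (h.vert W hW.1).foot_spec.2

/-- A line whose foot differs from the common coordinate has both points strictly on one side. At
most one vertical and one horizontal line are exceptional; removing them multiplies the mesh by at
most 4, whence the choice `ε / 4`. -/
theorem System.eq_of_coord_eq (hE : Axioms E) (h : System Q 𝒱 ℋ) (hx : x ∈ Q.cl) (hy : y ∈ Q.cl)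
    (h1 : Q.coord 𝒱 x = Q.coord 𝒱 y) (h2 : Q.transpose.coord ℋ x = Q.transpose.coord ℋ y) :
    x = y := by
  rw [← dist_le_zero]
  refine le_of_forall_pos_le_add fun ε hε => ?_
  rw [zero_add]
  obtain ⟨𝒱', k1, ℋ', k2, k3, k4, k5⟩ := h.mesh (ε / 4) (by positivity)
  have hW := (h.net k1 k2 k3 k4).web hE
  have m1 := k5.diff hE Q.dom_curve hW (by positivity) (h.subsingleton_foot (Q.coord 𝒱 x))
  have m2 := m1.diff hE Q.dom_curve (hW.mono sdiff_subset) (by positivity)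
    (h.transpose.subsingleton_foot (Q.transpose.coord ℋ x))
  rw [show 2 * (2 * (ε / 4)) = ε by ring] at m2
  set 𝒱'' := {V ∈ 𝒱' | Q.foot V ≠ Q.coord 𝒱 x} with h𝒱
  set ℋ'' := {H ∈ ℋ' | Q.transpose.foot H ≠ Q.transpose.coord ℋ x} with hℋ
  have s1 : 𝒱'' ⊆ 𝒱' := sep_subset _ _
  have s2 : ℋ'' ⊆ ℋ' := sep_subset _ _
  refine (h.net (s1.trans k1) (s2.trans k2) (k3.subset s1) (k4.subset s2)).dist_le hE
    (m2.mono ?_) hx hy (fun V hV => h.sameSide hE (k1 hV.1) h1 hV.2)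
    (fun V hV => h.transpose.sameSide hE (k2 hV.1) h2 hV.2)
  rintro A ⟨⟨hA | hA, hn1⟩, hn2⟩
  · exact Or.inl ⟨hA, fun he => hn1 ⟨k1 hA, he⟩⟩
  · exact Or.inr ⟨hA, fun he => hn2 ⟨k2 hA, he⟩⟩

/-- Every pair of coordinates occurs. -/
theorem System.exists_coord_eq (hE : Axioms E) (h : System Q 𝒱 ℋ) (hs : s ∈ Icc (0 : ℝ) 1)
    (ht : t ∈ Icc (0 : ℝ) 1) : ∃ x ∈ Q.cl, Q.coord 𝒱 x = s ∧ Q.transpose.coord ℋ x = t := by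
  set F : X → ℝ × ℝ := fun x => (Q.coord 𝒱 x, Q.transpose.coord ℋ x) with hF
  have hc : ContinuousOn F Q.cl := (h.continuousOn_coord hE).prodMk
    (cl_transpose (Q := Q) ▸ h.transpose.continuousOn_coord hE)
  have hcl : IsClosed (F '' Q.cl) :=
    ((isClosed_cl hE Q).isCompact.image_of_continuousOn hc).isClosed
  -- The image of the closed quadrilateral is compact, so density is enough. A crossing of two lines
  -- has their feet as its coordinates, and feet come arbitrarily close to any parameter.
  have near : ∀ {Q : Quad E} {𝒱 ℋ : Set (Set X)}, System Q 𝒱 ℋ → ∀ s ∈ Icc (0 : ℝ) 1, ∀ ε > 0,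
      ∃ V ∈ 𝒱, |Q.foot V - s| < ε := by
    intro Q 𝒱 ℋ h s hs ε hε
    rcases hs.2.lt_or_eq with h1 | h1
    · obtain ⟨V, hV, k1, k2⟩ := h.exists_foot hE hs.1
        (lt_min h1 (lt_add_of_pos_right s hε)) (min_le_left _ _)
      exact ⟨V, hV, abs_lt.2 ⟨by linarith, by linarith [k2.trans_le (min_le_right _ _)]⟩⟩
    · obtain ⟨V, hV, k1, k2⟩ := h.exists_foot hE (le_max_left 0 (s - ε))
        (max_lt (h1 ▸ zero_lt_one) (sub_lt_self s hε)) hs.2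
      exact ⟨V, hV, abs_lt.2 ⟨by linarith [(le_max_right 0 (s - ε)).trans_lt k1], by linarith⟩⟩
  have hmem : (s, t) ∈ closure (F '' Q.cl) := by
    rw [Metric.mem_closure_iff]
    intro ε hε
    obtain ⟨V, hV, hVs⟩ := near h s hs ε hε
    obtain ⟨H, hH, hHt⟩ := near h.transpose t ht ε hε
    obtain ⟨z, hz⟩ := h.meet V hV H hH
    have hz' : z ∈ V ∩ H := hz.superset rfl
    refine ⟨F z, mem_image_of_mem F ((h.vert V hV).subset_cl hz'.1), ?_⟩
    rw [Prod.dist_eq]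
    simp only [hF, Real.dist_eq]
    rw [h.coord_eq_foot hE hV hz'.1, h.transpose.coord_eq_foot hE hH hz'.2]
    rw [abs_sub_comm, abs_sub_comm t]
    exact max_lt hVs hHt
  rw [hcl.closure_eq] at hmem
  obtain ⟨x, hx, he⟩ := hmem
  exact ⟨x, hx, congrArg Prod.fst he, congrArg Prod.snd he⟩

end System

end Quad


/-! ### Closed elementary domains are discs -/

section Disc

variable {X : Type*} [MetricSpace X] [CompactSpace X] {E : Set (Set X)} {Q : Quad E} {x : X}
  {J U S : Set X} {𝒱 ℋ : Set (Set X)} {t : ℝ}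

/-- On the bottom and on the top side the coordinate runs continuously from 0 to 1. With the
transposed statement this shows that the boundary curve covers the frontier of the square. -/
theorem Quad.System.exists_left (hE : Axioms E) (h : Quad.System Q 𝒱 ℋ) (ht : t ∈ Icc (0 : ℝ) 1) :
    (∃ x ∈ Q.bot, Q.coord 𝒱 x = t) ∧ ∃ x ∈ Q.top, Q.coord 𝒱 x = t := by
  have hc := h.continuousOn_coord hE
  have key : ∀ S ⊆ Q.curve, IsPreconnected S → ∀ u ∈ S, ∀ v ∈ S, Q.coord 𝒱 u = 0 →
      Q.coord 𝒱 v = 1 → ∃ x ∈ S, Q.coord 𝒱 x = t := by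
    intro S hS hSc u hu v hv h0 h1
    have := hSc.intermediate_value hu hv (hc.mono (hS.trans Quad.curve_subset_cl))
    rw [h0, h1] at this
    exact this ht
  exact ⟨key _ Quad.bot_subset_curve Q.arc_bot.2.isPreconnected _ Quad.a_mem_bot _ Quad.b_mem_bot
      (h.coord_left hE Quad.a_mem_left) (h.coord_right hE Quad.b_mem_right),
    key _ Quad.top_subset_curve Q.arc_top.2.isPreconnected _ Quad.d_mem_top _ Quad.c_mem_top
      (h.coord_left hE Quad.d_mem_left) (h.coord_right hE Quad.c_mem_right)⟩

/-- A closed elementary quadrilateral is a closed square. -/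
theorem Quad.exists_square (hE : Axioms E) (Q : Quad E) : ∃ φ : X → ℂ, ContinuousOn φ Q.cl ∧
    InjOn φ Q.cl ∧ φ '' Q.cl = Icc 0 1 ×ℂ Icc 0 1 ∧
    φ '' Q.curve = frontier (Icc 0 1 ×ℂ Icc 0 1) := by
  obtain ⟨𝒱, ℋ, h⟩ := Q.exists_system hE
  have h' := h.transpose
  refine ⟨fun x => Complex.equivRealProdCLM.symm (Q.coord 𝒱 x, Q.transpose.coord ℋ x), ?_, ?_, ?_,
    ?_⟩
  · exact Complex.equivRealProdCLM.symm.continuous.comp_continuousOn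
      ((h.continuousOn_coord hE).prodMk (cl_transpose (Q := Q) ▸ h'.continuousOn_coord hE))
  · intro x hx y hy hxy
    have := Complex.equivRealProdCLM.symm.injective hxy
    exact h.eq_of_coord_eq hE hx hy (congrArg Prod.fst this) (congrArg Prod.snd this)
  · apply Subset.antisymm
    · rintro _ ⟨x, -, rfl⟩
      exact ⟨h.coord_mem, h'.coord_mem⟩
    · rintro z ⟨hz1, hz2⟩
      obtain ⟨x, hx, e1, e2⟩ := h.exists_coord_eq hE hz1 hz2
      exact ⟨x, hx, Complex.ext e1 e2⟩
  · rw [Complex.frontier_reProdIm, frontier_Icc zero_le_one, closure_Icc]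
    apply Subset.antisymm
    · rintro _ ⟨x, ((hx | hx) | hx) | hx, rfl⟩
      · exact Or.inl ⟨h.coord_mem, Or.inl (h'.coord_left hE hx)⟩
      · exact Or.inr ⟨Or.inr (h.coord_right hE hx), h'.coord_mem⟩
      · exact Or.inl ⟨h.coord_mem, Or.inr (h'.coord_right hE hx)⟩
      · exact Or.inr ⟨Or.inl (h.coord_left hE hx), h'.coord_mem⟩
    · rintro z (⟨hz1, hz2 | hz2⟩ | ⟨hz1 | hz1, hz2⟩)
      · obtain ⟨x, hx, e⟩ := (h.exists_left hE hz1).1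
        exact ⟨x, Quad.bot_subset_curve hx, Complex.ext e ((h'.coord_left hE hx).trans hz2.symm)⟩
      · obtain ⟨x, hx, e⟩ := (h.exists_left hE hz1).2
        exact ⟨x, Quad.top_subset_curve hx, Complex.ext e ((h'.coord_right hE hx).trans hz2.symm)⟩
      · obtain ⟨x, hx, e⟩ := (h'.exists_left hE hz2).1
        exact ⟨x, Quad.left_subset_curve hx, Complex.ext ((h.coord_left hE hx).trans hz1.symm) e⟩
      · obtain ⟨x, hx, e⟩ := (h'.exists_left hE hz2).2
        exact ⟨x, Quad.right_subset_curve hx, Complex.ext ((h.coord_right hE hx).trans hz1.symm) e⟩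

/-- Any four points of the curve in circular order serve as vertices: two base points of a loop and
an inner point of each of its arcs. -/
theorem Dom.exists_quad (hE : Axioms E) (h : Dom E J U) :
    ∃ Q : Quad E, Q.curve = J ∧ Q.dom = U := by
  obtain ⟨γ, hγ, hr⟩ := h.1.1
  have hpi := Real.pi_pos
  obtain ⟨A, B, hl, rfl⟩ := h.1.exists_loop (p := γ (Circle.exp 0)) (q := γ (Circle.exp Real.pi))
    (hr ▸ mem_range_self _) (hr ▸ mem_range_self _) fun he => by
      have := circle_exp_injOn 0 ⟨le_rfl, by linarith⟩ ⟨hpi.le, by linarith⟩ (hγ.injective he)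
      linarith
  set p := γ (Circle.exp 0)
  set q := γ (Circle.exp Real.pi)
  obtain ⟨x, hx, hxn⟩ := hl.left.2.nonempty_diff
  obtain ⟨y, hy, hyn⟩ := hl.right.2.nonempty_diff
  simp only [mem_insert_iff, mem_singleton_iff, not_or] at hxn hyn
  obtain ⟨A₁, A₂, a1, a2, aun, ain⟩ := hl.left.split hE.family hx hxn.1 hxn.2
  obtain ⟨B₁, B₂, b1, b2, bun, bin⟩ := hl.right.split hE.family hy hyn.1 hyn.2
  have sA1 : A₁ ⊆ A := aun ▸ subset_union_left
  have sA2 : A₂ ⊆ A := aun ▸ subset_union_right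
  have sB1 : B₁ ⊆ B := bun ▸ subset_union_left
  have sB2 : B₂ ⊆ B := bun ▸ subset_union_right
  have pA2 : p ∉ A₂ := fun h => hxn.1 (ain.subset ⟨a1.2.left_mem, h⟩).symm
  have qA1 : q ∉ A₁ := fun h => hxn.2 (ain.subset ⟨h, a2.2.right_mem⟩).symm
  have pB2 : p ∉ B₂ := fun h => hyn.1 (bin.subset ⟨b1.2.left_mem, h⟩).symm
  have qB1 : q ∉ B₁ := fun h => hyn.2 (bin.subset ⟨h, b2.2.right_mem⟩).symm
  have hAB : ∀ z ∈ A, z ∈ B → z = p ∨ z = q := fun z h1 h2 => hl.inter.subset ⟨h1, h2⟩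
  have e : A₁ ∪ A₂ ∪ B₂ ∪ B₁ = A ∪ B := by
    rw [aun, union_assoc, union_comm B₂, bun]
  refine ⟨⟨p, x, q, y, A₁, A₂, B₂, B₁, U, a1, a2, b2, b1, ain, ?_, ?_, ?_, ?_, ?_, ?_⟩, e, rfl⟩
  · refine Subset.antisymm ?_ (singleton_subset_iff.2 ⟨a2.2.right_mem, b2.2.right_mem⟩)
    exact fun z hz => (hAB z (sA2 hz.1) (sB2 hz.2)).resolve_left fun h => pA2 (h ▸ hz.1)
  · rw [inter_comm]; exact bin
  · refine Subset.antisymm ?_ (singleton_subset_iff.2 ⟨b1.2.left_mem, a1.2.left_mem⟩)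
    exact fun z hz => (hAB z (sA1 hz.2) (sB1 hz.1)).resolve_right fun h => qA1 (h ▸ hz.2)
  · refine Set.disjoint_left.2 fun z h1 h2 => ?_
    rcases hAB z (sA1 h1) (sB2 h2) with h | h
    exacts [pB2 (h ▸ h2), qA1 (h ▸ h1)]
  · refine Set.disjoint_left.2 fun z h1 h2 => ?_
    rcases hAB z (sA2 h2) (sB1 h1) with h | h
    exacts [pA2 (h ▸ h2), qB1 (h ▸ h1)]
  · exact e ▸ h

/-- The closure of an elementary domain is a closed disc. -/
theorem Dom.exists_disc (hE : Axioms E) (h : Dom E J U) : ∃ φ : X → ℂ,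
    ContinuousOn φ (closure U) ∧ InjOn φ (closure U) ∧ φ '' closure U = Metric.closedBall 0 1 ∧
    φ '' J = Metric.sphere 0 1 := by
  obtain ⟨Q, rfl, rfl⟩ := h.exists_quad hE
  obtain ⟨φ, h1, h2, h3, h4⟩ := Q.exists_square hE
  have hclosed : closure (Icc (0 : ℝ) 1 ×ℂ Icc (0 : ℝ) 1) = Icc 0 1 ×ℂ Icc 0 1 := by
    rw [Complex.closure_reProdIm, closure_Icc]
  -- The square is a bounded convex set with nonempty interior, so a homeomorphism of the plane
  -- carries it to the unit disc and its frontier to the circle.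
  obtain ⟨F, -, F2, F3⟩ := exists_homeomorph_image_interior_closure_frontier_eq_unitBall
    (s := Icc (0 : ℝ) 1 ×ℂ Icc (0 : ℝ) 1)
    (((convex_Icc 0 1).linear_preimage Complex.reLm).inter
      ((convex_Icc 0 1).linear_preimage Complex.imLm))
    (by
      rw [Complex.interior_reProdIm, interior_Icc]
      exact ⟨⟨1 / 2, 1 / 2⟩, by norm_num [Complex.mem_reProdIm]⟩)
    ((Metric.isBounded_Icc 0 1).reProdIm (Metric.isBounded_Icc 0 1))
  rw [hclosed] at F2
  rw [← Q.cl_eq hE]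
  refine ⟨F ∘ φ, F.continuous.comp_continuousOn h1, F.injective.comp_injOn h2, ?_, ?_⟩
  · rw [image_comp, h3, F2]
  · rw [image_comp, h4, F3]

end Disc

/-! ### Gluing two discs to a sphere -/

section Glue

variable {X : Type*} [TopologicalSpace X] [T2Space X] {A B K : Set X} {φ ψ : X → ℂ}

theorem _root_.IsCompact.continuousOn_invFunOn [Nonempty X] {Y : Type*} [TopologicalSpace Y]
    [T2Space Y] {f : X → Y} (hK : IsCompact K) (hc : ContinuousOn f K) (hi : InjOn f K) :
    ContinuousOn (Function.invFunOn f K) (f '' K) := by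
  rw [continuousOn_iff_isClosed]
  intro C hC
  refine ⟨f '' (K ∩ C), ((hK.inter_right hC).image_of_continuousOn
    (hc.mono inter_subset_left)).isClosed, ?_⟩
  ext z
  constructor
  · rintro ⟨h1, x, hx, rfl⟩
    have := hi.leftInvOn_invFunOn hx
    rw [mem_preimage, this] at h1
    exact ⟨⟨x, ⟨hx, h1⟩, rfl⟩, x, hx, rfl⟩
  · rintro ⟨⟨x, hx, rfl⟩, h⟩
    refine ⟨?_, h⟩
    rw [mem_preimage, hi.leftInvOn_invFunOn hx.1]
    exact hx.2

/-- Radial extension of a self-map of the unit circle. -/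
noncomputable def radial (η : ℂ → ℂ) (z : ℂ) : ℂ := ‖z‖ * η (z / ‖z‖)

variable {η : ℂ → ℂ} {z w : ℂ}

theorem div_norm_mem_sphere (hz : z ≠ 0) : z / ‖z‖ ∈ Metric.sphere (0 : ℂ) 1 := by
  rw [mem_sphere_zero_iff_norm, norm_div, Complex.norm_real, norm_norm,
    div_self (norm_ne_zero_iff.2 hz)]

theorem norm_radial (hm : MapsTo η (Metric.sphere 0 1) (Metric.sphere 0 1)) :
    ‖radial η z‖ = ‖z‖ := by
  by_cases hz : z = 0
  · simp [hz, radial]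
  · rw [radial, norm_mul, Complex.norm_real, norm_norm,
      mem_sphere_zero_iff_norm.1 (hm (div_norm_mem_sphere hz)), mul_one]

theorem radial_of_norm (hz : ‖z‖ = 1) : radial η z = η z := by
  simp [radial, hz]

/-- The radial extension preserves the norm, which gives continuity at the origin, where the angle
is undefined. -/
theorem continuous_radial (hc : ContinuousOn η (Metric.sphere 0 1))
    (hm : MapsTo η (Metric.sphere 0 1) (Metric.sphere 0 1)) : Continuous (radial η) := by
  rw [continuous_iff_continuousAt]
  intro z
  by_cases hz : z = 0
  · subst hz
    rw [ContinuousAt, show radial η 0 = 0 by simp [radial], tendsto_zero_iff_norm_tendsto_zero]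
    simp only [norm_radial hm]
    simpa using (continuous_norm (E := ℂ)).tendsto 0
  · have ho : IsOpen ({0}ᶜ : Set ℂ) := isOpen_compl_singleton
    refine ContinuousOn.continuousAt ?_ (ho.mem_nhds hz)
    have hn : ContinuousOn (fun z : ℂ => (‖z‖ : ℂ)) {0}ᶜ :=
      (Complex.continuous_ofReal.comp continuous_norm).continuousOn
    refine hn.mul (hc.comp (continuousOn_id.div hn fun w hw => ?_) fun w hw =>
      div_norm_mem_sphere hw)
    exact Complex.ofReal_ne_zero.2 (norm_ne_zero_iff.2 hw)

theorem injective_radial (hi : InjOn η (Metric.sphere 0 1))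
    (hm : MapsTo η (Metric.sphere 0 1) (Metric.sphere 0 1)) : Function.Injective (radial η) := by
  intro z w h
  have hn : ‖z‖ = ‖w‖ := by rw [← norm_radial hm, h, norm_radial hm]
  by_cases hz : z = 0
  · rw [hz, eq_comm, ← norm_eq_zero, ← hn, hz, norm_zero]
  have hw : w ≠ 0 := norm_ne_zero_iff.1 (hn ▸ norm_ne_zero_iff.2 hz)
  have hz' : (‖w‖ : ℂ) ≠ 0 := Complex.ofReal_ne_zero.2 (norm_ne_zero_iff.2 hw)
  rw [radial, radial, hn] at h
  have h2 := hi (hn ▸ div_norm_mem_sphere hz) (div_norm_mem_sphere hw) (mul_left_cancel₀ hz' h)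
  exact (div_left_inj' hz').1 h2

theorem image_radial (hs : η '' Metric.sphere 0 1 = Metric.sphere 0 1) :
    radial η '' Metric.closedBall 0 1 = Metric.closedBall 0 1 := by
  have hm : MapsTo η (Metric.sphere 0 1) (Metric.sphere 0 1) := fun z hz =>
    hs ▸ mem_image_of_mem η hz
  apply Subset.antisymm
  · rintro _ ⟨z, hz, rfl⟩
    rw [mem_closedBall_zero_iff, norm_radial hm]
    exact mem_closedBall_zero_iff.1 hz
  · intro w hw
    by_cases hw0 : w = 0
    · exact ⟨0, by simp, by simp [radial, hw0]⟩
    obtain ⟨u, hu, hu'⟩ := hs.superset (div_norm_mem_sphere hw0)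
    have hu1 := mem_sphere_zero_iff_norm.1 hu
    have hz' : (‖w‖ : ℂ) ≠ 0 := Complex.ofReal_ne_zero.2 (norm_ne_zero_iff.2 hw0)
    have hn : ‖(‖w‖ * u : ℂ)‖ = ‖w‖ := by
      rw [norm_mul, Complex.norm_real, norm_norm, hu1, mul_one]
    refine ⟨‖w‖ * u, ?_, ?_⟩
    · rw [mem_closedBall_zero_iff, hn]
      exact mem_closedBall_zero_iff.1 hw
    · rw [radial, hn, mul_div_cancel_left₀ _ hz', hu', mul_div_cancel₀ _ hz']

/-- Two discs can be parametrized so that the parametrizations agree on a common boundary. -/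
theorem exists_adjusted_disc (hK : IsCompact K) (hKA : K ⊆ A) (hφ : ContinuousOn φ A)
    (hφi : InjOn φ A) (hφA : φ '' A = Metric.closedBall 0 1) (hφK : φ '' K = Metric.sphere 0 1)
    (hψ : ContinuousOn ψ K) (hψi : InjOn ψ K) (hψK : ψ '' K = Metric.sphere 0 1) :
    ∃ χ : X → ℂ, ContinuousOn χ A ∧ InjOn χ A ∧ χ '' A = Metric.closedBall 0 1 ∧
      EqOn χ ψ K := by
  obtain ⟨x₀, -⟩ : K.Nonempty := by
    rw [← image_nonempty (f := φ), hφK]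
    exact ⟨1, by simp⟩
  have : Nonempty X := ⟨x₀⟩
  have hφiK := hφi.mono hKA
  -- The transition map on the circle between the two boundary parametrizations; composing `φ` with
  -- its radial extension corrects the boundary values to `ψ`.
  set η : ℂ → ℂ := ψ ∘ Function.invFunOn φ K with hη
  have ηφ : ∀ x ∈ K, η (φ x) = ψ x := fun x hx => by
    rw [hη, Function.comp_apply, hφiK.leftInvOn_invFunOn hx]
  have hs : η '' Metric.sphere 0 1 = Metric.sphere 0 1 := by
    rw [← hφK, ← image_comp, hφK, ← hψK]
    exact image_congr ηφ
  have hm : MapsTo η (Metric.sphere 0 1) (Metric.sphere 0 1) := fun z hz =>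
    hs ▸ mem_image_of_mem η hz
  have hi : InjOn η (Metric.sphere 0 1) := by
    rw [← hφK]
    rintro _ ⟨x, hx, rfl⟩ _ ⟨y, hy, rfl⟩ h
    rw [ηφ x hx, ηφ y hy] at h
    rw [hψi hx hy h]
  have hc : ContinuousOn η (Metric.sphere 0 1) := by
    refine hψ.comp (hφK ▸ hK.continuousOn_invFunOn (hφ.mono hKA) hφiK) ?_
    rw [← hφK]
    rintro _ ⟨x, hx, rfl⟩
    rwa [hφiK.leftInvOn_invFunOn hx]
  refine ⟨radial η ∘ φ, (continuous_radial hc hm).comp_continuousOn hφ,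
    (injective_radial hi hm).comp_injOn hφi, by rw [image_comp, hφA, image_radial hs], ?_⟩
  intro x hx
  have : ‖φ x‖ = 1 := mem_sphere_zero_iff_norm.1 (hφK ▸ mem_image_of_mem φ hx)
  rw [Function.comp_apply, radial_of_norm this, ηφ x hx]

/-- The point of the sphere above (`s = 1`) or below (`s = -1`) a point of the disc. -/
noncomputable def hemisphere (s : ℝ) (z : ℂ) : EuclideanSpace ℝ (Fin 3) :=
  !₂[z.re, z.im, s * √(1 - ‖z‖ ^ 2)]

theorem continuous_hemisphere (s : ℝ) : Continuous (hemisphere s) := by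
  unfold hemisphere
  refine (PiLp.continuous_toLp 2 _).comp (continuous_pi fun i => ?_)
  fin_cases i
  · exact Complex.continuous_re
  · exact Complex.continuous_im
  · exact continuous_const.mul (Real.continuous_sqrt.comp (by fun_prop))

theorem hemisphere_inj {s t : ℝ} (h : hemisphere s z = hemisphere t w) :
    z = w ∧ s * √(1 - ‖z‖ ^ 2) = t * √(1 - ‖w‖ ^ 2) := by
  have key : ∀ i, hemisphere s z i = hemisphere t w i := fun i => by rw [h]
  exact ⟨Complex.ext (key 0) (key 1), key 2⟩

theorem hemisphere_mem {s : ℝ} (hs : s ^ 2 = 1) (hz : z ∈ Metric.closedBall (0 : ℂ) 1) :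
    hemisphere s z ∈ Metric.sphere (0 : EuclideanSpace ℝ (Fin 3)) 1 := by
  have h1 : ‖z‖ ^ 2 ≤ 1 := pow_le_one₀ (norm_nonneg _) (mem_closedBall_zero_iff.1 hz)
  rw [mem_sphere_zero_iff_norm, EuclideanSpace.norm_eq, Real.sqrt_eq_one, Fin.sum_univ_three]
  simp only [Real.norm_eq_abs, sq_abs]
  change z.re ^ 2 + z.im ^ 2 + (s * √(1 - ‖z‖ ^ 2)) ^ 2 = 1
  rw [mul_pow, hs, Real.sq_sqrt (by linarith), Complex.sq_norm, Complex.normSq_apply]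
  ring

theorem exists_hemisphere (p : EuclideanSpace ℝ (Fin 3)) (hp : p ∈ Metric.sphere 0 1) :
    ∃ z ∈ Metric.closedBall (0 : ℂ) 1, (hemisphere 1 z = p) ∨ hemisphere (-1) z = p := by
  rw [mem_sphere_zero_iff_norm, EuclideanSpace.norm_eq, Real.sqrt_eq_one, Fin.sum_univ_three] at hp
  simp only [Real.norm_eq_abs, sq_abs] at hp
  have hz : ‖(⟨p 0, p 1⟩ : ℂ)‖ ^ 2 = p 0 ^ 2 + p 1 ^ 2 := by
    rw [Complex.sq_norm, Complex.normSq_apply]; ring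
  have hs : 1 - ‖(⟨p 0, p 1⟩ : ℂ)‖ ^ 2 = p 2 ^ 2 := by rw [hz]; linarith
  refine ⟨⟨p 0, p 1⟩, ?_, ?_⟩
  · rw [mem_closedBall_zero_iff]
    refine (sq_le_one_iff₀ (norm_nonneg _)).1 ?_
    nlinarith [sq_nonneg (p 2)]
  · rcases le_or_gt 0 (p 2) with h | h
    · left
      ext i
      fin_cases i
      · rfl
      · rfl
      · change 1 * √(1 - ‖(⟨p 0, p 1⟩ : ℂ)‖ ^ 2) = p 2
        rw [hs, Real.sqrt_sq h, one_mul]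
    · right
      ext i
      fin_cases i
      · rfl
      · rfl
      · change -1 * √(1 - ‖(⟨p 0, p 1⟩ : ℂ)‖ ^ 2) = p 2
        rw [hs, Real.sqrt_sq_eq_abs, abs_of_neg h]
        ring

/-- A space that is the union of two closed discs with common boundary is a sphere. -/
theorem nonempty_homeomorph_sphere [CompactSpace X] (hA : IsClosed A) (hB : IsClosed B)
    (hAB : A ∪ B = univ) (hφ : ContinuousOn φ A) (hφi : InjOn φ A)
    (hφA : φ '' A = Metric.closedBall 0 1) (hφK : φ '' (A ∩ B) = Metric.sphere 0 1)
    (hψ : ContinuousOn ψ B) (hψi : InjOn ψ B) (hψB : ψ '' B = Metric.closedBall 0 1)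
    (hψK : ψ '' (A ∩ B) = Metric.sphere 0 1) :
    Nonempty (X ≃ₜ Metric.sphere (0 : EuclideanSpace ℝ (Fin 3)) 1) := by
  classical
  obtain ⟨χ, c1, c2, c3, c4⟩ := exists_adjusted_disc (hA.inter hB).isCompact inter_subset_left hφ
    hφi hφA hφK (hψ.mono inter_subset_right) (hψi.mono inter_subset_right) hψK
  have nK : ∀ x ∈ A ∩ B, ‖ψ x‖ = 1 := fun x hx =>
    mem_sphere_zero_iff_norm.1 (hψK ▸ mem_image_of_mem ψ hx)
  have nA : ∀ x ∈ A, ‖χ x‖ = 1 → x ∈ B := by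
    intro x hx h
    obtain ⟨y, hy, he⟩ := hψK.superset (mem_sphere_zero_iff_norm.2 h)
    rw [← c4 hy] at he
    exact c2 hy.1 hx he ▸ hy.2
  have mA : ∀ x ∉ B, x ∈ A := fun x hx => (hAB.superset (mem_univ x)).resolve_right hx
  have bA : ∀ x ∈ A, χ x ∈ Metric.closedBall (0 : ℂ) 1 := fun x hx =>
    c3 ▸ mem_image_of_mem χ hx
  set F : X → EuclideanSpace ℝ (Fin 3) :=
    fun x => if x ∈ B then hemisphere 1 (ψ x) else hemisphere (-1) (χ x) with hF
  have FB : EqOn F (hemisphere 1 ∘ ψ) B := fun x hx => if_pos hx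
  -- On the common boundary both parametrizations agree and have norm 1, so both formulas give the
  -- same point of the equator.
  have FA : EqOn F (hemisphere (-1) ∘ χ) A := by
    intro x hx
    by_cases hxB : x ∈ B
    · rw [FB hxB, Function.comp_apply, Function.comp_apply, c4 ⟨hx, hxB⟩, hemisphere, hemisphere,
        nK x ⟨hx, hxB⟩]
      norm_num
    · exact if_neg hxB
  have hFc : Continuous F := by
    rw [← continuousOn_univ, ← hAB]
    exact (((continuous_hemisphere _).comp_continuousOn c1).congr FA).union_of_isClosed
      (((continuous_hemisphere _).comp_continuousOn hψ).congr FB) hA hB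
  have hFm : ∀ x, F x ∈ Metric.sphere (0 : EuclideanSpace ℝ (Fin 3)) 1 := by
    intro x
    by_cases hx : x ∈ B
    · rw [FB hx]
      exact hemisphere_mem (by norm_num) (hψB ▸ mem_image_of_mem ψ hx)
    · rw [FA (mA x hx)]
      exact hemisphere_mem (by norm_num) (bA x (mA x hx))
  have cross : ∀ x ∈ B, ∀ y ∉ B, F x ≠ F y := by
    intro x hx y hy h
    rw [FB hx, FA (mA y hy)] at h
    obtain ⟨-, h2⟩ := hemisphere_inj h
    -- The last coordinates have opposite signs, so equality forces height 0; then `χ y` is on the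
    -- unit circle and `y` on the common boundary.
    have h3 : √(1 - ‖χ y‖ ^ 2) = 0 := by
      have e1 := Real.sqrt_nonneg (1 - ‖ψ x‖ ^ 2)
      have e2 := Real.sqrt_nonneg (1 - ‖χ y‖ ^ 2)
      linarith
    have h4 : ‖χ y‖ ≤ 1 := mem_closedBall_zero_iff.1 (bA y (mA y hy))
    rw [Real.sqrt_eq_zero (by nlinarith [norm_nonneg (χ y)])] at h3
    refine hy (nA y (mA y hy) ?_)
    nlinarith [norm_nonneg (χ y)]
  have hFi : Function.Injective F := by
    intro x y h
    by_cases hx : x ∈ B <;> by_cases hy : y ∈ B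
    · rw [FB hx, FB hy] at h
      exact hψi hx hy (hemisphere_inj h).1
    · exact absurd h (cross x hx y hy)
    · exact absurd h.symm (cross y hy x hx)
    · rw [FA (mA x hx), FA (mA y hy)] at h
      exact c2 (mA x hx) (mA y hy) (hemisphere_inj h).1
  have hFs : ∀ p ∈ Metric.sphere (0 : EuclideanSpace ℝ (Fin 3)) 1, ∃ x, F x = p := by
    intro p hp
    obtain ⟨z, hz, h | h⟩ := exists_hemisphere p hp
    · obtain ⟨x, hx, rfl⟩ := hψB.superset hz
      exact ⟨x, (FB hx).trans h⟩
    · obtain ⟨x, hx, rfl⟩ := c3.superset hz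
      exact ⟨x, (FA hx).trans h⟩
  set G : X → Metric.sphere (0 : EuclideanSpace ℝ (Fin 3)) 1 := fun x => ⟨F x, hFm x⟩ with hG
  have hGb : Function.Bijective G := by
    refine ⟨fun x y h => hFi (congrArg Subtype.val h), fun p => ?_⟩
    obtain ⟨x, hx⟩ := hFs p p.2
    exact ⟨x, Subtype.ext hx⟩
  exact ⟨Continuous.homeoOfEquivCompactToT2 (f := Equiv.ofBijective G hGb)
    (hFc.subtype_mk hFm)⟩

end Glue

/-! ### The sphere theorem -/

section Final

variable {X : Type*} [MetricSpace X] [CompactSpace X] {E : Set (Set X)} {J : Set X}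

theorem Axioms.nonempty_homeomorph_sphere (hE : Axioms E) (hJ : IsElementaryClosedCurve E J) :
    Nonempty (X ≃ₜ Metric.sphere (0 : EuclideanSpace ℝ (Fin 3)) 1) := by
  obtain ⟨U, V₀, -, hcomp⟩ := hJ.exists_doms hE
  have hU : Dom E J U := ⟨hJ, hcomp ▸ Or.inl rfl⟩
  obtain ⟨V, hV, -, -, hdis, hun⟩ := hU.exists_other hE
  obtain ⟨φ, p1, p2, p3, p4⟩ := hU.exists_disc hE
  obtain ⟨ψ, q1, q2, q3, q4⟩ := hV.exists_disc hE
  have hin : closure U ∩ closure V = J := by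
    rw [hU.closure_eq hE, hV.closure_eq hE, ← inter_union_distrib_right, hdis.inter_eq, empty_union]
  refine Moore.nonempty_homeomorph_sphere isClosed_closure isClosed_closure ?_ p1 p2 p3
    (hin ▸ p4) q1 q2 q3 (hin ▸ q4)
  rw [hU.closure_eq hE, hV.closure_eq hE, ← union_union_distrib_right, hun, compl_union_self]

end Final

end Moore

theorem mainTheorem6 {X : Type*} [TopologicalSpace X] [CompactSpace X] [ConnectedSpace X]
    [T2Space X] [SecondCountableTopology X] (E : Set (Set X))
    (hE : Moore.IsElementaryFamily E) (hJordan : Moore.JordanDomainAxiom E)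
    (hExtension : Moore.ExtensionAxiom E) (hCovering : Moore.CoveringAxiom E)
    (hClosed : ∃ J : Set X, Moore.IsElementaryClosedCurve E J) :
    Nonempty (X ≃ₜ Metric.sphere (0 : EuclideanSpace ℝ (Fin 3)) 1) := by
  -- A compact Hausdorff second countable space is metrizable; a metric is needed to speak of the
  -- mesh of nets.
  let _ : MetricSpace X := TopologicalSpace.metrizableSpaceMetric X
  obtain ⟨J, hJ⟩ := hClosed
  exact Moore.Axioms.nonempty_homeomorph_sphere ⟨hE, hJordan, hExtension, hCovering⟩ hJ
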